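/- **Model.** There are $K\ge 1$ users. In slot $t=0,1,2,\dots$ the vector $h(t)\in[0,\infty)^K$ of channel power gains is observed; the vectors $h(t)$ are i.i.d. with $\mathbb E[(\log_2(1+Ph_k))^2]<\infty$ for every $k$. Sets $I,J$ below are nonempty sets of users. For gains $h_1\ge\dots\ge h_K$ (after sorting the users) the capacity region $\Gamma(h)$ consists of the vectors $(R_J)_J\ge 0$ for which there are powers $p_k\ge 0$ with $\sum_k p_k\le P$ and, for $k=1,\dots,K$, $$\sum_{J\subseteq\{1,\dots,k\},\,k\in J}R_J\le\log_2\frac{1+h_k\sum_{j\le k}p_j}{1+h_k\sum_{j<k}p_j}.$$ Let $0\le m\le 1$ be the normalized cache size, $F>0$ the file size in bits, $T_{\rm slot}>0$ the number of channel uses per slot, and $b_{J,I}=F\,m^{|I|-1}(1-m)^{|J|-|I|+1}$ for $I\subseteq J$. An admissible policy chooses causally in every slot, possibly with randomization, integers $a_k(t)\in\{0,\dots,\gamma_{\max,k}\}$ (files admitted for user $k$), $\sigma_J(t)\in\{0,\dots,\sigma_{\max}\}$ (applications of decentralized coded caching to one file of each user in $J$) and $\mu(t)\in\Gamma(h(t))$.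 User queues (in files) and codeword queues (in bits) evolve by $$S_k(t+1)=\Big[S_k(t)-\sum_{J\ni k}\sigma_J(t)\Big]^++a_k(t),\qquad Q_I(t+1)=\big[Q_I(t)-T_{\rm slot}\mu_I(t)\big]^++\sum_{J\supseteq I}b_{J,I}\sigma_J(t).$$ The initial queues have finite second moments. If a user queue holds fewer files than the number of combinations to be formed, the missing files are replaced by dummies. Codeword queues are first in, first out, codewords generated in the same slot counting as one batch. A file of user $k$ combined with the set $J$ is delivered once all codewords of positive size that were generated with it for the sets $I$, $k\in I\subseteq J$, have been sent. Let $D_k(T)$ be the number of files delivered to user $k$ in the first $T$ slots. The delivery rate of user $k$ is $\liminf_T\frac1T\mathbb E[D_k(T)]$, and $\Lambda^{CC}$ is the set of the vectors of delivery rates of all admissible policies. A policy is stable if $\limsup_T\frac1T\sum_{t<T}\mathbb E[X(t)]<\infty$ for every user queue and every codeword queue $X$. **Policy.** Let $\alpha_k\ge 0$, $d_k>0$, $V>0$, and let $g_k(x)=\frac{(d_k+x)^{1-\alpha_k}}{1-\alpha_k}$ if $\alpha_k\ne 1$ and $g_k(x)=\log(1+x/d_k)$ if $\alpha_k=1$.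 The proposed policy maintains virtual queues $U_k(t+1)=[U_k(t)-a_k(t)]^++\gamma_k(t)$, with nonnegative initial values of finite second moment, and uses, with arbitrary causal tie-breaking, $$\gamma_k(t)\in\arg\max_{0\le x\le\gamma_{\max,k}}\big[Vg_k(x)-U_k(t)x\big],\qquad a_k(t)=\gamma_{\max,k}\mathbf 1\{U_k(t)\ge S_k(t)\},$$ $$\sigma_J(t)=\sigma_{\max}\mathbf 1\Big\{\sum_{k\in J}S_k(t)>\sum_{I\subseteq J}\frac{b_{J,I}}{F^2}Q_I(t)\Big\},\qquad \mu(t)\in\arg\max_{r\in\Gamma(h(t))}\sum_J Q_J(t)r_J .$$ **Constants.** Put $$B=\sum_k\Big(\gamma_{\max,k}^2+\tfrac12\Big(\sum_{I\ni k}\sigma_{\max}\Big)^2\Big)+\frac1{2F^2}\sum_I\Big(\sum_{J\supseteq I}\sigma_{\max}b_{J,I}\Big)^2+\frac{T_{\rm slot}^2}{2F^2}\sum_I\sum_{k\in I}\mathbb E\big[(\log_2(1+Ph_k))^2\big].$$ Let $\varepsilon_0$ be the supremum of all $\varepsilon$ such that an additional load of $\varepsilon$ at every virtual queue, user queue and codeword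 queue can be supported by a static policy, i.e. there are $\bar a_k\le\gamma_{\max,k}$, $\bar\sigma_J\in[0,\sigma_{\max}]$ and a measurable selection $r(h)\in\Gamma(h)$ with $$\varepsilon\le\bar a_k,\qquad \bar a_k+\varepsilon\le\sum_{J\ni k}\bar\sigma_J,\qquad \sum_{J\supseteq I}b_{J,I}\bar\sigma_J+\varepsilon\le T_{\rm slot}\,\mathbb E[r_I(h)]\qquad\text{for all }k\text{ and }I.$$ **Theorem.** Let $D_k$ and the queues be those of the proposed policy. 1. Let $r$ be the vector of delivery rates of a stable admissible policy, or let $\gamma_{\max,k}\le\sigma_{\max}$ for all $k$ and $r\in\Lambda^{CC}$ be arbitrary. Then $$\liminf_{T\to\infty}\sum_k g_k\Big(\tfrac1T\mathbb E[D_k(T)]\Big)\ \ge\ \sum_k g_k(r_k)-\frac BV .$$ In particular, if $\frac1T\mathbb E[D_k(T)]\to\bar r^\pi_k$ for every $k$, then $\sum_kg_k(\bar r^\pi_k)\ge\sum_kg_k(r_k)-\frac BV$. 2. If $\varepsilon_0>0$, then the total queue length $\hat Q(t)=\sum_k(U_k(t)+S_k(t))+\sum_I Q_I(t)/F^2$ satisfies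 $$\limsup_{T\to\infty}\frac1T\sum_{t=0}^{T-1}\mathbb E[\hat Q(t)]\ \le\ \frac{B+V\sum_k\big(g_k(\gamma_{\max,k})-g_k(0)\big)}{\varepsilon_0},$$ and, if all $\alpha_k\le 1$ (so that $g_k\ge 0$), the left-hand side is also at most $\big(B+V\sum_kg_k(\gamma_{\max,k})\big)/\varepsilon_0$. -/

import Mathlib

open MeasureTheory ProbabilityTheory Filter
open scoped NNReal

namespace CodedCaching

/-- Nonempty subsets of the set of users `{0, …, K-1}`. -/
abbrev UserSet (K : ℕ) := {J : Finset (Fin K) // J.Nonempty}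

/-- The alpha-fair utility function with parameters `α` and `d`. -/
noncomputable def utility (α d x : ℝ) : ℝ :=
  if α = 1 then Real.log (1 + x / d) else (d + x) ^ (1 - α) / (1 - α)

/-- The capacity region `Γ(h)` (in bits per channel use) of the degraded Gaussian broadcast channel
with power `P` and power gains `h`, with one message for every nonempty set of users.
The permutation `ord` lists the users by decreasing gain (`ord i` is the `i`-th strongest user), and
the rates that are summed in the `i`-th constraint are those of the sets whose weakest member, in
this order, is `ord i`. -/
def capacityRegion {K : ℕ} (P : ℝ) (h : Fin K → ℝ≥0) : Set (UserSet K → ℝ) :=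
  {R | (∀ J, 0 ≤ R J) ∧
    ∃ ord : Equiv.Perm (Fin K), Antitone (fun i => h (ord i)) ∧
    ∃ p : Fin K → ℝ, (∀ i, 0 ≤ p i) ∧ ∑ i, p i ≤ P ∧
      ∀ i : Fin K,
        ∑ J : UserSet K with ord i ∈ J.1 ∧ ∀ j ∈ J.1, ord.symm j ≤ i, R J ≤
          Real.logb 2 ((1 + (h (ord i) : ℝ) * ∑ j with j ≤ i, p j) /
            (1 + (h (ord i) : ℝ) * ∑ j with j < i, p j))}

/-- The parameters of the system with `K` users. -/
structure System (K : ℕ) where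
  /-- normalized cache memory -/
  m : ℝ
  /-- file size in bits -/
  F : ℝ
  /-- number of channel uses per slot -/
  Tslot : ℝ
  /-- transmit power -/
  P : ℝ
  /-- largest number of combinations per slot and set of users -/
  σmax : ℕ
  /-- largest number of admitted files per slot, for each user -/
  γmax : Fin K → ℕ
  /-- law of the vector of channel gains in one slot -/
  ν : Measure (Fin K → ℝ≥0)
  m_nonneg : 0 ≤ m
  m_le_one : m ≤ 1
  F_pos : 0 < F
  Tslot_pos : 0 < Tslot
  P_pos : 0 < P
  isProbabilityMeasure : IsProbabilityMeasure ν
  integrable_sq : ∀ k, Integrable (fun h => (Real.logb 2 (1 + P * (h k : ℝ))) ^ 2) ν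

namespace System

variable {K : ℕ} (sys : System K)

/-- `b_{J,I}`: the number of bits of the codeword for the users in `I ⊆ J` when decentralized coded
caching is applied to one file for each user in `J`; it is the size of a part of a file that is
stored, among the users in `J`, exactly by the members of `I` other than its addressee. -/
noncomputable def b (J I : UserSet K) : ℝ :=
  sys.m ^ (I.1.card - 1) * (1 - sys.m) ^ (J.1.card - I.1.card + 1) * sys.F

/-- The constant `B` of the utility-delay tradeoff. -/
noncomputable def B : ℝ :=
  ∑ k : Fin K, ((sys.γmax k : ℝ) ^ 2
      + 1 / 2 * (∑ I : UserSet K with k ∈ I.1, (sys.σmax : ℝ)) ^ 2)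
    + 1 / (2 * sys.F ^ 2) *
      ∑ I : UserSet K, (∑ J : UserSet K with I.1 ⊆ J.1, (sys.σmax : ℝ) * sys.b J I) ^ 2
    + sys.Tslot ^ 2 / (2 * sys.F ^ 2) *
      ∑ I : UserSet K, ∑ k ∈ I.1, ∫ h, (Real.logb 2 (1 + sys.P * (h k : ℝ))) ^ 2 ∂sys.ν

/-- `ε` is a slack of the network if some static policy, with mean admissions `abar`, mean numbers
of combinations `sbar` and transmission rates `r h` when the channel state is `h`, can support an
additional load of `ε` at every virtual queue, user queue and codeword queue. -/
def IsSlack (ε : ℝ) : Prop :=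
  ∃ (abar : Fin K → ℝ) (sbar : UserSet K → ℝ) (r : (Fin K → ℝ≥0) → UserSet K → ℝ),
    Measurable r ∧ (∀ h, r h ∈ capacityRegion sys.P h) ∧
    (∀ k, abar k ≤ sys.γmax k) ∧ (∀ J, 0 ≤ sbar J ∧ sbar J ≤ sys.σmax) ∧
    (∀ k, ε ≤ abar k) ∧
    (∀ k, abar k + ε ≤ ∑ J : UserSet K with k ∈ J.1, sbar J) ∧
    (∀ I : UserSet K, ∑ J : UserSet K with I.1 ⊆ J.1, sys.b J I * sbar J + ε
      ≤ sys.Tslot * ∫ h, r h I ∂sys.ν)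

/-- The constant `ε₀`: the largest slack. -/
noncomputable def eps0 : ℝ := sSup {ε : ℝ | sys.IsSlack ε}

end System

/-- A trajectory of channel states and decisions (together with the initial queue lengths). -/
structure Trajectory (K : ℕ) (Ω : Type*) where
  /-- initial user queues, in files -/
  S₀ : Ω → Fin K → ℕ
  /-- initial codeword queues, in bits -/
  Q₀ : Ω → UserSet K → ℝ
  /-- channel gains -/
  h : ℕ → Ω → Fin K → ℝ≥0
  /-- numbers of admitted files -/
  a : ℕ → Ω → Fin K → ℕ
  /-- numbers of combinations for each set of users -/
  σ : ℕ → Ω → UserSet K → ℕ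
  /-- `x t ω k J` is the number of those of the `σ t ω J` combinations that contain an actual file
  of user `k` (the others are formed with a dummy in place of a file of user `k`) -/
  x : ℕ → Ω → Fin K → UserSet K → ℕ
  /-- transmission rates, in bits per channel use -/
  μ : ℕ → Ω → UserSet K → ℝ

namespace Trajectory

variable {K : ℕ} {Ω : Type*} (sys : System K) (c : Trajectory K Ω)

/-- User queues, in files: `S(t+1) = [S(t) - ∑_{J ∋ k} σ_J(t)]⁺ + a_k(t)`
(the subtraction of natural numbers is the positive part of the difference). -/
def S : ℕ → Ω → Fin K → ℕ
  | 0, ω, k => c.S₀ ω k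
  | t + 1, ω, k => (S t ω k - ∑ J : UserSet K with k ∈ J.1, c.σ t ω J) + c.a t ω k

/-- The number of bits that enter the codeword queue `I` in slot `t`. -/
noncomputable def bitsIn (t : ℕ) (ω : Ω) (I : UserSet K) : ℝ :=
  ∑ J : UserSet K with I.1 ⊆ J.1, sys.b J I * (c.σ t ω J : ℝ)

/-- Codeword queues, in bits. -/
noncomputable def Q : ℕ → Ω → UserSet K → ℝ
  | 0, ω, I => c.Q₀ ω I
  | t + 1, ω, I => max (Q t ω I - sys.Tslot * c.μ t ω I) 0 + c.bitsIn sys t ω I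

/-- The number of bits that have left the codeword queue `I` before slot `s`. -/
noncomputable def bitsOut (s : ℕ) (ω : Ω) (I : UserSet K) : ℝ :=
  ∑ τ ∈ Finset.range s, min (c.Q sys τ ω I) (sys.Tslot * c.μ τ ω I)

/-- First in, first out: before slot `s`, queue `I` has sent its initial content and all that it
received in the slots up to and including slot `t`. -/
def Sent (s t : ℕ) (ω : Ω) (I : UserSet K) : Prop :=
  c.Q₀ ω I + ∑ τ ∈ Finset.range (t + 1), c.bitsIn sys τ ω I ≤ c.bitsOut sys s ω I

open Classical in
/-- `D_k(s)`: the number of files delivered to user `k` before slot `s`. A file of user `k` that was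
combined in slot `t` with the users in `J` is delivered once all the (nonempty) codewords for sets
`I` with `k ∈ I ⊆ J` that were formed with it have been sent. -/
noncomputable def D (s : ℕ) (ω : Ω) (k : Fin K) : ℕ :=
  ∑ t ∈ Finset.range s, ∑ J : UserSet K with k ∈ J.1,
    if ∀ I : UserSet K, k ∈ I.1 → I.1 ⊆ J.1 → sys.b J I ≠ 0 → c.Sent sys s t ω I
    then c.x t ω k J else 0

end Trajectory

/-- The trajectory is that of an admissible (causal, possibly randomized) policy on the probability
space `(Ω, Pr)`: `ℱ t` is the information available before slot `t`, the channel states are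
independent and identically distributed, and the decisions respect the constraints of the system. -/
structure IsAdmissible {K : ℕ} (sys : System K) {Ω : Type*} [mΩ : MeasurableSpace Ω]
    (Pr : Measure Ω) (ℱ : Filtration ℕ mΩ) (c : Trajectory K Ω) : Prop where
  measurable_S₀ : Measurable[ℱ 0] c.S₀
  measurable_Q₀ : Measurable[ℱ 0] c.Q₀
  integrable_S₀ : ∀ k, Integrable (fun ω => (c.S₀ ω k : ℝ) ^ 2) Pr
  integrable_Q₀ : ∀ I, Integrable (fun ω => c.Q₀ ω I ^ 2) Pr
  Q₀_nonneg : ∀ ω I, 0 ≤ c.Q₀ ω I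
  measurable_h : ∀ t, Measurable[ℱ (t + 1)] (c.h t)
  measurable_a : ∀ t, Measurable[ℱ (t + 1)] (c.a t)
  measurable_σ : ∀ t, Measurable[ℱ (t + 1)] (c.σ t)
  measurable_x : ∀ t, Measurable[ℱ (t + 1)] (c.x t)
  measurable_μ : ∀ t, Measurable[ℱ (t + 1)] (c.μ t)
  law_h : ∀ t, Measure.map (c.h t) Pr = sys.ν
  indep_h : ∀ t, Indep (ℱ t) (MeasurableSpace.comap (c.h t) inferInstance) Pr
  a_le : ∀ t ω k, c.a t ω k ≤ sys.γmax k
  σ_le : ∀ t ω J, c.σ t ω J ≤ sys.σmax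
  μ_mem : ∀ t ω, c.μ t ω ∈ capacityRegion sys.P (c.h t ω)
  x_le : ∀ t ω k J, c.x t ω k J ≤ c.σ t ω J
  x_eq_zero : ∀ t ω k (J : UserSet K), k ∉ J.1 → c.x t ω k J = 0
  x_sum : ∀ t ω k,
    ∑ J, c.x t ω k J = min (c.S t ω k) (∑ J : UserSet K with k ∈ J.1, c.σ t ω J)

/-- The mean number of files per slot delivered to user `k` in the first `T` slots. -/
noncomputable def meanDelivery {K : ℕ} (sys : System K) {Ω : Type*} [MeasurableSpace Ω]
    (Pr : Measure Ω) (c : Trajectory K Ω) (k : Fin K) (T : ℕ) : ℝ :=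
  (∫ ω, (c.D sys T ω k : ℝ) ∂Pr) / T

/-- The vector `r` is the vector of long-term (mean) delivery rates of the policy. -/
def HasDeliveryRates {K : ℕ} (sys : System K) {Ω : Type*} [MeasurableSpace Ω]
    (Pr : Measure Ω) (c : Trajectory K Ω) (r : Fin K → ℝ) : Prop :=
  ∀ k, r k = liminf (fun T : ℕ => meanDelivery sys Pr c k T) atTop

/-- Strong stability of all user queues and codeword queues. -/
def IsStable {K : ℕ} (sys : System K) {Ω : Type*} [MeasurableSpace Ω]
    (Pr : Measure Ω) (c : Trajectory K Ω) : Prop :=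
  (∀ k, limsup (fun T : ℕ => (((∑ t ∈ Finset.range T, ∫ ω, (c.S t ω k : ℝ) ∂Pr) / T : ℝ) : EReal))
    atTop < ⊤) ∧
  (∀ I, limsup (fun T : ℕ => (((∑ t ∈ Finset.range T, ∫ ω, c.Q sys t ω I ∂Pr) / T : ℝ) : EReal))
    atTop < ⊤)

/-- `Λ^CC`: the delivery rates of all admissible policies. -/
def feasibleRates {K : ℕ} (sys : System K) : Set (Fin K → ℝ) :=
  {r | ∃ (Ω : Type) (mΩ : MeasurableSpace Ω) (Pr : Measure Ω) (_ : IsProbabilityMeasure Pr)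
      (ℱ : Filtration ℕ mΩ) (c : Trajectory K Ω),
      IsAdmissible sys Pr ℱ c ∧ HasDeliveryRates sys Pr c r}

/-- The delivery rates of the admissible policies that keep all queues stable. -/
def stableRates {K : ℕ} (sys : System K) : Set (Fin K → ℝ) :=
  {r | ∃ (Ω : Type) (mΩ : MeasurableSpace Ω) (Pr : Measure Ω) (_ : IsProbabilityMeasure Pr)
      (ℱ : Filtration ℕ mΩ) (c : Trajectory K Ω),
      IsAdmissible sys Pr ℱ c ∧ IsStable sys Pr c ∧ HasDeliveryRates sys Pr c r}

/-- Virtual queues with initial lengths `U₀`, arrivals `γ` and services `a`: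
`U(t+1) = [U(t) - a(t)]⁺ + γ(t)`. -/
noncomputable def virtualQueue {K : ℕ} {Ω : Type*} (U₀ : Ω → Fin K → ℝ)
    (a : ℕ → Ω → Fin K → ℕ) (γ : ℕ → Ω → Fin K → ℝ) : ℕ → Ω → Fin K → ℝ
  | 0, ω, k => U₀ ω k
  | t + 1, ω, k => max (virtualQueue U₀ a γ t ω k - (a t ω k : ℝ)) 0 + γ t ω k

open Classical in
/-- The trajectory `c`, with virtual queues that start at `U₀` and have arrivals `γ`, follows the
proposed online policy with parameter `V` for the alpha-fair utilities with parameters `α k`, `d k`.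
Ties in the two maximizations may be broken in any (causal) way. -/
structure IsProposed {K : ℕ} (sys : System K) (V : ℝ) (α d : Fin K → ℝ)
    {Ω : Type*} [mΩ : MeasurableSpace Ω] (Pr : Measure Ω) (ℱ : Filtration ℕ mΩ)
    (c : Trajectory K Ω) (U₀ : Ω → Fin K → ℝ) (γ : ℕ → Ω → Fin K → ℝ) : Prop where
  admissible : IsAdmissible sys Pr ℱ c
  measurable_U₀ : Measurable[ℱ 0] U₀
  integrable_U₀ : ∀ k, Integrable (fun ω => U₀ ω k ^ 2) Pr
  U₀_nonneg : ∀ ω k, 0 ≤ U₀ ω k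
  measurable_γ : ∀ t, Measurable[ℱ (t + 1)] (γ t)
  γ_mem : ∀ t ω k, γ t ω k ∈ Set.Icc (0 : ℝ) (sys.γmax k)
  γ_max : ∀ t ω k, IsMaxOn
    (fun y : ℝ => V * utility (α k) (d k) y - virtualQueue U₀ c.a γ t ω k * y)
    (Set.Icc (0 : ℝ) (sys.γmax k)) (γ t ω k)
  admission : ∀ t ω k, c.a t ω k =
    if (c.S t ω k : ℝ) ≤ virtualQueue U₀ c.a γ t ω k then sys.γmax k else 0
  routing : ∀ t ω (J : UserSet K), c.σ t ω J =
    if ∑ I : UserSet K with I.1 ⊆ J.1, sys.b J I / sys.F ^ 2 * c.Q sys t ω I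
        < ∑ k ∈ J.1, (c.S t ω k : ℝ)
    then sys.σmax else 0
  scheduling : ∀ t ω, IsMaxOn (fun r : UserSet K → ℝ => ∑ J, c.Q sys t ω J * r J)
    (capacityRegion sys.P (c.h t ω)) (c.μ t ω)

/-- Total queue length: virtual queues, user queues, and codeword queues; the latter are measured in
units of `F²` bits, as in the routing rule. -/
noncomputable def totalQueue {K : ℕ} (sys : System K) {Ω : Type*} (c : Trajectory K Ω)
    (U₀ : Ω → Fin K → ℝ) (γ : ℕ → Ω → Fin K → ℝ) (t : ℕ) (ω : Ω) : ℝ :=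
  ∑ k, (virtualQueue U₀ c.a γ t ω k + (c.S t ω k : ℝ)) + ∑ I, c.Q sys t ω I / sys.F ^ 2

end CodedCaching

/-! The proof is a drift-plus-penalty argument combined with a converse for arbitrary policies. Half
the sum of the squared queue lengths (codeword queues in units of `F`) serves as Lyapunov function.
Up to the constant `B`, its expected one-step change is linear in the queue lengths, and each rule
of the policy optimizes its own share of this linear expression, the choice of the auxiliary rates
also counting `V` times the utility. Hence (`drift_le`) the drift is at most what any static choice
of auxiliary rates, admissions, combination numbers and mean transmission rates would give.

Static choices are then inserted. Zero shows that second moments grow at most linearly, so all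
queues are `o(T)` in mean. Target rates `r` supported by a static policy make all queue terms
nonpositive; telescoping leaves the utility of the auxiliary rates within `B / V` of that of `r`, up
to `O(1/T)`. By Jensen this passes to time averages, and by conservation of files and bits the
averaged auxiliary rates exceed the mean deliveries only by a vanishing amount. A static policy with
slack `ε` instead gives a drift of at most a constant minus `ε` times the total queue, whence the
backlog bound.

The substantial point is the converse `exists_isSupported`: achievable delivery rates are supported
by a static policy. Mean transmission rates of randomized decisions are handled by conditioning on
the channel, which leads into the hull of the capacity region. For a stable policy, time averages
along a subsequence with bounded mean backlog converge to a suitable choice. Without stability,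
combinations may be formed and never completely sent. A combination for `J` is then counted as one
for the set `A` of users to whom it is delivered; a codeword for `I'` becomes one for `I' ∩ A`. By
`b_eq_sum` the sizes match exactly, and all bits that count have really been sent. The rate used for
`I'` must be reassigned to subsets of `I'`, which the degraded channel allows
(`reassign_mem_capacityRegion`, based on `exists_power_reallocation`). The combination numbers so
obtained may exceed `σmax`; they can be capped because the rates are at most `γmax ≤ σmax`. -/

namespace CodedCaching

/-! ### Concavity, monotonicity and Lipschitz bounds of the utilities -/

section Utility

variable {α d : ℝ}

theorem hasDerivAt_utility (hd : 0 < d) {x : ℝ} (hx : -d < x) :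
    HasDerivAt (utility α d) ((d + x) ^ (-α)) x := by
  have hdx : 0 < d + x := by linarith
  by_cases h : α = 1
  · have e : utility α d = fun x => Real.log (1 + x / d) := by
      funext y; simp [utility, h]
    rw [e, h, Real.rpow_neg_one]
    have h1 : HasDerivAt (fun x : ℝ => 1 + x / d) (1 / d) x :=
      ((hasDerivAt_id x).div_const d).const_add 1
    have hne : 1 + x / d ≠ 0 := by
      have : 1 + x / d = (d + x) / d := by field_simp
      rw [this]; positivity
    convert h1.log hne using 1
    field_simp
  · have e : utility α d = fun x => (d + x) ^ (1 - α) / (1 - α) := by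
      funext y; simp [utility, h]
    rw [e]
    have h0 : 1 - α ≠ 0 := sub_ne_zero.mpr (Ne.symm h)
    have h1 : HasDerivAt (fun x : ℝ => d + x) 1 x := (hasDerivAt_id x).const_add d
    have h2 := (h1.rpow_const (p := 1 - α) (Or.inl hdx.ne')).div_const (1 - α)
    rwa [show 1 - α - 1 = -α by ring, one_mul, mul_div_cancel_left₀ _ h0] at h2

theorem continuousOn_utility (hd : 0 < d) : ContinuousOn (utility α d) (Set.Ici 0) := fun x hx =>
  (hasDerivAt_utility hd (by have : (0 : ℝ) ≤ x := hx; linarith)).continuousAt.continuousWithinAt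

theorem differentiableOn_utility (hd : 0 < d) :
    DifferentiableOn ℝ (utility α d) (interior (Set.Ici 0)) := fun x hx =>
  (hasDerivAt_utility hd (by
    have : (0 : ℝ) ≤ x := interior_subset hx
    linarith)).differentiableAt.differentiableWithinAt

theorem deriv_utility (hd : 0 < d) {x : ℝ} (hx : 0 ≤ x) :
    deriv (utility α d) x = (d + x) ^ (-α) :=
  (hasDerivAt_utility hd (by linarith)).deriv

theorem concaveOn_utility (hα : 0 ≤ α) (hd : 0 < d) :
    ConcaveOn ℝ (Set.Ici 0) (utility α d) := by
  refine AntitoneOn.concaveOn_of_deriv (convex_Ici 0) (continuousOn_utility hd)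
    (differentiableOn_utility hd) fun x hx y hy hxy => ?_
  have hx' : (0 : ℝ) ≤ x := interior_subset hx
  have hy' : (0 : ℝ) ≤ y := interior_subset hy
  rw [deriv_utility hd hx', deriv_utility hd hy']
  exact Real.rpow_le_rpow_of_nonpos (by linarith) (by linarith) (by linarith)

theorem monotoneOn_utility (hd : 0 < d) : MonotoneOn (utility α d) (Set.Ici 0) := by
  refine monotoneOn_of_deriv_nonneg (convex_Ici 0) (continuousOn_utility hd)
    (differentiableOn_utility hd) fun x hx => ?_
  have hx' : (0 : ℝ) ≤ x := interior_subset hx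
  rw [deriv_utility hd hx']
  positivity

theorem utility_sub_le (hα : 0 ≤ α) (hd : 0 < d) {x y : ℝ} (hx : 0 ≤ x) (hxy : x ≤ y) :
    utility α d y - utility α d x ≤ d ^ (-α) * (y - x) := by
  refine Convex.image_sub_le_mul_sub_of_deriv_le (convex_Ici 0) (continuousOn_utility hd)
    (differentiableOn_utility hd) (fun z hz => ?_) x hx y (hx.trans hxy) hxy
  have hz' : (0 : ℝ) ≤ z := interior_subset hz
  rw [deriv_utility hd hz']
  exact Real.rpow_le_rpow_of_nonpos hd (by linarith) (by linarith)

/-- If `y` exceeds `x` by at most `δ`, then its utility exceeds that of `x` by a multiple of `δ`. -/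
theorem utility_le_add (hα : 0 ≤ α) (hd : 0 < d) {x y δ : ℝ} (hx : 0 ≤ x) (hy : 0 ≤ y)
    (hδ : 0 ≤ δ) (h : y ≤ x + δ) : utility α d y ≤ utility α d x + d ^ (-α) * δ := by
  rcases le_total y x with hyx | hxy
  · have := monotoneOn_utility (α := α) hd hy hx hyx
    have : 0 ≤ d ^ (-α) * δ := by positivity
    linarith
  · have h1 := utility_sub_le hα hd hx hxy
    have : d ^ (-α) * (y - x) ≤ d ^ (-α) * δ :=
      mul_le_mul_of_nonneg_left (by linarith) (by positivity)
    linarith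

theorem utility_zero_nonneg (hα : α ≤ 1) (hd : 0 < d) : 0 ≤ utility α d 0 := by
  unfold utility
  split_ifs with h
  · simp
  · have : 0 < 1 - α := sub_pos.mpr (lt_of_le_of_ne hα h)
    positivity

end Utility

/-! ### The capacity region: bounds, closed graph, reassignment of rates -/

section Region

variable {K : ℕ}

/-- The position, in the order `ord`, of the weakest member of `J`. -/
noncomputable def weakest (ord : Equiv.Perm (Fin K)) (J : UserSet K) : Fin K :=
  J.1.sup' J.2 ord.symm

theorem weakest_eq_iff (ord : Equiv.Perm (Fin K)) (J : UserSet K) (i : Fin K) :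
    weakest ord J = i ↔ ord i ∈ J.1 ∧ ∀ j ∈ J.1, ord.symm j ≤ i := by
  constructor
  · rintro rfl
    refine ⟨?_, fun j hj => Finset.le_sup' _ hj⟩
    obtain ⟨j, hj, he⟩ := Finset.exists_mem_eq_sup' J.2 ord.symm
    unfold weakest
    rw [he]
    simpa using hj
  · rintro ⟨h1, h2⟩
    refine le_antisymm (Finset.sup'_le _ _ h2) ?_
    have := Finset.le_sup' ord.symm h1
    rwa [Equiv.symm_apply_apply] at this

theorem weakest_mono (ord : Equiv.Perm (Fin K)) {I J : UserSet K} (h : I.1 ⊆ J.1) :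
    weakest ord I ≤ weakest ord J :=
  Finset.sup'_mono _ h I.2

/-- The user is the weakest member of `I`: its constraint contains `r I` among nonnegative rates,
and dropping the interference and using full power only enlarges the right-hand side. -/
theorem rate_le_of_mem_capacityRegion {P : ℝ} {h : Fin K → ℝ≥0} {r : UserSet K → ℝ}
    (hr : r ∈ capacityRegion P h) (I : UserSet K) :
    ∃ k ∈ I.1, r I ≤ Real.logb 2 (1 + P * (h k : ℝ)) := by
  obtain ⟨h0, ord, -, p, hp, hpP, hc⟩ := hr
  have hw := (weakest_eq_iff ord I _).1 rfl
  refine ⟨_, hw.1, ?_⟩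
  set i := weakest ord I
  have h1 : r I ≤ ∑ J : UserSet K with ord i ∈ J.1 ∧ ∀ j ∈ J.1, ord.symm j ≤ i, r J :=
    Finset.single_le_sum (f := r) (fun J _ => h0 J) (by simpa using hw)
  refine (h1.trans (hc i)).trans ?_
  have hA : 0 ≤ ∑ j with j < i, p j := Finset.sum_nonneg fun j _ => hp j
  have hN : 0 ≤ ∑ j with j ≤ i, p j := Finset.sum_nonneg fun j _ => hp j
  have hN' : ∑ j with j ≤ i, p j ≤ P :=
    (Finset.sum_le_univ_sum_of_nonneg hp).trans hpP
  have hh : (0 : ℝ) ≤ h (ord i) := NNReal.coe_nonneg _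
  refine Real.logb_le_logb_of_le one_lt_two (by positivity) ?_
  refine (div_le_self (by positivity) (by nlinarith)).trans ?_
  nlinarith

theorem rate_sq_le_of_mem_capacityRegion {P : ℝ} {h : Fin K → ℝ≥0}
    {r : UserSet K → ℝ} (hr : r ∈ capacityRegion P h) (I : UserSet K) :
    r I ^ 2 ≤ ∑ k ∈ I.1, (Real.logb 2 (1 + P * (h k : ℝ))) ^ 2 := by
  obtain ⟨k, hk, hle⟩ := rate_le_of_mem_capacityRegion hr I
  refine (pow_le_pow_left₀ (hr.1 I) hle 2).trans ?_
  exact Finset.single_le_sum (f := fun k => (Real.logb 2 (1 + P * (h k : ℝ))) ^ 2)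
    (fun k _ => sq_nonneg _) hk

theorem rate_le_sum_logb {P : ℝ} (hP : 0 < P) {h : Fin K → ℝ≥0}
    {r : UserSet K → ℝ} (hr : r ∈ capacityRegion P h) (I : UserSet K) :
    r I ≤ ∑ k, Real.logb 2 (1 + P * (h k : ℝ)) := by
  obtain ⟨k, hk, hle⟩ := rate_le_of_mem_capacityRegion hr I
  refine hle.trans ?_
  exact Finset.single_le_sum (f := fun k => Real.logb 2 (1 + P * (h k : ℝ)))
    (fun k _ => Real.logb_nonneg one_lt_two (by
      have : (0 : ℝ) ≤ P * h k := by positivity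
      linarith)) (Finset.mem_univ k)

/-- For each of the finitely many orders, the graph is obtained from a closed set by projecting out
the power vector, which ranges over a compact set. Closedness provides the measurability needed to
disintegrate the pair of channel state and rates. -/
theorem isClosed_capacityRegion_graph (P : ℝ) :
    IsClosed {z : (Fin K → ℝ≥0) × (UserSet K → ℝ) | z.2 ∈ capacityRegion P z.1} := by
  let C : Set (Fin K → ℝ) := {p | (∀ i, 0 ≤ p i) ∧ ∑ i, p i ≤ P}
  have hC : IsCompact C := by
    refine (isCompact_univ_pi (fun _ : Fin K => isCompact_Icc (a := (0 : ℝ)) (b := P))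
      |>.of_isClosed_subset ?_ ?_)
    · refine IsClosed.inter ?_ ?_
      · change IsClosed {p : Fin K → ℝ | ∀ i, 0 ≤ p i}
        simp only [Set.ofPred_forall]
        exact isClosed_iInter fun i => isClosed_le continuous_const (continuous_apply i)
      · change IsClosed {p : Fin K → ℝ | ∑ i, p i ≤ P}
        exact isClosed_le (by fun_prop) continuous_const
    · intro p hp i _
      exact ⟨hp.1 i, (Finset.single_le_sum (f := p) (fun j _ => hp.1 j)
        (Finset.mem_univ i)).trans hp.2⟩
  have : CompactSpace C := isCompact_iff_compactSpace.1 hC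
  have key : ∀ ord : Equiv.Perm (Fin K),
      IsClosed {y : C × ((Fin K → ℝ≥0) × (UserSet K → ℝ)) | ∀ i : Fin K,
        ∑ J : UserSet K with ord i ∈ J.1 ∧ ∀ j ∈ J.1, ord.symm j ≤ i, y.2.2 J ≤
          Real.logb 2 ((1 + (y.2.1 (ord i) : ℝ) * ∑ j with j ≤ i, y.1.1 j) /
            (1 + (y.2.1 (ord i) : ℝ) * ∑ j with j < i, y.1.1 j))} := by
    intro ord
    simp only [Set.ofPred_forall]
    refine isClosed_iInter fun i => isClosed_le (by fun_prop) ?_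
    have pos : ∀ (s : Finset (Fin K)) (y : C × ((Fin K → ℝ≥0) × (UserSet K → ℝ))),
        0 < 1 + (y.2.1 (ord i) : ℝ) * ∑ j ∈ s, y.1.1 j := fun s y => by
      have : 0 ≤ ∑ j ∈ s, y.1.1 j := Finset.sum_nonneg fun j _ => y.1.2.1 j
      positivity
    have cont : ∀ s : Finset (Fin K), Continuous
        fun y : C × ((Fin K → ℝ≥0) × (UserSet K → ℝ)) =>
          1 + (y.2.1 (ord i) : ℝ) * ∑ j ∈ s, y.1.1 j := fun s => by
      fun_prop
    exact (((cont _).div (cont _) fun y => (pos _ y).ne').log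
      fun y => (div_pos (pos _ y) (pos _ y)).ne').div_const _
  have e : {z : (Fin K → ℝ≥0) × (UserSet K → ℝ) | z.2 ∈ capacityRegion P z.1} =
      {z | ∀ J, 0 ≤ z.2 J} ∩ ⋃ ord : Equiv.Perm (Fin K), {z | Antitone fun i => z.1 (ord i)} ∩
        Prod.snd '' {y : C × ((Fin K → ℝ≥0) × (UserSet K → ℝ)) | ∀ i : Fin K,
        ∑ J : UserSet K with ord i ∈ J.1 ∧ ∀ j ∈ J.1, ord.symm j ≤ i, y.2.2 J ≤
          Real.logb 2 ((1 + (y.2.1 (ord i) : ℝ) * ∑ j with j ≤ i, y.1.1 j) /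
            (1 + (y.2.1 (ord i) : ℝ) * ∑ j with j < i, y.1.1 j))} := by
    ext ⟨h, r⟩
    simp only [capacityRegion, Set.mem_ofPred_eq, Set.mem_inter_iff, Set.mem_iUnion, Set.mem_image]
    refine and_congr_right fun _ => exists_congr fun ord => and_congr_right fun _ => ?_
    constructor
    · rintro ⟨p, hp, hpP, hc⟩
      exact ⟨⟨⟨p, hp, hpP⟩, h, r⟩, hc, rfl⟩
    · rintro ⟨⟨⟨p, hp⟩, h', r'⟩, hc, he⟩
      obtain ⟨rfl, rfl⟩ := Prod.mk.inj he
      exact ⟨p, hp.1, hp.2, hc⟩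
  rw [e]
  refine IsClosed.inter ?_ (isClosed_iUnion_of_finite fun ord => IsClosed.inter ?_
    (isClosedMap_snd_of_compactSpace _ (key ord)))
  · simp only [Set.ofPred_forall]
    exact isClosed_iInter fun J => isClosed_le continuous_const (by fun_prop)
  · simp only [Antitone, Set.ofPred_forall]
    exact isClosed_iInter fun i => isClosed_iInter fun j => isClosed_iInter fun _ =>
      isClosed_le (by fun_prop) (by fun_prop)

theorem measurableSet_capacityRegion_graph (P : ℝ) :
    MeasurableSet {z : (Fin K → ℝ≥0) × (UserSet K → ℝ) | z.2 ∈ capacityRegion P z.1} :=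
  (isClosed_capacityRegion_graph P).measurableSet

/-- In a degraded channel, power can be reallocated when load is moved to stronger users. Users are
listed by decreasing gain, and `C i` is the total power of the users before `i`. -/
theorem exists_power_reallocation (n : ℕ) (h ρ' : ℕ → ℝ) (h0 : ∀ j, 0 ≤ h j)
    (hanti : ∀ i j, i ≤ j → j < n → h j ≤ h i) (hρ' : ∀ j, 0 ≤ ρ' j) (ρ C : ℕ → ℝ)
    (hC0 : 0 ≤ C 0) (hC : ∀ j < n, C j ≤ C (j + 1))
    (hρ : ∀ j < n, (2 : ℝ) ^ ρ j * (1 + h j * C j) ≤ 1 + h j * C (j + 1))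
    (htail : ∀ i ≤ n, ∑ j ∈ Finset.Ico i n, ρ' j ≤ ∑ j ∈ Finset.Ico i n, ρ j) :
    ∃ C' : ℕ → ℝ, 0 ≤ C' 0 ∧ C' n = C n ∧ (∀ j < n, C' j ≤ C' (j + 1)) ∧
      ∀ j < n, (2 : ℝ) ^ ρ' j * (1 + h j * C' j) ≤ 1 + h j * C' (j + 1) := by
  -- The weakest remaining user is treated first: it keeps the load `ρ' n`, and its surplus `e` is
  -- handed to the next stronger user.
  induction n generalizing ρ C with
  | zero => exact ⟨C, hC0, rfl, by simp, by simp⟩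
  | succ n ih =>
    have hCn : ∀ j ≤ n + 1, 0 ≤ C j := by
      intro j
      induction j with
      | zero => intro _; exact hC0
      | succ j ihj => intro hj; exact (ihj (by omega)).trans (hC j (by omega))
    have he : ρ' n ≤ ρ n := by simpa using htail n (by omega)
    set e := ρ n - ρ' n with he_def
    have he0 : 0 ≤ e := by linarith
    have hre : (1 : ℝ) ≤ 2 ^ e := Real.one_le_rpow one_le_two he0
    have hrρ : (1 : ℝ) ≤ 2 ^ ρ' n := Real.one_le_rpow one_le_two (hρ' n)
    have hsplit : (2 : ℝ) ^ ρ n = 2 ^ ρ' n * 2 ^ e := by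
      rw [← Real.rpow_add two_pos]; congr 1; simp [e]
    have hn := hρ n (by omega)
    rw [hsplit] at hn
    -- `c` is the new total power of the users before `n`. What remains up to `C (n + 1)` carries
    -- `ρ' n`, and the power between `C n` and `c` would carry `e` at the gain `h n`.
    obtain ⟨c, hc1, hc2, hc3, hc4⟩ : ∃ c, 2 ^ e * C n ≤ c ∧ c ≤ C (n + 1) ∧
        (2 : ℝ) ^ ρ' n * (1 + h n * c) ≤ 1 + h n * C (n + 1) ∧
        (2 : ℝ) ^ e * (1 + h n * C n) ≤ 1 + h n * c := by
      have hA := hCn n (by omega)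
      rcases (h0 n).eq_or_lt with hz | hpos
      -- With zero gain no positive rate is possible, so both factors equal one and nothing moves.
      · rw [← hz] at hn ⊢
        simp only [zero_mul, add_zero, mul_one] at hn ⊢
        have h1 : (2 : ℝ) ^ e = 1 := le_antisymm (by nlinarith) hre
        have h2 : (2 : ℝ) ^ ρ' n = 1 := le_antisymm (by nlinarith) hrρ
        exact ⟨C n, by rw [h1, one_mul], hC n (by omega), h2.le, h1.le⟩
      · have hr0 : (0 : ℝ) < 2 ^ ρ' n := by positivity
        set c := ((1 + h n * C (n + 1)) / 2 ^ ρ' n - 1) / h n with hcdef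
        have hce : 1 + h n * c = (1 + h n * C (n + 1)) / 2 ^ ρ' n := by
          rw [hcdef]; field_simp; ring
        have h3 : (2 : ℝ) ^ e * (1 + h n * C n) ≤ 1 + h n * c := by
          rw [hce, le_div_iff₀ hr0]; linarith
        refine ⟨c, ?_, ?_, ?_, h3⟩
        · by_contra! hlt
          nlinarith
        · have h4 : 1 + h n * c ≤ 1 + h n * C (n + 1) := by
            rw [hce]
            refine div_le_self ?_ hrρ
            have := hCn (n + 1) le_rfl
            positivity
          by_contra! hlt
          nlinarith
        · rw [hce]
          exact (mul_div_cancel₀ _ hr0.ne').le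
    have hcn : C n ≤ c := by nlinarith [hCn n (by omega)]
    -- User `n - 1` receives the surplus rate together with the power up to `c`. If `n = 0`, there
    -- is no such user and the surplus power is left unused below `C' 0`; this is why `C' 0` need
    -- not vanish.
    obtain ⟨C', h1, h2, h3, h4⟩ := ih (fun i j hij hj => hanti i j hij (by omega))
      (fun j => if j + 1 = n then ρ j + e else ρ j) (fun j => if j = n then c else C j)
      (by
        split_ifs
        · exact (hCn n (by omega)).trans hcn
        · exact hC0)
      (by
        intro j hj
        rw [if_neg hj.ne]
        split_ifs with hjn
        · exact (hC j (by omega)).trans (hjn ▸ hcn)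
        · exact hC j (by omega))
      (by
        intro j hj
        have hold := hρ j (by omega)
        rw [if_neg hj.ne]
        split_ifs with hjn
        · rw [Real.rpow_add two_pos, mul_comm ((2 : ℝ) ^ ρ j), mul_assoc]
          refine (mul_le_mul_of_nonneg_left hold (by positivity)).trans ?_
          rw [hjn]
          -- The bound `hc4` says `2 ^ e - 1 ≤ h n * (c - 2 ^ e * C n)`; by `hc1` the bracket is
          -- nonnegative, so the inequality persists at the larger gain `h j`.
          have hh : h n ≤ h j := hanti j n (by omega) (by omega)
          nlinarith
        · exact hold)
      (by
        intro i hi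
        rcases hi.eq_or_lt with rfl | hlt
        · simp
        · obtain ⟨m, rfl⟩ : ∃ m, n = m + 1 := ⟨n - 1, by omega⟩
          have := htail i (by omega)
          rw [Finset.sum_Ico_succ_top (by omega)] at this
          nth_rewrite 2 [Finset.sum_Ico_succ_top (by omega)] at this
          rw [Finset.sum_Ico_succ_top (a := i) (b := m)
            (f := fun j => if j + 1 = m + 1 then ρ j + e else ρ j) (by omega)]
          nth_rewrite 2 [Finset.sum_Ico_succ_top (by omega)] at this
          rw [Finset.sum_congr rfl (g := ρ) (fun j hj => if_neg (by
            have := (Finset.mem_Ico.1 hj).2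
            omega))]
          simp only [if_true]
          linarith)
    refine ⟨fun j => if j = n + 1 then C (n + 1) else C' j, by simpa using h1, by simp, ?_, ?_⟩
    · intro j hj
      dsimp only
      rw [if_neg (by omega)]
      split_ifs with hjn
      · obtain rfl : j = n := by omega
        simpa [h2] using hc2
      · exact h3 j (by omega)
    · intro j hj
      dsimp only
      rw [if_neg (by omega)]
      split_ifs with hjn
      · obtain rfl : j = n := by omega
        simpa [h2] using hc3
      · exact h4 j (by omega)

/-- The capacity region is closed under using part of the rate of the message for `I'` for messages
that are intended for subsets of `I'`. -/
theorem reassign_mem_capacityRegion {P : ℝ} {h : Fin K → ℝ≥0} {r : UserSet K → ℝ}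
    (hr : r ∈ capacityRegion P h) (θ : UserSet K → UserSet K → ℝ) (hθ0 : ∀ I' I, 0 ≤ θ I' I)
    (hθ : ∀ I' I, ¬ I.1 ⊆ I'.1 → θ I' I = 0) (hθ1 : ∀ I', ∑ I, θ I' I ≤ 1) :
    (fun I => ∑ I', θ I' I * r I') ∈ capacityRegion P h := by
  obtain ⟨h0, ord, hord, p, hp, hpP, hc⟩ := hr
  have h0' : ∀ I, 0 ≤ ∑ I', θ I' I * r I' := fun I =>
    Finset.sum_nonneg fun I' _ => mul_nonneg (hθ0 _ _) (h0 _)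
  refine ⟨h0', ord, hord, ?_⟩
  have hfilter : ∀ (f : UserSet K → ℝ) (i : Fin K),
      ∑ J : UserSet K with ord i ∈ J.1 ∧ ∀ j ∈ J.1, ord.symm j ≤ i, f J =
        ∑ J with weakest ord J = i, f J := fun _ i => by
    refine Finset.sum_congr (Finset.filter_congr fun J _ => (weakest_eq_iff ord J i).symm)
      fun _ _ => rfl
  simp only [hfilter] at hc ⊢
  -- Only the total rate per weakest member enters the constraints, so the region becomes a
  -- statement about one load per position.
  let load : (UserSet K → ℝ) → ℕ → ℝ := fun f n => ∑ J with (weakest ord J : ℕ) = n, f J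
  have hload : ∀ (f : UserSet K → ℝ) (i : Fin K),
      ∑ J with weakest ord J = i, f J = load f i := fun _ _ =>
    Finset.sum_congr (Finset.filter_congr fun J _ => Fin.ext_iff) fun _ _ => rfl
  have htail : ∀ (f : UserSet K → ℝ) (i : ℕ),
      ∑ n ∈ Finset.Ico i K, load f n = ∑ J with i ≤ (weakest ord J : ℕ), f J := fun f i => by
    simp only [load, Finset.sum_filter]
    rw [Finset.sum_comm]
    refine Finset.sum_congr rfl fun J _ => ?_
    rw [Finset.sum_ite_eq]
    simp [Finset.mem_Ico]
  let g : ℕ → ℝ := fun n => if hn : n < K then (h (ord ⟨n, hn⟩) : ℝ) else 0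
  have hg : ∀ i : Fin K, g i = h (ord i) := fun i => by simp [g]
  let C : ℕ → ℝ := fun n => ∑ j ∈ Finset.univ.filter fun j : Fin K => (j : ℕ) < n, p j
  have hClt : ∀ i : Fin K, ∑ j with j < i, p j = C i := fun i =>
    Finset.sum_congr (Finset.filter_congr fun j _ => Fin.lt_def) fun _ _ => rfl
  have hCle : ∀ i : Fin K, ∑ j with j ≤ i, p j = C (i + 1) := fun i =>
    Finset.sum_congr (Finset.filter_congr fun j _ => by rw [Fin.le_def, Nat.lt_succ_iff])
      fun _ _ => rfl
  have hCnn : ∀ n, 0 ≤ C n := fun n => Finset.sum_nonneg fun j _ => hp j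
  have hCmono : ∀ n, C n ≤ C (n + 1) := fun n =>
    Finset.sum_le_sum_of_subset_of_nonneg
      (fun j hj => by simp only [Finset.mem_filter, Finset.mem_univ, true_and] at hj ⊢; omega)
      fun j _ _ => hp j
  obtain ⟨C', h1, h2, h3, h4⟩ := exists_power_reallocation K g
    (load fun I => ∑ I', θ I' I * r I') (fun j => by dsimp only [g]; split_ifs <;> simp)
    (fun i j hij hj => by
      simp only [g, dif_pos hj, dif_pos (hij.trans_lt hj)]
      have hle : (⟨i, hij.trans_lt hj⟩ : Fin K) ≤ ⟨j, hj⟩ := hij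
      exact_mod_cast hord hle)
    (fun j => Finset.sum_nonneg fun J _ => h0' J) (load r) C (hCnn 0) (fun j _ => hCmono j)
    (fun j hj => by
      have := hc ⟨j, hj⟩
      rw [hload, hClt, hCle, ← hg] at this
      have hgj : 0 ≤ g j := by dsimp only [g]; split_ifs; simp
      have d0 : 0 < 1 + g j * C j := by have := hCnn j; positivity
      have n0 : 0 < 1 + g j * C (j + 1) := by have := hCnn (j + 1); positivity
      rw [Real.le_logb_iff_rpow_le one_lt_two (div_pos n0 d0), le_div_iff₀ d0] at this
      exact this)
    (fun i _ => by
      -- The weakest member of a subset of `I'` is never weaker than that of `I'`. Reassignment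
      -- therefore moves load towards stronger users and does not increase any tail sum.
      rw [htail, htail, Finset.sum_comm, Finset.sum_filter]
      refine Finset.sum_le_sum fun I' _ => ?_
      rw [← Finset.sum_mul]
      split_ifs with hi
      · refine mul_le_of_le_one_left (h0 _) (le_trans ?_ (hθ1 I'))
        exact Finset.sum_le_univ_sum_of_nonneg fun I => hθ0 _ _
      · rw [Finset.sum_eq_zero, zero_mul]
        intro I hI
        refine hθ _ _ fun hsub => hi ?_
        exact (Finset.mem_filter.1 hI).2.trans (weakest_mono ord hsub))
  let p' : Fin K → ℝ := fun i => C' (i + 1) - C' i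
  have hsum : ∀ n ≤ K, ∑ j ∈ Finset.univ.filter (fun j : Fin K => (j : ℕ) < n), p' j = C' n - C' 0 := by
    intro n
    induction n with
    | zero => simp
    | succ n ih =>
      intro hn
      have : (Finset.univ.filter fun j : Fin K => (j : ℕ) < n + 1) =
          insert ⟨n, hn⟩ (Finset.univ.filter fun j : Fin K => (j : ℕ) < n) := by
        ext j
        simp only [Finset.mem_filter, Finset.mem_univ, true_and, Finset.mem_insert, Fin.ext_iff]
        omega
      rw [this, Finset.sum_insert (by simp), ih (by omega)]
      simp [p']
  have hC'mono : ∀ n ≤ K, C' 0 ≤ C' n := by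
    intro n
    induction n with
    | zero => simp
    | succ n ih => intro hn; exact (ih (by omega)).trans (h3 n hn)
  refine ⟨p', fun i => sub_nonneg.2 (h3 i i.2), ?_, fun i => ?_⟩
  · have := hsum K le_rfl
    rw [Finset.filter_true_of_mem fun j _ => j.2] at this
    rw [this, h2]
    have : C K = ∑ j, p j := by
      simp only [C]; rw [Finset.filter_true_of_mem fun j _ => j.2]
    linarith
  · have e1 : ∑ j with j < i, p' j = C' i - C' 0 := by
      rw [← hsum i i.2.le]
      exact Finset.sum_congr (Finset.filter_congr fun j _ => Fin.lt_def) fun _ _ => rfl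
    have e2 : ∑ j with j ≤ i, p' j = C' (i + 1) - C' 0 := by
      rw [← hsum (i + 1) i.2]
      exact Finset.sum_congr (Finset.filter_congr fun j _ => by rw [Fin.le_def, Nat.lt_succ_iff])
        fun _ _ => rfl
    have hgi : (0 : ℝ) ≤ h (ord i) := NNReal.coe_nonneg _
    have a1 := sub_nonneg.2 (hC'mono i i.2.le)
    have a2 := sub_nonneg.2 (hC'mono (i + 1) i.2)
    have d0 : 0 < 1 + (h (ord i) : ℝ) * (C' i - C' 0) := by positivity
    have n0 : 0 < 1 + (h (ord i) : ℝ) * (C' (i + 1) - C' 0) := by positivity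
    rw [hload, e1, e2, Real.le_logb_iff_rpow_le one_lt_two (div_pos n0 d0), le_div_iff₀ d0]
    have h5 := h4 i i.2
    rw [hg] at h5
    have h6 : (1 : ℝ) ≤ 2 ^ load (fun I => ∑ I', θ I' I * r I') i :=
      Real.one_le_rpow one_le_two (Finset.sum_nonneg fun J _ => h0' J)
    -- Removing the unused power `C' 0` lowers both cumulative powers by the same amount, which is
    -- harmless because the interference is multiplied by a factor of at least one.
    have h7 : 0 ≤ ((2 : ℝ) ^ load (fun I => ∑ I', θ I' I * r I') i - 1) *
        ((h (ord i) : ℝ) * C' 0) := mul_nonneg (by linarith) (by positivity)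
    linarith

end Region

end CodedCaching

namespace CodedCaching

/-! ### Batches in a first-in, first-out queue -/

section Fifo

/-- The content that has been sent does not exceed the total service. -/
theorem sum_sent_le (f : ℕ → ℝ) (hf : ∀ t, 0 ≤ f t) {q B : ℝ} (hq : 0 ≤ q) (hB : 0 ≤ B)
    (P : ℕ → Prop) [DecidablePred P] (hP : ∀ t, P t ↔ q + ∑ τ ∈ Finset.range (t + 1), f τ ≤ B)
    (T : ℕ) : ∑ t ∈ Finset.range T, (if P t then f t else 0) ≤ B := by
  induction T with
  | zero => simpa using hB
  | succ T ih =>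
    by_cases h : P T
    · have h1 : ∑ t ∈ Finset.range (T + 1), (if P t then f t else 0) ≤
          ∑ t ∈ Finset.range (T + 1), f t :=
        Finset.sum_le_sum fun t _ => by split_ifs; exacts [le_rfl, hf t]
      have := (hP T).1 h
      linarith
    · rw [Finset.sum_range_succ, if_neg h, add_zero]
      exact ih

/-- The content of the batches that have not been sent completely exceeds the queue length by at
most the size of one batch. -/
theorem sum_not_sent_le (f : ℕ → ℝ) (hf : ∀ t, 0 ≤ f t) {q B C : ℝ} (hfC : ∀ t, f t ≤ C)
    (P : ℕ → Prop) [DecidablePred P] (hP : ∀ t, P t ↔ q + ∑ τ ∈ Finset.range (t + 1), f τ ≤ B)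
    (T : ℕ) : ∑ t ∈ Finset.range T, (if P t then 0 else f t) ≤
      C + max (q + ∑ t ∈ Finset.range T, f t - B) 0 := by
  have hC : 0 ≤ C := (hf 0).trans (hfC 0)
  have anti : ∀ T, q + ∑ t ∈ Finset.range T, f t ≤ B →
      ∑ t ∈ Finset.range T, (if P t then 0 else f t) = 0 := by
    intro T hT
    refine Finset.sum_eq_zero fun t ht => if_pos ((hP t).2 (le_trans ?_ hT))
    have : Finset.range (t + 1) ⊆ Finset.range T :=
      Finset.range_subset_range.2 (Finset.mem_range.1 ht)
    have := Finset.sum_le_sum_of_subset_of_nonneg this fun i _ _ => hf i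
    linarith
  induction T with
  | zero => simpa using add_nonneg hC (le_max_right _ _)
  | succ T ih =>
    by_cases h : P T
    · rw [anti _ ((hP T).1 h)]
      exact add_nonneg hC (le_max_right _ _)
    · have h' := not_le.1 (mt (hP T).2 h)
      rw [max_eq_left (by linarith)]
      rw [Finset.sum_range_succ, if_neg h]
      -- In the first case batch `T` is the first unsent one and may be partly sent, which costs the
      -- extra `C`; in the second, both sides grow by `f T`.
      rcases le_total (q + ∑ t ∈ Finset.range T, f t) B with hle | hle
      · rw [anti T hle]
        have := hfC T
        linarith
      · rw [max_eq_left (by linarith)] at ih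
        rw [Finset.sum_range_succ]
        linarith

end Fifo

/-! ### Codeword sizes and pathwise conservation of files and bits -/

namespace System

variable {K : ℕ} (sys : System K)

theorem b_nonneg (J I : UserSet K) : 0 ≤ sys.b J I := by
  have h1 := sys.m_nonneg
  have h2 := sub_nonneg.2 sys.m_le_one
  have h3 := sys.F_pos
  unfold System.b
  positivity

/-- The codewords of a combination for `J` that serve the members of `A ⊆ J` have the same total
sizes as those of a combination for `A`. -/
theorem b_eq_sum {A J I : UserSet K} (hAJ : A.1 ⊆ J.1) (hIA : I.1 ⊆ A.1) :
    sys.b A I = ∑ I' : UserSet K with I'.1 ⊆ J.1 ∧ I'.1 ∩ A.1 = I.1, sys.b J I' := by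
  have hcard : ∀ E ∈ (J.1 \ A.1).powerset, (I.1 ∪ E).card = I.1.card + E.card := fun E hE => by
    refine Finset.card_union_of_disjoint (Finset.disjoint_left.2 fun k hk hkE => ?_)
    exact (Finset.mem_sdiff.1 (Finset.mem_powerset.1 hE hkE)).2 (hIA hk)
  have hI : 0 < I.1.card := I.2.card_pos
  have hIA' : I.1.card ≤ A.1.card := Finset.card_le_card hIA
  have hJA : (J.1 \ A.1).card = J.1.card - A.1.card := Finset.card_sdiff_of_subset hAJ
  have hAJ' : A.1.card ≤ J.1.card := Finset.card_le_card hAJ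
  have h1 : ∑ E ∈ (J.1 \ A.1).powerset, sys.m ^ ((I.1 ∪ E).card - 1) *
      (1 - sys.m) ^ (J.1.card - (I.1 ∪ E).card + 1) * sys.F = sys.b A I := by
    -- The sets `I'` are the unions of `I` with subsets of `J \ A`, and the binomial sum of `m` and
    -- `1 - m` over these subsets is one.
    have h2 := Finset.sum_pow_mul_eq_add_pow sys.m (1 - sys.m) (J.1 \ A.1)
    rw [add_sub_cancel, one_pow] at h2
    refine Eq.trans ?_ ((congrArg (sys.b A I * ·) h2).trans (mul_one _))
    rw [Finset.mul_sum]
    unfold System.b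
    refine Finset.sum_congr rfl fun E hE => ?_
    have hE' := Finset.card_le_card (Finset.mem_powerset.1 hE)
    rw [hcard E hE, show I.1.card + E.card - 1 = (I.1.card - 1) + E.card by omega,
      show J.1.card - (I.1.card + E.card) + 1 =
        (A.1.card - I.1.card + 1) + ((J.1 \ A.1).card - E.card) by omega, pow_add, pow_add]
    ring
  rw [← h1]
  symm
  refine Finset.sum_bij' (fun I' _ => I'.1 \ A.1)
    (fun E _ => ⟨I.1 ∪ E, I.2.mono Finset.subset_union_left⟩) ?_ ?_ ?_ ?_ ?_
  · intro I' hI'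
    exact Finset.mem_powerset.2 (Finset.sdiff_subset_sdiff (Finset.mem_filter.1 hI').2.1 subset_rfl)
  · intro E hE
    have hE' := Finset.mem_powerset.1 hE
    refine Finset.mem_filter.2 ⟨Finset.mem_univ _, ?_, ?_⟩
    · exact Finset.union_subset (hIA.trans hAJ) (hE'.trans Finset.sdiff_subset)
    · ext k
      simp only [Finset.mem_inter, Finset.mem_union]
      constructor
      · rintro ⟨h | h, hA⟩
        exacts [h, absurd hA (Finset.mem_sdiff.1 (hE' h)).2]
      · exact fun h => ⟨Or.inl h, hIA h⟩
  · intro I' hI'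
    refine Subtype.ext ?_
    dsimp only
    rw [← (Finset.mem_filter.1 hI').2.2, Finset.union_comm, Finset.sdiff_union_inter]
  · intro E hE
    have hE' := Finset.mem_powerset.1 hE
    ext k
    simp only [Finset.mem_sdiff, Finset.mem_union]
    constructor
    · rintro ⟨h | h, hA⟩
      exacts [absurd (hIA h) hA, h]
    · exact fun h => ⟨Or.inr h, (Finset.mem_sdiff.1 (hE' h)).2⟩
  · intro I' hI'
    have : I.1 ∪ I'.1 \ A.1 = I'.1 := by
      rw [← (Finset.mem_filter.1 hI').2.2, Finset.union_comm, Finset.sdiff_union_inter]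
    rw [this]
    rfl

/-- The largest number of bits that enter the codeword queue `I` in one slot. -/
noncomputable def bitsMax (I : UserSet K) : ℝ :=
  ∑ J : UserSet K with I.1 ⊆ J.1, (sys.σmax : ℝ) * sys.b J I

theorem bitsMax_nonneg (I : UserSet K) : 0 ≤ sys.bitsMax I :=
  Finset.sum_nonneg fun J _ => mul_nonneg (Nat.cast_nonneg _) (sys.b_nonneg J I)

theorem exists_pos_le_b : ∃ β > 0, ∀ J I, sys.b J I ≠ 0 → β ≤ sys.b J I := by
  have h : ∀ z : UserSet K × UserSet K, ∃ β > 0, sys.b z.1 z.2 ≠ 0 → β ≤ sys.b z.1 z.2 := by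
    intro z
    by_cases hz : sys.b z.1 z.2 = 0
    · exact ⟨1, one_pos, fun h => absurd hz h⟩
    · exact ⟨_, (sys.b_nonneg _ _).lt_of_ne' hz, fun _ => le_rfl⟩
  choose f hf hfb using h
  rcases isEmpty_or_nonempty (UserSet K × UserSet K) with hE | hE
  · exact ⟨1, one_pos, fun J I => (hE.false (J, I)).elim⟩
  · obtain ⟨z, hz⟩ := Finite.exists_min f
    exact ⟨f z, hf z, fun J I h => (hz (J, I)).trans (hfb _ h)⟩

end System

namespace Trajectory

variable {K : ℕ} {Ω : Type*}

theorem bitsIn_nonneg (sys : System K) (c : Trajectory K Ω) (t : ℕ) (ω : Ω) (I : UserSet K) :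
    0 ≤ c.bitsIn sys t ω I :=
  Finset.sum_nonneg fun J _ => mul_nonneg (sys.b_nonneg J I) (Nat.cast_nonneg _)

open Classical in
/-- The users in `J` whose files of the combinations for `J` of slot `t` are delivered before
slot `s`. -/
noncomputable def deliveredUsers (sys : System K) (c : Trajectory K Ω) (s t : ℕ) (ω : Ω)
    (J : UserSet K) : Finset (Fin K) :=
  J.1.filter fun k => ∀ I : UserSet K, k ∈ I.1 → I.1 ⊆ J.1 → sys.b J I ≠ 0 → c.Sent sys s t ω I

theorem deliveredUsers_subset (sys : System K) (c : Trajectory K Ω) (s t : ℕ) (ω : Ω)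
    (J : UserSet K) : c.deliveredUsers sys s t ω J ⊆ J.1 := by
  classical exact Finset.filter_subset _ _

theorem mem_deliveredUsers (sys : System K) (c : Trajectory K Ω) {s t : ℕ} {ω : Ω}
    {J : UserSet K} {k : Fin K} : k ∈ c.deliveredUsers sys s t ω J ↔ k ∈ J.1 ∧
      ∀ I : UserSet K, k ∈ I.1 → I.1 ⊆ J.1 → sys.b J I ≠ 0 → c.Sent sys s t ω I := by
  classical exact Finset.mem_filter

/-- The number of combinations that are delivered before slot `s` to exactly the users in `A`. -/
noncomputable def deliveredTo (sys : System K) (c : Trajectory K Ω) (s : ℕ) (ω : Ω)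
    (A : UserSet K) : ℝ :=
  ∑ t ∈ Finset.range s, ∑ J : UserSet K,
    if c.deliveredUsers sys s t ω J = A.1 then (c.σ t ω J : ℝ) else 0

/-- The number of bits in queue `I'`, of codewords that serve exactly the users in `I` among those
to which the combination is delivered before slot `s`. -/
noncomputable def usefulBits (sys : System K) (c : Trajectory K Ω) (s : ℕ) (ω : Ω)
    (I' I : UserSet K) : ℝ :=
  ∑ t ∈ Finset.range s, ∑ J : UserSet K with I'.1 ⊆ J.1,
    if I'.1 ∩ c.deliveredUsers sys s t ω J = I.1 then sys.b J I' * (c.σ t ω J : ℝ) else 0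

theorem deliveredTo_nonneg (sys : System K) (c : Trajectory K Ω) (s : ℕ) (ω : Ω)
    (A : UserSet K) : 0 ≤ c.deliveredTo sys s ω A :=
  Finset.sum_nonneg fun t _ => Finset.sum_nonneg fun J _ => by split_ifs <;> positivity

theorem usefulBits_nonneg (sys : System K) (c : Trajectory K Ω) (s : ℕ) (ω : Ω)
    (I' I : UserSet K) : 0 ≤ c.usefulBits sys s ω I' I :=
  Finset.sum_nonneg fun t _ => Finset.sum_nonneg fun J _ => by
    split_ifs
    exacts [mul_nonneg (sys.b_nonneg _ _) (Nat.cast_nonneg _), le_rfl]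

theorem usefulBits_eq_zero (sys : System K) (c : Trajectory K Ω) (s : ℕ) (ω : Ω)
    {I' I : UserSet K} (h : ¬ I.1 ⊆ I'.1) : c.usefulBits sys s ω I' I = 0 :=
  Finset.sum_eq_zero fun t _ => Finset.sum_eq_zero fun J _ =>
    if_neg fun he : I'.1 ∩ c.deliveredUsers sys s t ω J = I.1 =>
      h (he ▸ Finset.inter_subset_left)

/-- This holds combination by combination: one for `J` delivered exactly to `E` counts as one for
`E`, and `b_eq_sum` splits the size of its codeword for `I` over the codewords `I'` with `I' ∩ E =
I`. If `I` is not contained in `E`, both contributions vanish. -/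
theorem sum_b_mul_deliveredTo (sys : System K) (c : Trajectory K Ω) (s : ℕ) (ω : Ω)
    (I : UserSet K) :
    ∑ A : UserSet K with I.1 ⊆ A.1, sys.b A I * c.deliveredTo sys s ω A =
      ∑ I', c.usefulBits sys s ω I' I := by
  have key : ∀ t (J : UserSet K),
      ∑ A : UserSet K with I.1 ⊆ A.1, sys.b A I *
          (if c.deliveredUsers sys s t ω J = A.1 then (c.σ t ω J : ℝ) else 0) =
        ∑ I' : UserSet K, if I'.1 ⊆ J.1 then
          (if I'.1 ∩ c.deliveredUsers sys s t ω J = I.1 then sys.b J I' * (c.σ t ω J : ℝ) else 0)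
          else 0 := by
    intro t J
    set E := c.deliveredUsers sys s t ω J with hE
    have hEJ : E ⊆ J.1 := c.deliveredUsers_subset sys s t ω J
    by_cases hIE : I.1 ⊆ E
    · let A₀ : UserSet K := ⟨E, I.2.mono hIE⟩
      rw [Finset.sum_eq_single A₀]
      · rw [if_pos rfl, sys.b_eq_sum (A := A₀) hEJ hIE, Finset.sum_mul, Finset.sum_filter]
        refine Finset.sum_congr rfl fun I' _ => ?_
        rw [ite_and]
      · intro A _ hA
        rw [if_neg fun h => hA (Subtype.ext h.symm), mul_zero]
      · intro h
        exact (h (Finset.mem_filter.2 ⟨Finset.mem_univ A₀, hIE⟩)).elim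
    · rw [Finset.sum_eq_zero, Finset.sum_eq_zero]
      · intro I' _
        rw [if_neg (c := I'.1 ∩ E = I.1), ite_self]
        exact fun h => hIE (h ▸ Finset.inter_subset_right)
      · intro A hA
        rw [if_neg, mul_zero]
        exact fun h => hIE (h ▸ (Finset.mem_filter.1 hA).2)
  simp only [deliveredTo, usefulBits, Finset.mul_sum]
  rw [Finset.sum_comm]
  conv_rhs => rw [Finset.sum_comm]
  refine Finset.sum_congr rfl fun t _ => ?_
  rw [Finset.sum_comm]
  conv_rhs => simp only [Finset.sum_filter]; rw [Finset.sum_comm]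
  exact Finset.sum_congr rfl fun J _ => key t J

theorem bitsOut_le (sys : System K) (c : Trajectory K Ω) (s : ℕ) (ω : Ω) (I : UserSet K) :
    c.bitsOut sys s ω I ≤ sys.Tslot * ∑ τ ∈ Finset.range s, c.μ τ ω I := by
  rw [Finset.mul_sum]
  exact Finset.sum_le_sum fun τ _ => min_le_right _ _

/-- Conservation of bits: the truncation at zero in the queue recursion is matched by the minimum in
`bitsOut`. -/
theorem Q_add_bitsOut (sys : System K) (c : Trajectory K Ω) (s : ℕ) (ω : Ω) (I : UserSet K) :
    c.Q sys s ω I + c.bitsOut sys s ω I =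
      c.Q₀ ω I + ∑ τ ∈ Finset.range s, c.bitsIn sys τ ω I := by
  induction s with
  | zero => simp [Trajectory.Q, Trajectory.bitsOut]
  | succ s ih =>
    rw [Finset.sum_range_succ, ← add_assoc, ← ih]
    simp only [Trajectory.bitsOut, Finset.sum_range_succ, Trajectory.Q]
    rcases le_total (c.Q sys s ω I) (sys.Tslot * c.μ s ω I) with h | h
    · rw [min_eq_left h, max_eq_right (by linarith)]; ring
    · rw [min_eq_right h, max_eq_left (by linarith)]; ring

end Trajectory

namespace IsAdmissible

variable {K : ℕ} {sys : System K} {Ω : Type*} [mΩ : MeasurableSpace Ω]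
  {Pr : Measure Ω} {ℱ : Filtration ℕ mΩ} {c : Trajectory K Ω}
variable (hc : IsAdmissible sys Pr ℱ c)
include hc

theorem μ_nonneg (t : ℕ) (ω : Ω) (I : UserSet K) : 0 ≤ c.μ t ω I := (hc.μ_mem t ω).1 I

theorem bitsIn_le (t : ℕ) (ω : Ω) (I : UserSet K) : c.bitsIn sys t ω I ≤ sys.bitsMax I := by
  refine Finset.sum_le_sum fun J _ => ?_
  rw [mul_comm]
  exact mul_le_mul_of_nonneg_right (Nat.cast_le.2 (hc.σ_le t ω J)) (sys.b_nonneg J I)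

theorem Q_nonneg (t : ℕ) (ω : Ω) (I : UserSet K) : 0 ≤ c.Q sys t ω I := by
  cases t with
  | zero => exact hc.Q₀_nonneg ω I
  | succ t => exact add_nonneg (le_max_right _ _) (c.bitsIn_nonneg sys t ω I)

theorem bitsOut_nonneg (s : ℕ) (ω : Ω) (I : UserSet K) : 0 ≤ c.bitsOut sys s ω I :=
  Finset.sum_nonneg fun τ _ => le_min (hc.Q_nonneg τ ω I)
    (mul_nonneg sys.Tslot_pos.le (hc.μ_nonneg τ ω I))

theorem Q_le (s : ℕ) (ω : Ω) (I : UserSet K) :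
    c.Q sys s ω I ≤ c.Q₀ ω I + s * sys.bitsMax I := by
  have h1 := c.Q_add_bitsOut sys s ω I
  have h2 := hc.bitsOut_nonneg s ω I
  have h3 : ∑ τ ∈ Finset.range s, c.bitsIn sys τ ω I ≤ s * sys.bitsMax I := by
    simpa using Finset.sum_le_card_nsmul (Finset.range s) _ _ fun τ _ => hc.bitsIn_le τ ω I
  linarith

/-- Conservation of files: by `x_sum`, the actual files, without dummies, account for exactly what
the truncated subtraction removes. -/
theorem S_add_sum_x (s : ℕ) (ω : Ω) (k : Fin K) :
    c.S s ω k + ∑ t ∈ Finset.range s, ∑ J, c.x t ω k J =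
      c.S₀ ω k + ∑ t ∈ Finset.range s, c.a t ω k := by
  induction s with
  | zero => simp [Trajectory.S]
  | succ s ih =>
    rw [Finset.sum_range_succ, Finset.sum_range_succ, ← add_assoc (c.S₀ ω k), ← ih,
      hc.x_sum s ω k]
    simp only [Trajectory.S]
    omega

theorem S_le (s : ℕ) (ω : Ω) (k : Fin K) : c.S s ω k ≤ c.S₀ ω k + s * sys.γmax k := by
  have h1 := hc.S_add_sum_x s ω k
  have h2 : ∑ t ∈ Finset.range s, c.a t ω k ≤ s * sys.γmax k := by
    simpa using Finset.sum_le_card_nsmul (Finset.range s) _ _ fun τ _ => hc.a_le τ ω k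
  omega

theorem sum_x_eq (t : ℕ) (ω : Ω) (k : Fin K) :
    ∑ J : UserSet K with k ∈ J.1, c.x t ω k J = ∑ J, c.x t ω k J := by
  rw [Finset.sum_filter]
  refine Finset.sum_congr rfl fun J _ => ?_
  split_ifs with h
  exacts [rfl, (hc.x_eq_zero t ω k J h).symm]

theorem D_le_sum_x (s : ℕ) (ω : Ω) (k : Fin K) :
    c.D sys s ω k ≤ ∑ t ∈ Finset.range s, ∑ J, c.x t ω k J := by
  refine Finset.sum_le_sum fun t _ => ?_
  rw [← hc.sum_x_eq t ω k]
  exact Finset.sum_le_sum fun J _ => by split_ifs <;> simp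

theorem D_le_admitted (s : ℕ) (ω : Ω) (k : Fin K) :
    c.D sys s ω k ≤ c.S₀ ω k + s * sys.γmax k := by
  have h1 := hc.S_add_sum_x s ω k
  have h2 : ∑ t ∈ Finset.range s, c.a t ω k ≤ s * sys.γmax k := by
    simpa using Finset.sum_le_card_nsmul (Finset.range s) _ _ fun τ _ => hc.a_le τ ω k
  have h3 := hc.D_le_sum_x s ω k
  omega

theorem D_le_sum_σ (s : ℕ) (ω : Ω) (k : Fin K) :
    c.D sys s ω k ≤ ∑ t ∈ Finset.range s, ∑ J : UserSet K with k ∈ J.1, c.σ t ω J := by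
  refine (hc.D_le_sum_x s ω k).trans (Finset.sum_le_sum fun t _ => ?_)
  rw [← hc.sum_x_eq t ω k]
  exact Finset.sum_le_sum fun J _ => hc.x_le t ω k J

/-- A delivered file of `k` belongs to a combination whose set of served users contains `k`; that
set is the index `A` under which the combination is counted. -/
theorem D_le_sum_deliveredTo (s : ℕ) (ω : Ω) (k : Fin K) :
    (c.D sys s ω k : ℝ) ≤ ∑ A : UserSet K with k ∈ A.1, c.deliveredTo sys s ω A := by
  classical
  simp only [Trajectory.D, Trajectory.deliveredTo]
  conv_rhs => rw [Finset.sum_comm]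
  push_cast
  refine Finset.sum_le_sum fun t _ => ?_
  conv_rhs => rw [Finset.sum_comm]
  rw [Finset.sum_filter]
  refine Finset.sum_le_sum fun J _ => ?_
  have hnn : 0 ≤ ∑ A : UserSet K with k ∈ A.1,
      if c.deliveredUsers sys s t ω J = A.1 then (c.σ t ω J : ℝ) else 0 :=
    Finset.sum_nonneg fun A _ => by split_ifs <;> positivity
  split_ifs with hk hS
  · have hmem : k ∈ c.deliveredUsers sys s t ω J :=
      (c.mem_deliveredUsers sys).2 ⟨hk, hS⟩
    let A₀ : UserSet K := ⟨c.deliveredUsers sys s t ω J, ⟨k, hmem⟩⟩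
    have h1 := Finset.single_le_sum (f := fun A : UserSet K =>
      if c.deliveredUsers sys s t ω J = A.1 then (c.σ t ω J : ℝ) else 0)
      (s := Finset.univ.filter fun A : UserSet K => k ∈ A.1)
      (fun A _ => by split_ifs <;> positivity)
      (Finset.mem_filter.2 ⟨Finset.mem_univ A₀, hmem⟩)
    rw [if_pos (show c.deliveredUsers sys s t ω J = A₀.1 from rfl)] at h1
    exact (Nat.cast_le.2 (hc.x_le t ω k J)).trans h1
  · simpa using hnn
  · exact hnn

/-- A codeword for `I'` counts only if some member of `I'` has had its file delivered. Delivery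
requires this codeword to have been sent, unless it is empty and contributes no bits, so all counted
bits lie in sent batches. -/
theorem sum_usefulBits_le (s : ℕ) (ω : Ω) (I' : UserSet K) :
    ∑ I, c.usefulBits sys s ω I' I ≤ c.bitsOut sys s ω I' := by
  classical
  refine le_trans ?_ (sum_sent_le (fun t => c.bitsIn sys t ω I')
    (fun t => c.bitsIn_nonneg sys t ω I') (hc.Q₀_nonneg ω I') (hc.bitsOut_nonneg s ω I')
    (fun t => c.Sent sys s t ω I') (fun t => Iff.rfl) s)
  simp only [Trajectory.usefulBits]
  rw [Finset.sum_comm]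
  refine Finset.sum_le_sum fun t _ => ?_
  rw [Finset.sum_comm]
  have hb : ∀ J, 0 ≤ sys.b J I' * (c.σ t ω J : ℝ) := fun J =>
    mul_nonneg (sys.b_nonneg J I') (Nat.cast_nonneg _)
  have h1 : ∀ J ∈ Finset.univ.filter fun J : UserSet K => I'.1 ⊆ J.1,
      ∑ I : UserSet K, (if I'.1 ∩ c.deliveredUsers sys s t ω J = I.1
        then sys.b J I' * (c.σ t ω J : ℝ) else 0) ≤
      if c.Sent sys s t ω I' then sys.b J I' * (c.σ t ω J : ℝ) else 0 := by
    intro J hJ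
    by_cases hne : (I'.1 ∩ c.deliveredUsers sys s t ω J).Nonempty
    · rw [Finset.sum_eq_single ⟨_, hne⟩ (fun I _ hI => if_neg fun h => hI (Subtype.ext h.symm))
        (fun h => absurd (Finset.mem_univ _) h), if_pos rfl]
      split_ifs with hS
      · exact le_rfl
      · obtain ⟨k, hk⟩ := hne
        rw [Finset.mem_inter] at hk
        have : sys.b J I' = 0 := by
          by_contra hb0
          exact hS (((c.mem_deliveredUsers sys).1 hk.2).2 I' hk.1 (Finset.mem_filter.1 hJ).2 hb0)
        rw [this, zero_mul]
    · rw [Finset.sum_eq_zero]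
      · split_ifs
        exacts [hb J, le_rfl]
      · exact fun I _ => if_neg fun h : I'.1 ∩ c.deliveredUsers sys s t ω J = I.1 => hne (h ▸ I.2)
  refine (Finset.sum_le_sum h1).trans ?_
  unfold Trajectory.bitsIn
  split_ifs <;> simp

/-- The number of files that have left the user queue but have not been delivered is bounded by the
lengths of the codeword queues. -/
theorem sum_x_le_D_add {β : ℝ} (hβ : 0 < β) (hb : ∀ J I, sys.b J I ≠ 0 → β ≤ sys.b J I)
    (s : ℕ) (ω : Ω) (k : Fin K) :
    ∑ t ∈ Finset.range s, ∑ J, (c.x t ω k J : ℝ) ≤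
      c.D sys s ω k + (∑ I, (sys.bitsMax I + c.Q sys s ω I)) / β := by
  classical
  have h1 : ∀ I, ∑ t ∈ Finset.range s,
      (if c.Sent sys s t ω I then 0 else c.bitsIn sys t ω I) ≤ sys.bitsMax I + c.Q sys s ω I := by
    intro I
    have := sum_not_sent_le (fun t => c.bitsIn sys t ω I) (fun t => c.bitsIn_nonneg sys t ω I)
      (fun t => hc.bitsIn_le t ω I) (fun t => c.Sent sys s t ω I) (fun t => Iff.rfl) s
    rwa [← c.Q_add_bitsOut sys, add_sub_cancel_right, max_eq_left (hc.Q_nonneg s ω I)] at this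
  rw [← sub_le_iff_le_add', le_div_iff₀ hβ]
  refine le_trans ?_ (Finset.sum_le_sum fun I _ => h1 I)
  conv_rhs => rw [Finset.sum_comm]
  simp only [Trajectory.D]
  push_cast
  rw [← Finset.sum_sub_distrib, Finset.sum_mul]
  refine Finset.sum_le_sum fun t _ => ?_
  rw [show ∑ J, (c.x t ω k J : ℝ) = ∑ J : UserSet K with k ∈ J.1, (c.x t ω k J : ℝ) by
    exact_mod_cast (hc.sum_x_eq t ω k).symm, ← Finset.sum_sub_distrib, Finset.sum_mul]
  have h2 : ∀ I, (if c.Sent sys s t ω I then 0 else c.bitsIn sys t ω I) =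
      ∑ J : UserSet K, if I.1 ⊆ J.1 ∧ ¬ c.Sent sys s t ω I
        then sys.b J I * (c.σ t ω J : ℝ) else 0 := by
    intro I
    by_cases hS : c.Sent sys s t ω I
    · simp [hS]
    · simp [hS, Trajectory.bitsIn, Finset.sum_filter]
  rw [Finset.sum_congr rfl fun I _ => h2 I, Finset.sum_comm, Finset.sum_filter]
  refine Finset.sum_le_sum fun J _ => ?_
  have hnn : ∀ I : UserSet K, 0 ≤ if I.1 ⊆ J.1 ∧ ¬ c.Sent sys s t ω I
        then sys.b J I * (c.σ t ω J : ℝ) else 0 := fun I => by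
    split_ifs
    exacts [mul_nonneg (sys.b_nonneg J I) (Nat.cast_nonneg _), le_rfl]
  split_ifs with hk hS
  · simpa using Finset.sum_nonneg fun I _ => hnn I
  · push Not at hS
    -- Each undelivered combination is charged to one of its unsent codewords, which contains at
    -- least `β` bits per combination.
    obtain ⟨I, hkI, hIJ, hbI, hnS⟩ := hS
    refine le_trans ?_ (Finset.single_le_sum (fun I _ => hnn I) (Finset.mem_univ I))
    rw [if_pos ⟨hIJ, hnS⟩, sub_zero, mul_comm]
    exact mul_le_mul (hb J I hbI) (Nat.cast_le.2 (hc.x_le t ω k J)) (Nat.cast_nonneg _)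
      (sys.b_nonneg J I)
  · exact Finset.sum_nonneg fun I _ => hnn I

end IsAdmissible

end CodedCaching

/-! ### Measurability and moments of the queues and decisions -/

namespace CodedCaching

namespace System

variable {K : ℕ} (sys : System K)

/-- The sum over the users of the capacities with full power. -/
noncomputable def rateBound (h : Fin K → ℝ≥0) : ℝ := ∑ k, Real.logb 2 (1 + sys.P * (h k : ℝ))

theorem logb_nonneg (k : Fin K) (h : Fin K → ℝ≥0) :
    0 ≤ Real.logb 2 (1 + sys.P * (h k : ℝ)) :=
  Real.logb_nonneg one_lt_two (by
    have := sys.P_pos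
    have : (0 : ℝ) ≤ sys.P * h k := by positivity
    linarith)

theorem measurable_logb (k : Fin K) :
    Measurable fun h : Fin K → ℝ≥0 => Real.logb 2 (1 + sys.P * (h k : ℝ)) := by
  unfold Real.logb
  fun_prop

theorem memLp_logb (k : Fin K) :
    MemLp (fun h : Fin K → ℝ≥0 => Real.logb 2 (1 + sys.P * (h k : ℝ))) 2 sys.ν :=
  (memLp_two_iff_integrable_sq (sys.measurable_logb k).aestronglyMeasurable).2
    (sys.integrable_sq k)

theorem memLp_rateBound : MemLp sys.rateBound 2 sys.ν :=
  memLp_finsetSum _ fun k _ => sys.memLp_logb k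

theorem integrable_rateBound : Integrable sys.rateBound sys.ν :=
  have := sys.isProbabilityMeasure
  sys.memLp_rateBound.integrable one_le_two

theorem abs_rate_le {h : Fin K → ℝ≥0} {r : UserSet K → ℝ} (hr : r ∈ capacityRegion sys.P h)
    (I : UserSet K) : |r I| ≤ sys.rateBound h := by
  rw [abs_of_nonneg (hr.1 I)]
  exact rate_le_sum_logb sys.P_pos hr I

end System

/-- Only an inequality holds here, because the virtual queue may be served beyond its content. -/
theorem sum_γ_le {K : ℕ} {Ω : Type*} (U₀ : Ω → Fin K → ℝ) (a : ℕ → Ω → Fin K → ℕ) (γ : ℕ → Ω → Fin K → ℝ)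
    (T : ℕ) (ω : Ω) (k : Fin K) :
    U₀ ω k + ∑ t ∈ Finset.range T, γ t ω k ≤
      virtualQueue U₀ a γ T ω k + ∑ t ∈ Finset.range T, (a t ω k : ℝ) := by
  induction T with
  | zero => simp [virtualQueue]
  | succ T ih =>
    rw [Finset.sum_range_succ, Finset.sum_range_succ]
    have := le_max_left (virtualQueue U₀ a γ T ω k - (a T ω k : ℝ)) 0
    simp only [virtualQueue]
    linarith

variable {K : ℕ} {sys : System K} {Ω : Type*} [mΩ : MeasurableSpace Ω]
  {Pr : Measure Ω} {ℱ : Filtration ℕ mΩ} {c : Trajectory K Ω}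

namespace IsAdmissible

variable (hc : IsAdmissible sys Pr ℱ c)
include hc

theorem measurable_S (t : ℕ) : Measurable[ℱ t] (c.S t) := by
  induction t with
  | zero => exact hc.measurable_S₀
  | succ t ih =>
    have h1 : Measurable[ℱ (t + 1)] (c.S t) := ih.mono (ℱ.mono t.le_succ) le_rfl
    refine @measurable_pi_lambda _ _ _ (ℱ (t + 1)) _ _ fun k => ?_
    have h2 : Measurable[ℱ (t + 1)] fun ω => c.S t ω k := (measurable_pi_apply k).comp h1
    have h3 : Measurable[ℱ (t + 1)] fun ω => c.a t ω k :=
      (measurable_pi_apply k).comp (hc.measurable_a t)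
    have h4 : ∀ J, Measurable[ℱ (t + 1)] fun ω => c.σ t ω J := fun J =>
      (measurable_pi_apply J).comp (hc.measurable_σ t)
    exact (h2.sub (Finset.measurable_sum _ fun J _ => h4 J)).add h3

theorem measurable_bitsIn (t : ℕ) (I : UserSet K) :
    Measurable[ℱ (t + 1)] fun ω => c.bitsIn sys t ω I := by
  refine Finset.measurable_sum _ fun J _ => Measurable.const_mul ?_ _
  exact (measurable_of_countable fun n : ℕ => (n : ℝ)).comp
    ((measurable_pi_apply J).comp (hc.measurable_σ t))

theorem measurable_μ_apply (t : ℕ) (I : UserSet K) :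
    Measurable[ℱ (t + 1)] fun ω => c.μ t ω I :=
  (measurable_pi_apply I).comp (hc.measurable_μ t)

theorem measurable_Q (t : ℕ) (I : UserSet K) : Measurable[ℱ t] fun ω => c.Q sys t ω I := by
  induction t with
  | zero => exact (measurable_pi_apply I).comp hc.measurable_Q₀
  | succ t ih =>
    have h1 : Measurable[ℱ (t + 1)] fun ω => c.Q sys t ω I := ih.mono (ℱ.mono t.le_succ) le_rfl
    exact ((h1.sub ((hc.measurable_μ_apply t I).const_mul _)).max measurable_const).add
      (hc.measurable_bitsIn t I)

theorem measurable_Q' (t : ℕ) (I : UserSet K) : Measurable fun ω => c.Q sys t ω I :=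
  (hc.measurable_Q t I).mono (ℱ.le t) le_rfl

theorem measurable_S' (t : ℕ) (k : Fin K) : Measurable fun ω => (c.S t ω k : ℝ) :=
  (measurable_of_countable fun n : ℕ => (n : ℝ)).comp
    ((measurable_pi_apply k).comp ((hc.measurable_S t).mono (ℱ.le t) le_rfl))

theorem measurable_σ' (t : ℕ) (J : UserSet K) : Measurable fun ω => (c.σ t ω J : ℝ) :=
  (measurable_of_countable fun n : ℕ => (n : ℝ)).comp
    ((measurable_pi_apply J).comp ((hc.measurable_σ t).mono (ℱ.le _) le_rfl))

theorem measurable_x' (t : ℕ) (k : Fin K) (J : UserSet K) :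
    Measurable fun ω => (c.x t ω k J : ℝ) :=
  (measurable_of_countable fun n : ℕ => (n : ℝ)).comp
    ((measurable_pi_apply J).comp ((measurable_pi_apply k).comp
      ((hc.measurable_x t).mono (ℱ.le _) le_rfl)))

theorem measurable_μ' (t : ℕ) : Measurable (c.μ t) :=
  (hc.measurable_μ t).mono (ℱ.le _) le_rfl

theorem measurable_h' (t : ℕ) : Measurable (c.h t) :=
  (hc.measurable_h t).mono (ℱ.le _) le_rfl

theorem measurable_bitsIn' (t : ℕ) (I : UserSet K) : Measurable fun ω => c.bitsIn sys t ω I :=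
  (hc.measurable_bitsIn t I).mono (ℱ.le _) le_rfl

theorem measurable_bitsOut (s : ℕ) (I : UserSet K) : Measurable fun ω => c.bitsOut sys s ω I :=
  Finset.measurable_sum _ fun τ _ => (hc.measurable_Q' τ I).min
    (((measurable_pi_apply I).comp (hc.measurable_μ' τ)).const_mul _)

theorem measurableSet_sent (s t : ℕ) (I : UserSet K) : MeasurableSet {ω | c.Sent sys s t ω I} :=
  measurableSet_le ((hc.measurable_Q' 0 I).add
    (Finset.measurable_sum _ fun τ _ => hc.measurable_bitsIn' τ I)) (hc.measurable_bitsOut s I)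

theorem measurable_D (s : ℕ) (k : Fin K) : Measurable fun ω => (c.D sys s ω k : ℝ) := by
  classical
  simp only [Trajectory.D]
  push_cast
  refine Finset.measurable_sum _ fun t _ => Finset.measurable_sum _ fun J _ => ?_
  refine Measurable.ite ?_ (hc.measurable_x' t k J) measurable_const
  simp only [Set.ofPred_forall]
  exact MeasurableSet.iInter fun I => MeasurableSet.iInter fun _ => MeasurableSet.iInter fun _ =>
    MeasurableSet.iInter fun _ => hc.measurableSet_sent s t I

theorem measurable_deliveredUsers (s t : ℕ) (J : UserSet K) :
    Measurable fun ω => c.deliveredUsers sys s t ω J := by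
  classical
  refine measurable_to_countable' fun E => ?_
  have : (fun ω => c.deliveredUsers sys s t ω J) ⁻¹' {E} =
      ⋂ k : Fin K, {ω | k ∈ c.deliveredUsers sys s t ω J ↔ k ∈ E} := by
    ext ω
    simp only [Set.mem_preimage, Set.mem_singleton_iff, Finset.ext_iff, Set.mem_iInter,
      Set.mem_ofPred_eq]
  rw [this]
  refine MeasurableSet.iInter fun k => ?_
  have hk : MeasurableSet {ω | k ∈ c.deliveredUsers sys s t ω J} := by
    simp only [Trajectory.mem_deliveredUsers, Set.ofPred_and, Set.ofPred_forall]
    exact (MeasurableSet.const _).inter (MeasurableSet.iInter fun I => MeasurableSet.iInter fun _ =>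
      MeasurableSet.iInter fun _ => MeasurableSet.iInter fun _ => hc.measurableSet_sent s t I)
  by_cases hE : k ∈ E
  · simpa [hE] using hk
  · simp only [hE, iff_false]
    exact hk.compl

theorem measurable_deliveredTo (s : ℕ) (A : UserSet K) :
    Measurable fun ω => c.deliveredTo sys s ω A := by
  classical
  refine Finset.measurable_sum _ fun t _ => Finset.measurable_sum _ fun J _ => ?_
  exact Measurable.ite (hc.measurable_deliveredUsers s t J (MeasurableSet.singleton A.1))
    (hc.measurable_σ' t J) measurable_const

theorem measurable_usefulBits (s : ℕ) (I' I : UserSet K) :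
    Measurable fun ω => c.usefulBits sys s ω I' I := by
  classical
  refine Finset.measurable_sum _ fun t _ => Finset.measurable_sum _ fun J _ => ?_
  refine Measurable.ite ?_ ((hc.measurable_σ' t J).const_mul _) measurable_const
  exact hc.measurable_deliveredUsers s t J
    (MeasurableSet.of_discrete (s := {E : Finset (Fin K) | I'.1 ∩ E = I.1}))

theorem measurePreserving_h (t : ℕ) : MeasurePreserving (c.h t) Pr sys.ν :=
  ⟨hc.measurable_h' t, hc.law_h t⟩

theorem memLp_rateBound (t : ℕ) : MemLp (fun ω => sys.rateBound (c.h t ω)) 2 Pr :=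
  sys.memLp_rateBound.comp_measurePreserving (hc.measurePreserving_h t)

theorem memLp_μ (t : ℕ) (I : UserSet K) : MemLp (fun ω => c.μ t ω I) 2 Pr :=
  (hc.memLp_rateBound t).mono'
    ((measurable_pi_apply I).comp (hc.measurable_μ' t)).aestronglyMeasurable
    (.of_forall fun ω => sys.abs_rate_le (hc.μ_mem t ω) I)

theorem memLp_Q [IsFiniteMeasure Pr] (t : ℕ) (I : UserSet K) :
    MemLp (fun ω => c.Q sys t ω I) 2 Pr := by
  have h0 : MemLp (fun ω => c.Q₀ ω I) 2 Pr :=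
    (memLp_two_iff_integrable_sq (hc.measurable_Q' 0 I).aestronglyMeasurable).2 (hc.integrable_Q₀ I)
  refine (h0.add (memLp_const (t * sys.bitsMax I))).mono'
    (hc.measurable_Q' t I).aestronglyMeasurable (.of_forall fun ω => ?_)
  rw [Real.norm_of_nonneg (hc.Q_nonneg t ω I)]
  exact hc.Q_le t ω I

theorem memLp_S [IsFiniteMeasure Pr] (t : ℕ) (k : Fin K) :
    MemLp (fun ω => (c.S t ω k : ℝ)) 2 Pr := by
  have h0 : MemLp (fun ω => (c.S₀ ω k : ℝ)) 2 Pr :=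
    (memLp_two_iff_integrable_sq (hc.measurable_S' 0 k).aestronglyMeasurable).2 (hc.integrable_S₀ k)
  refine (h0.add (memLp_const ((t * sys.γmax k : ℕ) : ℝ))).mono'
    (hc.measurable_S' t k).aestronglyMeasurable (.of_forall fun ω => ?_)
  rw [Real.norm_of_nonneg (Nat.cast_nonneg _)]
  have := hc.S_le t ω k
  rw [← Nat.cast_le (α := ℝ), Nat.cast_add] at this
  exact this

theorem memLp_σ [IsFiniteMeasure Pr] (t : ℕ) (J : UserSet K) :
    MemLp (fun ω => (c.σ t ω J : ℝ)) 2 Pr :=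
  (memLp_const (sys.σmax : ℝ)).mono' (hc.measurable_σ' t J).aestronglyMeasurable
    (.of_forall fun ω => by
      rw [Real.norm_of_nonneg (Nat.cast_nonneg _)]
      exact_mod_cast hc.σ_le t ω J)

variable [IsFiniteMeasure Pr]

theorem integrable_μ (t : ℕ) (I : UserSet K) : Integrable (fun ω => c.μ t ω I) Pr :=
  (hc.memLp_μ t I).integrable one_le_two

theorem integrable_Q (t : ℕ) (I : UserSet K) : Integrable (fun ω => c.Q sys t ω I) Pr :=
  (hc.memLp_Q t I).integrable one_le_two

theorem integrable_S (t : ℕ) (k : Fin K) : Integrable (fun ω => (c.S t ω k : ℝ)) Pr :=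
  (hc.memLp_S t k).integrable one_le_two

theorem integrable_σ (t : ℕ) (J : UserSet K) : Integrable (fun ω => (c.σ t ω J : ℝ)) Pr :=
  (hc.memLp_σ t J).integrable one_le_two

theorem integrable_D (s : ℕ) (k : Fin K) : Integrable (fun ω => (c.D sys s ω k : ℝ)) Pr := by
  refine ((hc.integrable_S 0 k).add (integrable_const ((s * sys.γmax k : ℕ) : ℝ))).mono'
    (hc.measurable_D s k).aestronglyMeasurable (.of_forall fun ω => ?_)
  rw [Real.norm_of_nonneg (Nat.cast_nonneg _)]
  have := hc.D_le_admitted s ω k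
  rw [← Nat.cast_le (α := ℝ), Nat.cast_add] at this
  exact this

theorem integrable_deliveredTo (s : ℕ) (A : UserSet K) :
    Integrable (fun ω => c.deliveredTo sys s ω A) Pr := by
  classical
  refine (integrable_finsetSum (Finset.range s) fun t _ => integrable_finsetSum Finset.univ
    fun J _ => hc.integrable_σ t J).mono' (hc.measurable_deliveredTo s A).aestronglyMeasurable
    (.of_forall fun ω => ?_)
  rw [Real.norm_of_nonneg (c.deliveredTo_nonneg sys s ω A)]
  exact Finset.sum_le_sum fun t _ => Finset.sum_le_sum fun J _ => by split_ifs <;> simp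

theorem integrable_bitsIn (t : ℕ) (I : UserSet K) : Integrable (fun ω => c.bitsIn sys t ω I) Pr :=
  integrable_finsetSum _ fun J _ => (hc.integrable_σ t J).const_mul _

theorem integrable_bitsOut (s : ℕ) (I : UserSet K) :
    Integrable (fun ω => c.bitsOut sys s ω I) Pr := by
  refine ((integrable_finsetSum (Finset.range s) fun t _ => hc.integrable_μ t I).const_mul
    sys.Tslot).mono' (hc.measurable_bitsOut s I).aestronglyMeasurable (.of_forall fun ω => ?_)
  rw [Real.norm_of_nonneg (hc.bitsOut_nonneg s ω I)]
  exact c.bitsOut_le sys s ω I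

theorem integrable_usefulBits (s : ℕ) (I' I : UserSet K) :
    Integrable (fun ω => c.usefulBits sys s ω I' I) Pr := by
  refine (hc.integrable_bitsOut s I').mono' (hc.measurable_usefulBits s I' I).aestronglyMeasurable
    (.of_forall fun ω => ?_)
  rw [Real.norm_of_nonneg (c.usefulBits_nonneg sys s ω I' I)]
  exact (Finset.single_le_sum (f := fun I => c.usefulBits sys s ω I' I)
    (fun I _ => c.usefulBits_nonneg sys s ω I' I) (Finset.mem_univ I)).trans
    (hc.sum_usefulBits_le s ω I')

end IsAdmissible

section VirtualQueue

variable {U₀ : Ω → Fin K → ℝ} {γ : ℕ → Ω → Fin K → ℝ} {V : ℝ} {α d : Fin K → ℝ}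

namespace IsProposed

variable (hp : IsProposed sys V α d Pr ℱ c U₀ γ)
include hp

theorem U_nonneg (t : ℕ) (ω : Ω) (k : Fin K) : 0 ≤ virtualQueue U₀ c.a γ t ω k := by
  cases t with
  | zero => exact hp.U₀_nonneg ω k
  | succ t => exact add_nonneg (le_max_right _ _) (hp.γ_mem t ω k).1

theorem U_le (t : ℕ) (ω : Ω) (k : Fin K) :
    virtualQueue U₀ c.a γ t ω k ≤ U₀ ω k + t * sys.γmax k := by
  induction t with
  | zero => simp [virtualQueue]
  | succ t ih =>
    have h1 := (hp.γ_mem t ω k).2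
    have h2 : max (virtualQueue U₀ c.a γ t ω k - (c.a t ω k : ℝ)) 0 ≤
        virtualQueue U₀ c.a γ t ω k :=
      max_le (sub_le_self _ (Nat.cast_nonneg _)) (hp.U_nonneg t ω k)
    simp only [virtualQueue]
    push_cast
    linarith

theorem measurable_γ_apply (t : ℕ) (k : Fin K) : Measurable[ℱ (t + 1)] fun ω => γ t ω k :=
  (measurable_pi_apply k).comp (hp.measurable_γ t)

theorem measurable_U (t : ℕ) (k : Fin K) :
    Measurable[ℱ t] fun ω => virtualQueue U₀ c.a γ t ω k := by
  induction t with
  | zero => exact (measurable_pi_apply k).comp hp.measurable_U₀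
  | succ t ih =>
    have h1 := ih.mono (ℱ.mono t.le_succ) le_rfl
    have h3 : Measurable[ℱ (t + 1)] fun ω => (c.a t ω k : ℝ) :=
      (measurable_of_countable fun n : ℕ => (n : ℝ)).comp
        ((measurable_pi_apply k).comp (hp.admissible.measurable_a t))
    exact ((h1.sub h3).max measurable_const).add (hp.measurable_γ_apply t k)

theorem measurable_U' (t : ℕ) (k : Fin K) :
    Measurable fun ω => virtualQueue U₀ c.a γ t ω k :=
  (hp.measurable_U t k).mono (ℱ.le t) le_rfl

theorem measurable_γ' (t : ℕ) (k : Fin K) : Measurable fun ω => γ t ω k :=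
  (hp.measurable_γ_apply t k).mono (ℱ.le _) le_rfl

variable [IsFiniteMeasure Pr]

theorem memLp_U (t : ℕ) (k : Fin K) :
    MemLp (fun ω => virtualQueue U₀ c.a γ t ω k) 2 Pr := by
  have h0 : MemLp (fun ω => U₀ ω k) 2 Pr :=
    (memLp_two_iff_integrable_sq (hp.measurable_U' 0 k).aestronglyMeasurable).2 (hp.integrable_U₀ k)
  refine (h0.add (memLp_const (t * sys.γmax k : ℝ))).mono'
    (hp.measurable_U' t k).aestronglyMeasurable (.of_forall fun ω => ?_)
  rw [Real.norm_of_nonneg (hp.U_nonneg t ω k)]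
  exact hp.U_le t ω k

theorem memLp_γ (t : ℕ) (k : Fin K) : MemLp (fun ω => γ t ω k) 2 Pr :=
  (memLp_const (sys.γmax k : ℝ)).mono' (hp.measurable_γ' t k).aestronglyMeasurable
    (.of_forall fun ω => by
      rw [Real.norm_of_nonneg (hp.γ_mem t ω k).1]
      exact (hp.γ_mem t ω k).2)

theorem integrable_U (t : ℕ) (k : Fin K) :
    Integrable (fun ω => virtualQueue U₀ c.a γ t ω k) Pr :=
  (hp.memLp_U t k).integrable one_le_two

theorem integrable_γ (t : ℕ) (k : Fin K) : Integrable (fun ω => γ t ω k) Pr :=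
  (hp.memLp_γ t k).integrable one_le_two

theorem integrable_utility (hd : ∀ k, 0 < d k) (t : ℕ) (k : Fin K) :
    Integrable (fun ω => utility (α k) (d k) (γ t ω k)) Pr := by
  have hm : Measurable (utility (α k) (d k)) := by
    unfold utility
    split_ifs
    · exact (measurable_const.add (measurable_id.div_const _)).log
    · exact ((measurable_const.add measurable_id).pow_const _).div_const _
  refine (integrable_const (|utility (α k) (d k) 0| +
    |utility (α k) (d k) (sys.γmax k)|)).mono' (hm.comp (hp.measurable_γ' t k)).aestronglyMeasurable
    (.of_forall fun ω => ?_)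
  have h0 := (hp.γ_mem t ω k).1
  have h1 := monotoneOn_utility (α := α k) (hd k) (Set.mem_Ici.2 le_rfl) (Set.mem_Ici.2 h0) h0
  have h2 := monotoneOn_utility (α := α k) (hd k) (Set.mem_Ici.2 h0)
    (Set.mem_Ici.2 (Nat.cast_nonneg _)) (hp.γ_mem t ω k).2
  rw [Real.norm_eq_abs]
  refine abs_le.2 ⟨?_, ?_⟩
  · have := neg_abs_le (utility (α k) (d k) 0)
    have := abs_nonneg (utility (α k) (d k) (sys.γmax k))
    linarith
  · have := le_abs_self (utility (α k) (d k) (sys.γmax k))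
    have := abs_nonneg (utility (α k) (d k) 0)
    linarith

end IsProposed

end VirtualQueue

end CodedCaching

/-! ### Mean rates of randomized transmissions and optimality of the scheduling rule -/

namespace CodedCaching

/-- The intersection of all half-spaces that contain the capacity region. -/
def rateHull {K : ℕ} (P : ℝ) (h : Fin K → ℝ≥0) : Set (UserSet K → ℝ) :=
  {y | ∀ (w : UserSet K → ℝ) (B : ℝ), (∀ r ∈ capacityRegion P h, ∑ I, w I * r I ≤ B) →
    ∑ I, w I * y I ≤ B}

theorem capacityRegion_subset_rateHull {K : ℕ} (P : ℝ) (h : Fin K → ℝ≥0) :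
    capacityRegion P h ⊆ rateHull P h := fun r hr _ _ hw => hw r hr

namespace System

variable {K : ℕ} (sys : System K)

/-- The mean transmission rates of the static policies that may be randomized. -/
def meanRates : Set (UserSet K → ℝ) :=
  {x | ∃ m : (Fin K → ℝ≥0) → UserSet K → ℝ, Measurable m ∧
    (∀ᵐ h ∂sys.ν, m h ∈ rateHull sys.P h) ∧ ∀ I, x I = ∫ h, m h I ∂sys.ν}

/-- The bounds `r I ≤ rateBound` and `-r I ≤ rateBound` are half-spaces containing the capacity
region, hence its hull. -/
theorem abs_le_of_mem_rateHull {h : Fin K → ℝ≥0} {y : UserSet K → ℝ}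
    (hy : y ∈ rateHull sys.P h) (I : UserSet K) : |y I| ≤ sys.rateBound h := by
  classical
  rw [abs_le']
  constructor
  · have := hy (fun J => if J = I then 1 else 0) (sys.rateBound h) fun r hr => by
      simpa using (le_abs_self _).trans (sys.abs_rate_le hr I)
    simpa using this
  · have := hy (fun J => if J = I then -1 else 0) (sys.rateBound h) fun r hr => by
      simpa using (neg_le_abs _).trans (sys.abs_rate_le hr I)
    simpa using this

theorem integrable_of_ae_mem_rateHull {m : (Fin K → ℝ≥0) → UserSet K → ℝ} (hm : Measurable m)
    (h : ∀ᵐ h ∂sys.ν, m h ∈ rateHull sys.P h) (I : UserSet K) :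
    Integrable (fun h => m h I) sys.ν :=
  sys.integrable_rateBound.mono' ((measurable_pi_apply I).comp hm).aestronglyMeasurable
    (h.mono fun _ hh => sys.abs_le_of_mem_rateHull hh I)

theorem convex_meanRates : Convex ℝ sys.meanRates := by
  rintro x ⟨m, hm, hmh, hx⟩ y ⟨n, hn, hnh, hy⟩ a b ha hb hab
  refine ⟨fun h => a • m h + b • n h, (hm.const_smul a).add (hn.const_smul b), ?_, fun I => ?_⟩
  · filter_upwards [hmh, hnh] with h h1 h2 w B hw
    have e : ∑ I, w I * (a • m h + b • n h) I =
        a * ∑ I, w I * m h I + b * ∑ I, w I * n h I := by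
      rw [Finset.mul_sum, Finset.mul_sum, ← Finset.sum_add_distrib]
      refine Finset.sum_congr rfl fun I _ => ?_
      simp only [Pi.add_apply, Pi.smul_apply, smul_eq_mul]
      ring
    rw [e]
    calc _ ≤ a * B + b * B := add_le_add (mul_le_mul_of_nonneg_left (h1 w B hw) ha)
          (mul_le_mul_of_nonneg_left (h2 w B hw) hb)
      _ = B := by rw [← add_mul, hab, one_mul]
  · simp only [Pi.add_apply, Pi.smul_apply, smul_eq_mul]
    rw [integral_add ((sys.integrable_of_ae_mem_rateHull hm hmh I).const_mul a)
      ((sys.integrable_of_ae_mem_rateHull hn hnh I).const_mul b), integral_const_mul,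
      integral_const_mul, hx, hy]

theorem reassign_mem_meanRates {x : UserSet K → ℝ} (hx : x ∈ sys.meanRates)
    (θ : UserSet K → UserSet K → ℝ) (hθ0 : ∀ I' I, 0 ≤ θ I' I)
    (hθ : ∀ I' I, ¬ I.1 ⊆ I'.1 → θ I' I = 0) (hθ1 : ∀ I', ∑ I, θ I' I ≤ 1) :
    (fun I => ∑ I', θ I' I * x I') ∈ sys.meanRates := by
  obtain ⟨m, hm, hmh, hx⟩ := hx
  refine ⟨fun h I => ∑ I', θ I' I * m h I', ?_, ?_, fun I => ?_⟩
  · exact measurable_pi_lambda _ fun I => Finset.measurable_sum _ fun I' _ =>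
      ((measurable_pi_apply I').comp hm).const_mul _
  · filter_upwards [hmh] with h hh w B hw
    have e : ∀ r : UserSet K → ℝ, ∑ I, w I * ∑ I', θ I' I * r I' =
        ∑ I', (∑ I, w I * θ I' I) * r I' := fun r => by
      simp only [Finset.mul_sum, Finset.sum_mul]
      rw [Finset.sum_comm]
      exact Finset.sum_congr rfl fun _ _ => Finset.sum_congr rfl fun _ _ => by ring
    rw [e]
    -- A half-space containing the region is pulled back along the reassignment map; as this map
    -- preserves the region, the preimage contains it too.
    refine hh _ B fun r hr => ?_
    rw [← e]
    exact hw _ (reassign_mem_capacityRegion hr θ hθ0 hθ hθ1)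
  · rw [integral_finsetSum _ fun I' _ =>
      (sys.integrable_of_ae_mem_rateHull hm hmh I').const_mul _]
    exact Finset.sum_congr rfl fun I' _ => by rw [integral_const_mul, hx]

theorem mean_mem_meanRates {r : (Fin K → ℝ≥0) → UserSet K → ℝ} (hr : Measurable r)
    (h : ∀ h, r h ∈ capacityRegion sys.P h) : (fun I => ∫ h, r h I ∂sys.ν) ∈ sys.meanRates :=
  ⟨r, hr, .of_forall fun g => capacityRegion_subset_rateHull _ _ (h g), fun _ => rfl⟩

end System

variable {K : ℕ} {sys : System K} {Ω : Type*} [mΩ : MeasurableSpace Ω]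
  {Pr : Measure Ω} [IsProbabilityMeasure Pr] {ℱ : Filtration ℕ mΩ} {c : Trajectory K Ω}

/-- The selection is the conditional mean of the rates given the channel state. The conditional law
is carried by the capacity region, so its mean satisfies every linear bound valid there; it need not
lie in the region itself, hence the hull. -/
theorem IsAdmissible.mean_rate_mem_meanRates (hc : IsAdmissible sys Pr ℱ c) (t : ℕ) :
    (fun I => ∫ ω, c.μ t ω I ∂Pr) ∈ sys.meanRates := by
  have := sys.isProbabilityMeasure
  let κ := condDistrib (c.μ t) (c.h t) Pr
  have hκ : sys.ν.compProd κ = Pr.map fun ω => (c.h t ω, c.μ t ω) := by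
    rw [← hc.law_h t]
    exact compProd_map_condDistrib (hc.measurable_μ' t).aemeasurable
  have hpair : Measurable fun ω => (c.h t ω, c.μ t ω) :=
    (hc.measurable_h' t).prodMk (hc.measurable_μ' t)
  have hae : ∀ᵐ h ∂sys.ν, ∀ᵐ r ∂κ h, r ∈ capacityRegion sys.P h := by
    refine Measure.ae_ae_of_ae_compProd (p := fun z => z.2 ∈ capacityRegion sys.P z.1) ?_
    rw [hκ, ae_map_iff hpair.aemeasurable (measurableSet_capacityRegion_graph sys.P)]
    exact .of_forall fun ω => hc.μ_mem t ω
  have hmeas : ∀ I, Measurable fun h => ∫ r : UserSet K → ℝ, r I ∂κ h := fun I =>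
    ((measurable_pi_apply I).stronglyMeasurable.integral_kernel (κ := κ)).measurable
  refine ⟨fun h I => ∫ r : UserSet K → ℝ, r I ∂κ h, measurable_pi_lambda _ hmeas, ?_, fun I => ?_⟩
  · filter_upwards [hae] with h hh w B hw
    have hint : ∀ I, Integrable (fun r : UserSet K → ℝ => r I) (κ h) := fun I =>
      (integrable_const (sys.rateBound h)).mono' (measurable_pi_apply I).aestronglyMeasurable
        (hh.mono fun r hr => sys.abs_rate_le hr I)
    have e : ∑ I, w I * ∫ r : UserSet K → ℝ, r I ∂κ h = ∫ r, ∑ I, w I * r I ∂κ h := by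
      rw [integral_finsetSum _ fun I _ => (hint I).const_mul _]
      exact Finset.sum_congr rfl fun I _ => (integral_const_mul _ _).symm
    rw [e]
    calc _ ≤ ∫ _, B ∂κ h := integral_mono_ae
          (integrable_finsetSum _ fun I _ => (hint I).const_mul _) (integrable_const B)
          (hh.mono fun r hr => hw r hr)
      _ = B := by simp
  · have hI : Measurable fun z : (Fin K → ℝ≥0) × (UserSet K → ℝ) => z.2 I :=
      (measurable_pi_apply I).comp measurable_snd
    have h1 : Integrable (fun z : (Fin K → ℝ≥0) × (UserSet K → ℝ) => z.2 I) (sys.ν.compProd κ) := by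
      rw [hκ, integrable_map_measure hI.aestronglyMeasurable hpair.aemeasurable]
      exact hc.integrable_μ t I
    rw [← Measure.integral_compProd h1, hκ,
      integral_map hpair.aemeasurable hI.aestronglyMeasurable]

/-- The queues before slot `t` are independent of its channel state, so the left side is the
expected queue-weighted rate of the static selection. Maximality of `μ` over the region is a linear
bound and thus extends to the hull. -/
theorem IsProposed.sum_mul_le_of_mem_meanRates {U₀ : Ω → Fin K → ℝ} {γ : ℕ → Ω → Fin K → ℝ}
    {V : ℝ} {α d : Fin K → ℝ} (hp : IsProposed sys V α d Pr ℱ c U₀ γ) (t : ℕ)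
    {x : UserSet K → ℝ} (hx : x ∈ sys.meanRates) :
    ∑ I, (∫ ω, c.Q sys t ω I ∂Pr) * x I ≤ ∑ I, ∫ ω, c.Q sys t ω I * c.μ t ω I ∂Pr := by
  have hc := hp.admissible
  obtain ⟨m, hm, hmh, hx⟩ := hx
  have hm' : ∀ I, Measurable fun h => m h I := fun I => (measurable_pi_apply I).comp hm
  have hmt : ∀ I, MemLp (fun ω => m (c.h t ω) I) 2 Pr := fun I => by
    refine (hc.memLp_rateBound t).mono'
      ((hm' I).comp (hc.measurable_h' t)).aestronglyMeasurable ?_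
    exact (hc.measurePreserving_h t).quasiMeasurePreserving.ae
      (hmh.mono fun h hh => sys.abs_le_of_mem_rateHull hh I)
  have hind : ∀ I, IndepFun (fun ω => c.Q sys t ω I) (fun ω => m (c.h t ω) I) Pr := fun I =>
    (IndepFun_iff_Indep _ _ _).2 (indep_of_indep_of_le_left (indep_of_indep_of_le_right
      (hc.indep_h t) ((measurable_iff_comap_le.1 ((hm' I).comp (comap_measurable (c.h t))))))
      (measurable_iff_comap_le.1 (hc.measurable_Q t I)))
  have h1 : ∀ I, (∫ ω, c.Q sys t ω I ∂Pr) * x I = ∫ ω, c.Q sys t ω I * m (c.h t ω) I ∂Pr := by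
    intro I
    rw [hx I, ← hc.law_h t, integral_map (hc.measurable_h' t).aemeasurable
      (hm' I).aestronglyMeasurable]
    exact ((hind I).integral_mul_eq_mul_integral (hc.measurable_Q' t I).aestronglyMeasurable
      (hmt I).aestronglyMeasurable).symm
  have i1 : ∀ I ∈ Finset.univ, Integrable (fun ω => c.Q sys t ω I * m (c.h t ω) I) Pr :=
    fun I _ => (hc.memLp_Q t I).integrable_mul (hmt I)
  have i2 : ∀ I ∈ Finset.univ, Integrable (fun ω => c.Q sys t ω I * c.μ t ω I) Pr :=
    fun I _ => (hc.memLp_Q t I).integrable_mul (hc.memLp_μ t I)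
  rw [Finset.sum_congr rfl fun I _ => h1 I, ← integral_finsetSum _ i1, ← integral_finsetSum _ i2]
  refine integral_mono_ae (integrable_finsetSum _ i1) (integrable_finsetSum _ i2) ?_
  filter_upwards [(hc.measurePreserving_h t).quasiMeasurePreserving.ae hmh] with ω hω
  exact hω _ _ fun r hr => hp.scheduling t ω hr

theorem IsProposed.sum_mul_le_of_mem_closure {U₀ : Ω → Fin K → ℝ} {γ : ℕ → Ω → Fin K → ℝ}
    {V : ℝ} {α d : Fin K → ℝ} (hp : IsProposed sys V α d Pr ℱ c U₀ γ) (t : ℕ)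
    {x : UserSet K → ℝ} (hx : x ∈ closure sys.meanRates) :
    ∑ I, (∫ ω, c.Q sys t ω I ∂Pr) * x I ≤ ∑ I, ∫ ω, c.Q sys t ω I * c.μ t ω I ∂Pr := by
  have hcl : IsClosed {x : UserSet K → ℝ | ∑ I, (∫ ω, c.Q sys t ω I ∂Pr) * x I ≤
      ∑ I, ∫ ω, c.Q sys t ω I * c.μ t ω I ∂Pr} :=
    isClosed_le (by fun_prop) continuous_const
  exact closure_minimal (fun y hy => hp.sum_mul_le_of_mem_meanRates t hy) hcl hx

end CodedCaching

/-! ### Quadratic drift and comparison with static policies -/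

namespace CodedCaching

theorem sq_queue_step_le {q s a : ℝ} (hq : 0 ≤ q) (hs : 0 ≤ s) (ha : 0 ≤ a) :
    (max (q - s) 0 + a) ^ 2 ≤ q ^ 2 + s ^ 2 + a ^ 2 + 2 * (q * (a - s)) := by
  rcases le_total (q - s) 0 with h | h
  · rw [max_eq_right h]
    nlinarith [sq_nonneg (q - s), mul_nonneg hq ha]
  · rw [max_eq_left h]
    nlinarith [mul_nonneg hs ha]

/-- A common bound for arrivals and service gives the additive constant `g ^ 2` instead of `2 * g ^
2`. With the squared admissions of the user queue, this makes the share of each user `γmax ^ 2` in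
`B`, after halving. -/
theorem sq_bounded_queue_step_le {q a γ g : ℝ} (hq : 0 ≤ q) (ha : 0 ≤ a) (hag : a ≤ g)
    (hγ : 0 ≤ γ) (hγg : γ ≤ g) :
    (max (q - a) 0 + γ) ^ 2 ≤ q ^ 2 + g ^ 2 + 2 * (q * (γ - a)) := by
  rcases le_total (q - a) 0 with h | h
  · rw [max_eq_right h, zero_add]
    nlinarith [sq_nonneg (q - (g - γ)), mul_nonneg hγ (sub_nonneg.2 hγg),
      mul_nonneg hq (sub_nonneg.2 hag)]
  · rw [max_eq_left h]
    have : (γ - a) ^ 2 ≤ g ^ 2 := sq_le_sq' (by linarith) (by linarith)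
    nlinarith

variable {K : ℕ} {sys : System K} {Ω : Type*}

/-- Half the sum of the squares of all queue lengths, those of the codeword queues being measured in
units of the file size. -/
noncomputable def lyapunov (sys : System K) (c : Trajectory K Ω) (U₀ : Ω → Fin K → ℝ)
    (γ : ℕ → Ω → Fin K → ℝ) (t : ℕ) (ω : Ω) : ℝ :=
  (∑ k, (virtualQueue U₀ c.a γ t ω k ^ 2 + (c.S t ω k : ℝ) ^ 2) +
    ∑ I, c.Q sys t ω I ^ 2 / sys.F ^ 2) / 2

theorem lyapunov_nonneg (sys : System K) (c : Trajectory K Ω) (U₀ : Ω → Fin K → ℝ)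
    (γ : ℕ → Ω → Fin K → ℝ) (t : ℕ) (ω : Ω) : 0 ≤ lyapunov sys c U₀ γ t ω := by
  unfold lyapunov
  positivity

theorem U_sq_add_S_sq_le_lyapunov (sys : System K) (c : Trajectory K Ω) (U₀ : Ω → Fin K → ℝ)
    (γ : ℕ → Ω → Fin K → ℝ) (t : ℕ) (ω : Ω) (k : Fin K) :
    virtualQueue U₀ c.a γ t ω k ^ 2 + (c.S t ω k : ℝ) ^ 2 ≤ 2 * lyapunov sys c U₀ γ t ω := by
  have h1 := Finset.single_le_sum
    (f := fun k => virtualQueue U₀ c.a γ t ω k ^ 2 + (c.S t ω k : ℝ) ^ 2)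
    (fun k _ => by positivity) (Finset.mem_univ k)
  have h2 : 0 ≤ ∑ I, c.Q sys t ω I ^ 2 / sys.F ^ 2 := by positivity
  unfold lyapunov
  linarith

theorem Q_sq_le_lyapunov (sys : System K) (c : Trajectory K Ω) (U₀ : Ω → Fin K → ℝ)
    (γ : ℕ → Ω → Fin K → ℝ) (t : ℕ) (ω : Ω) (I : UserSet K) :
    c.Q sys t ω I ^ 2 ≤ 2 * sys.F ^ 2 * lyapunov sys c U₀ γ t ω := by
  have hF : 0 < sys.F ^ 2 := pow_pos sys.F_pos 2
  have h1 := Finset.single_le_sum (f := fun I => c.Q sys t ω I ^ 2 / sys.F ^ 2)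
    (fun I _ => by positivity) (Finset.mem_univ I)
  have h2 : 0 ≤ ∑ k, (virtualQueue U₀ c.a γ t ω k ^ 2 + (c.S t ω k : ℝ) ^ 2) := by positivity
  have h3 : c.Q sys t ω I ^ 2 / sys.F ^ 2 ≤ 2 * lyapunov sys c U₀ γ t ω := by
    unfold lyapunov
    linarith
  rw [div_le_iff₀ hF] at h3
  linarith

variable [mΩ : MeasurableSpace Ω]
  {Pr : Measure Ω} {ℱ : Filtration ℕ mΩ} {c : Trajectory K Ω}
  {U₀ : Ω → Fin K → ℝ} {γ : ℕ → Ω → Fin K → ℝ} {V : ℝ} {α d : Fin K → ℝ}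

namespace IsProposed

variable (hp : IsProposed sys V α d Pr ℱ c U₀ γ)
include hp

theorem lyapunov_succ_le (t : ℕ) (ω : Ω) :
    lyapunov sys c U₀ γ (t + 1) ω ≤ lyapunov sys c U₀ γ t ω +
      (∑ k, ((sys.γmax k : ℝ) ^ 2 + 1 / 2 * (∑ I : UserSet K with k ∈ I.1, (sys.σmax : ℝ)) ^ 2)
      + 1 / (2 * sys.F ^ 2) * ∑ I, sys.bitsMax I ^ 2)
      + sys.Tslot ^ 2 / (2 * sys.F ^ 2) * ∑ I, c.μ t ω I ^ 2
      + ∑ k, virtualQueue U₀ c.a γ t ω k * (γ t ω k - c.a t ω k)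
      + ∑ k, (c.S t ω k : ℝ) * (c.a t ω k - ∑ J : UserSet K with k ∈ J.1, (c.σ t ω J : ℝ))
      + ∑ I, c.Q sys t ω I / sys.F ^ 2 * (c.bitsIn sys t ω I - sys.Tslot * c.μ t ω I) := by
  have hc := hp.admissible
  have hF : 0 < sys.F ^ 2 := pow_pos sys.F_pos 2
  have hk : ∀ k, (virtualQueue U₀ c.a γ (t + 1) ω k ^ 2 + (c.S (t + 1) ω k : ℝ) ^ 2) / 2 ≤
      (virtualQueue U₀ c.a γ t ω k ^ 2 + (c.S t ω k : ℝ) ^ 2) / 2 +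
      ((sys.γmax k : ℝ) ^ 2 + 1 / 2 * (∑ I : UserSet K with k ∈ I.1, (sys.σmax : ℝ)) ^ 2) +
      virtualQueue U₀ c.a γ t ω k * (γ t ω k - c.a t ω k) +
      (c.S t ω k : ℝ) * (c.a t ω k - ∑ J : UserSet K with k ∈ J.1, (c.σ t ω J : ℝ)) := by
    intro k
    have ha : (c.a t ω k : ℝ) ≤ sys.γmax k := Nat.cast_le.2 (hc.a_le t ω k)
    have h1 := sq_bounded_queue_step_le (hp.U_nonneg t ω k) (Nat.cast_nonneg (c.a t ω k)) ha
      (hp.γ_mem t ω k).1 (hp.γ_mem t ω k).2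
    have hs0 : (0 : ℝ) ≤ ∑ J : UserSet K with k ∈ J.1, (c.σ t ω J : ℝ) :=
      Finset.sum_nonneg fun J _ => Nat.cast_nonneg _
    have h2 := sq_queue_step_le (Nat.cast_nonneg (c.S t ω k)) hs0
      (Nat.cast_nonneg (c.a t ω k) : (0 : ℝ) ≤ _)
    have hS : (c.S (t + 1) ω k : ℝ) = max ((c.S t ω k : ℝ) -
        ∑ J : UserSet K with k ∈ J.1, (c.σ t ω J : ℝ)) 0 + c.a t ω k := by
      simp only [Trajectory.S, Nat.cast_add]
      congr 1
      rw [← Nat.cast_sum]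
      rcases le_total (∑ J : UserSet K with k ∈ J.1, c.σ t ω J) (c.S t ω k) with h | h
      · rw [Nat.cast_sub h, max_eq_left (sub_nonneg.2 (Nat.cast_le.2 h))]
      · rw [Nat.sub_eq_zero_of_le h, max_eq_right (sub_nonpos.2 (Nat.cast_le.2 h)), Nat.cast_zero]
    have h3 : (∑ J : UserSet K with k ∈ J.1, (c.σ t ω J : ℝ)) ^ 2 ≤
        (∑ I : UserSet K with k ∈ I.1, (sys.σmax : ℝ)) ^ 2 :=
      pow_le_pow_left₀ hs0 (Finset.sum_le_sum fun J _ => Nat.cast_le.2 (hc.σ_le t ω J)) 2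
    have h4 : (c.a t ω k : ℝ) ^ 2 ≤ (sys.γmax k : ℝ) ^ 2 := pow_le_pow_left₀ (Nat.cast_nonneg _) ha 2
    rw [hS]
    simp only [virtualQueue]
    linarith
  have hI : ∀ I, c.Q sys (t + 1) ω I ^ 2 / sys.F ^ 2 / 2 ≤ c.Q sys t ω I ^ 2 / sys.F ^ 2 / 2 +
      1 / (2 * sys.F ^ 2) * sys.bitsMax I ^ 2 + sys.Tslot ^ 2 / (2 * sys.F ^ 2) * c.μ t ω I ^ 2 +
      c.Q sys t ω I / sys.F ^ 2 * (c.bitsIn sys t ω I - sys.Tslot * c.μ t ω I) := by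
    intro I
    have h1 := sq_queue_step_le (hc.Q_nonneg t ω I)
      (mul_nonneg sys.Tslot_pos.le (hc.μ_nonneg t ω I)) (c.bitsIn_nonneg sys t ω I)
    have h2 : c.bitsIn sys t ω I ^ 2 ≤ sys.bitsMax I ^ 2 :=
      pow_le_pow_left₀ (c.bitsIn_nonneg sys t ω I) (hc.bitsIn_le t ω I) 2
    have e : c.Q sys t ω I ^ 2 / sys.F ^ 2 / 2 +
      1 / (2 * sys.F ^ 2) * sys.bitsMax I ^ 2 + sys.Tslot ^ 2 / (2 * sys.F ^ 2) * c.μ t ω I ^ 2 +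
      c.Q sys t ω I / sys.F ^ 2 * (c.bitsIn sys t ω I - sys.Tslot * c.μ t ω I) =
      (c.Q sys t ω I ^ 2 + sys.bitsMax I ^ 2 + (sys.Tslot * c.μ t ω I) ^ 2 +
        2 * (c.Q sys t ω I * (c.bitsIn sys t ω I - sys.Tslot * c.μ t ω I))) / sys.F ^ 2 / 2 := by
      field_simp
    rw [e]
    simp only [Trajectory.Q]
    gcongr
    linarith
  have h1 := Finset.sum_le_sum fun k (_ : k ∈ Finset.univ) => hk k
  have h2 := Finset.sum_le_sum fun I (_ : I ∈ Finset.univ) => hI I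
  simp only [Finset.sum_add_distrib, ← Finset.sum_div, ← Finset.mul_sum] at h1 h2
  unfold lyapunov
  simp only [Finset.sum_add_distrib, ← Finset.sum_div, ← Finset.mul_sum]
  linarith

/-- The expression separates: the auxiliary rate maximizes `V * utility - U * γ`, admission
minimizes `(S - U) * a`, and routing minimizes `∑ J, σ J * W J` after the sums over users and
codewords are regrouped by `J`. -/
theorem decisions_le (t : ℕ) (ω : Ω) {γb ab : Fin K → ℝ} {σb : UserSet K → ℝ}
    (hγb : ∀ k, γb k ∈ Set.Icc (0 : ℝ) (sys.γmax k)) (hab : ∀ k, ab k ∈ Set.Icc (0 : ℝ) (sys.γmax k))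
    (hσb : ∀ J, σb J ∈ Set.Icc (0 : ℝ) sys.σmax) :
    ∑ k, virtualQueue U₀ c.a γ t ω k * (γ t ω k - c.a t ω k)
      + ∑ k, (c.S t ω k : ℝ) * (c.a t ω k - ∑ J : UserSet K with k ∈ J.1, (c.σ t ω J : ℝ))
      + ∑ I, c.Q sys t ω I / sys.F ^ 2 * c.bitsIn sys t ω I ≤
    V * ∑ k, (utility (α k) (d k) (γ t ω k) - utility (α k) (d k) (γb k))
      + ∑ k, virtualQueue U₀ c.a γ t ω k * (γb k - ab k)
      + ∑ k, (c.S t ω k : ℝ) * (ab k - ∑ J : UserSet K with k ∈ J.1, σb J)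
      + ∑ I, c.Q sys t ω I / sys.F ^ 2 * ∑ J : UserSet K with I.1 ⊆ J.1, sys.b J I * σb J := by
  have hk : ∀ k, virtualQueue U₀ c.a γ t ω k * (γ t ω k - c.a t ω k) + c.S t ω k * c.a t ω k ≤
      V * (utility (α k) (d k) (γ t ω k) - utility (α k) (d k) (γb k)) +
      virtualQueue U₀ c.a γ t ω k * (γb k - ab k) + c.S t ω k * ab k := by
    intro k
    have h1 := hp.γ_max t ω k (hγb k)
    simp only [Set.mem_ofPred_eq] at h1
    have h2 : (c.S t ω k - virtualQueue U₀ c.a γ t ω k) * (c.a t ω k : ℝ) ≤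
        (c.S t ω k - virtualQueue U₀ c.a γ t ω k) * ab k := by
      rw [hp.admission t ω k]
      split_ifs with h
      · exact mul_le_mul_of_nonpos_left (hab k).2 (sub_nonpos.2 h)
      · rw [Nat.cast_zero, mul_zero]
        exact mul_nonneg (sub_nonneg.2 (not_le.1 h).le) (hab k).1
    linarith
  let W : UserSet K → ℝ := fun J =>
    ∑ I : UserSet K with I.1 ⊆ J.1, sys.b J I / sys.F ^ 2 * c.Q sys t ω I -
      ∑ k ∈ J.1, (c.S t ω k : ℝ)
  have hW : ∀ s : UserSet K → ℝ,
      ∑ I, c.Q sys t ω I / sys.F ^ 2 * (∑ J : UserSet K with I.1 ⊆ J.1, sys.b J I * s J) -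
      ∑ k, (c.S t ω k : ℝ) * ∑ J : UserSet K with k ∈ J.1, s J = ∑ J, s J * W J := by
    intro s
    simp only [W, mul_sub, Finset.sum_sub_distrib, Finset.mul_sum, Finset.sum_filter]
    congr 1
    · rw [Finset.sum_comm]
      refine Finset.sum_congr rfl fun J _ => Finset.sum_congr rfl fun I _ => ?_
      split_ifs <;> ring
    · rw [Finset.sum_comm]
      refine Finset.sum_congr rfl fun J _ => ?_
      simp only [mul_ite, mul_zero, Finset.sum_ite_mem, Finset.univ_inter]
      exact Finset.sum_congr rfl fun k _ => mul_comm _ _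
  have hJ : ∑ J, (c.σ t ω J : ℝ) * W J ≤ ∑ J, σb J * W J := by
    refine Finset.sum_le_sum fun J _ => ?_
    rw [hp.routing t ω J]
    split_ifs with h
    · exact mul_le_mul_of_nonpos_right (hσb J).2 (sub_nonpos.2 h.le)
    · rw [Nat.cast_zero, zero_mul]
      exact mul_nonneg (hσb J).1 (sub_nonneg.2 (not_lt.1 h))
  rw [← hW, ← hW] at hJ
  have hk' := Finset.sum_le_sum fun k (_ : k ∈ Finset.univ) => hk k
  simp only [Finset.sum_add_distrib, ← Finset.mul_sum] at hk'
  simp only [mul_sub, Finset.sum_sub_distrib] at hk' ⊢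
  unfold Trajectory.bitsIn
  linarith

variable [IsProbabilityMeasure Pr]

theorem integrable_lyapunov (t : ℕ) : Integrable (lyapunov sys c U₀ γ t) Pr :=
  ((integrable_finsetSum _ fun k _ => (hp.memLp_U t k).integrable_sq.add
    (hp.admissible.memLp_S t k).integrable_sq).add (integrable_finsetSum _ fun I _ =>
    (hp.admissible.memLp_Q t I).integrable_sq.div_const _)).div_const _

/-- The drift of the Lyapunov function in comparison with a static policy. -/
theorem drift_le (hd : ∀ k, 0 < d k) (t : ℕ) {γb ab : Fin K → ℝ}
    {σb x : UserSet K → ℝ} (hγb : ∀ k, γb k ∈ Set.Icc (0 : ℝ) (sys.γmax k))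
    (hab : ∀ k, ab k ∈ Set.Icc (0 : ℝ) (sys.γmax k))
    (hσb : ∀ J, σb J ∈ Set.Icc (0 : ℝ) sys.σmax)
    (hx : ∑ I, (∫ ω, c.Q sys t ω I ∂Pr) * x I ≤ ∑ I, ∫ ω, c.Q sys t ω I * c.μ t ω I ∂Pr) :
    ∫ ω, lyapunov sys c U₀ γ (t + 1) ω ∂Pr ≤ ∫ ω, lyapunov sys c U₀ γ t ω ∂Pr + sys.B
      + V * ∑ k, (∫ ω, utility (α k) (d k) (γ t ω k) ∂Pr - utility (α k) (d k) (γb k))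
      + ∑ k, (∫ ω, virtualQueue U₀ c.a γ t ω k ∂Pr) * (γb k - ab k)
      + ∑ k, (∫ ω, (c.S t ω k : ℝ) ∂Pr) * (ab k - ∑ J : UserSet K with k ∈ J.1, σb J)
      + ∑ I, (∫ ω, c.Q sys t ω I ∂Pr) / sys.F ^ 2 *
        (∑ J : UserSet K with I.1 ⊆ J.1, sys.b J I * σb J - sys.Tslot * x I) := by
  have hc := hp.admissible
  have hF : 0 < sys.F ^ 2 := pow_pos sys.F_pos 2
  set B₀ : ℝ := ∑ k, ((sys.γmax k : ℝ) ^ 2 +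
      1 / 2 * (∑ I : UserSet K with k ∈ I.1, (sys.σmax : ℝ)) ^ 2)
      + 1 / (2 * sys.F ^ 2) * ∑ I, sys.bitsMax I ^ 2 with hB₀
  have hpt : ∀ ω, lyapunov sys c U₀ γ (t + 1) ω ≤ lyapunov sys c U₀ γ t ω + B₀
      + sys.Tslot ^ 2 / (2 * sys.F ^ 2) * ∑ I : UserSet K, ∑ k ∈ I.1,
        (Real.logb 2 (1 + sys.P * (c.h t ω k : ℝ))) ^ 2
      + V * ∑ k, (utility (α k) (d k) (γ t ω k) - utility (α k) (d k) (γb k))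
      + ∑ k, virtualQueue U₀ c.a γ t ω k * (γb k - ab k)
      + ∑ k, (c.S t ω k : ℝ) * (ab k - ∑ J : UserSet K with k ∈ J.1, σb J)
      + ∑ I, c.Q sys t ω I * ((∑ J : UserSet K with I.1 ⊆ J.1, sys.b J I * σb J) / sys.F ^ 2)
      + ∑ I, c.Q sys t ω I * c.μ t ω I * (-(sys.Tslot / sys.F ^ 2)) := by
    intro ω
    have h1 := hp.lyapunov_succ_le t ω
    have h2 := hp.decisions_le t ω hγb hab hσb
    have h3 : sys.Tslot ^ 2 / (2 * sys.F ^ 2) * ∑ I, c.μ t ω I ^ 2 ≤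
        sys.Tslot ^ 2 / (2 * sys.F ^ 2) * ∑ I : UserSet K, ∑ k ∈ I.1,
        (Real.logb 2 (1 + sys.P * (c.h t ω k : ℝ))) ^ 2 :=
      mul_le_mul_of_nonneg_left (Finset.sum_le_sum fun I _ =>
        rate_sq_le_of_mem_capacityRegion (hc.μ_mem t ω) I) (by positivity)
    have e1 : ∑ I, c.Q sys t ω I / sys.F ^ 2 *
        (c.bitsIn sys t ω I - sys.Tslot * c.μ t ω I) =
        ∑ I, c.Q sys t ω I / sys.F ^ 2 * c.bitsIn sys t ω I +
        ∑ I, c.Q sys t ω I * c.μ t ω I * (-(sys.Tslot / sys.F ^ 2)) := by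
      rw [← Finset.sum_add_distrib]
      exact Finset.sum_congr rfl fun I _ => by ring
    have e2 : ∑ I, c.Q sys t ω I / sys.F ^ 2 * ∑ J : UserSet K with I.1 ⊆ J.1, sys.b J I * σb J =
        ∑ I, c.Q sys t ω I * ((∑ J : UserSet K with I.1 ⊆ J.1, sys.b J I * σb J) / sys.F ^ 2) :=
      Finset.sum_congr rfl fun I _ => by ring
    rw [e2] at h2
    rw [e1, ← hB₀] at h1
    linarith
  have hlog : ∀ k, Integrable (fun ω => (Real.logb 2 (1 + sys.P * (c.h t ω k : ℝ))) ^ 2) Pr :=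
    fun k => ((sys.memLp_logb k).comp_measurePreserving (hc.measurePreserving_h t)).integrable_sq
  have i0 := hp.integrable_lyapunov t
  have i2 : Integrable (fun ω => sys.Tslot ^ 2 / (2 * sys.F ^ 2) * ∑ I : UserSet K, ∑ k ∈ I.1,
        (Real.logb 2 (1 + sys.P * (c.h t ω k : ℝ))) ^ 2) Pr :=
    (integrable_finsetSum _ fun I _ => integrable_finsetSum _ fun k _ => hlog k).const_mul _
  have i3' : ∀ k ∈ Finset.univ, Integrable (fun ω => utility (α k) (d k) (γ t ω k) -
      utility (α k) (d k) (γb k)) Pr := fun k _ =>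
    (hp.integrable_utility hd t k).sub (integrable_const _)
  have i3 : Integrable (fun ω => V * ∑ k, (utility (α k) (d k) (γ t ω k) -
      utility (α k) (d k) (γb k))) Pr := (integrable_finsetSum _ i3').const_mul _
  have i4' : ∀ k ∈ Finset.univ, Integrable (fun ω => virtualQueue U₀ c.a γ t ω k *
      (γb k - ab k)) Pr := fun k _ => (hp.integrable_U t k).mul_const _
  have i5' : ∀ k ∈ Finset.univ, Integrable (fun ω => (c.S t ω k : ℝ) *
      (ab k - ∑ J : UserSet K with k ∈ J.1, σb J)) Pr := fun k _ => (hc.integrable_S t k).mul_const _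
  have i6' : ∀ I ∈ Finset.univ, Integrable (fun ω => c.Q sys t ω I *
      ((∑ J : UserSet K with I.1 ⊆ J.1, sys.b J I * σb J) / sys.F ^ 2)) Pr := fun I _ =>
    (hc.integrable_Q t I).mul_const _
  have i7' : ∀ I ∈ Finset.univ, Integrable (fun ω => c.Q sys t ω I * c.μ t ω I *
      (-(sys.Tslot / sys.F ^ 2))) Pr := fun I _ =>
    ((hc.memLp_Q t I).integrable_mul (hc.memLp_μ t I)).mul_const _
  have i4 := integrable_finsetSum _ i4'
  have i5 := integrable_finsetSum _ i5'
  have i6 := integrable_finsetSum _ i6'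
  have i7 := integrable_finsetSum _ i7'
  have j1 := i0.add (integrable_const B₀)
  have j2 := j1.add i2
  have j3 := j2.add i3
  have j4 := j3.add i4
  have j5 := j4.add i5
  have j6 := j5.add i6
  have key := integral_mono (hp.integrable_lyapunov (t + 1)) (j6.add i7) hpt
  rw [integral_add' j6 i7, integral_add' j5 i6, integral_add' j4 i5, integral_add' j3 i4,
    integral_add' j2 i3, integral_add' j1 i2, integral_add' i0 (integrable_const B₀),
    integral_const_mul, integral_const_mul, integral_finsetSum _ i3', integral_finsetSum _ i4',
    integral_finsetSum _ i5', integral_finsetSum _ i6', integral_finsetSum _ i7',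
    integral_finsetSum _ fun I _ => integrable_finsetSum _ fun k _ => hlog k] at key
  have e3 : ∀ I : UserSet K, ∫ ω, ∑ k ∈ I.1, (Real.logb 2 (1 + sys.P * (c.h t ω k : ℝ))) ^ 2 ∂Pr =
      ∑ k ∈ I.1, ∫ h, (Real.logb 2 (1 + sys.P * (h k : ℝ))) ^ 2 ∂sys.ν := by
    intro I
    rw [integral_finsetSum _ fun k _ => hlog k]
    refine Finset.sum_congr rfl fun k _ => ?_
    rw [← hc.law_h t, integral_map (hc.measurable_h' t).aemeasurable
      ((sys.measurable_logb k).pow_const 2).aestronglyMeasurable]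
  have e4 : ∀ k, ∫ ω, (utility (α k) (d k) (γ t ω k) - utility (α k) (d k) (γb k)) ∂Pr =
      ∫ ω, utility (α k) (d k) (γ t ω k) ∂Pr - utility (α k) (d k) (γb k) := fun k => by
    rw [integral_sub (hp.integrable_utility hd t k) (integrable_const _)]
    simp
  simp only [e3, e4, integral_mul_const, integral_const, probReal_univ, one_smul] at key
  have hB : sys.B = B₀ + sys.Tslot ^ 2 / (2 * sys.F ^ 2) *
      ∑ I : UserSet K, ∑ k ∈ I.1, ∫ h, (Real.logb 2 (1 + sys.P * (h k : ℝ))) ^ 2 ∂sys.ν := rfl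
  have e5 : ∑ I, (∫ ω, c.Q sys t ω I ∂Pr) / sys.F ^ 2 *
        (∑ J : UserSet K with I.1 ⊆ J.1, sys.b J I * σb J - sys.Tslot * x I) =
      ∑ I, (∫ ω, c.Q sys t ω I ∂Pr) *
        ((∑ J : UserSet K with I.1 ⊆ J.1, sys.b J I * σb J) / sys.F ^ 2) -
      sys.Tslot / sys.F ^ 2 * ∑ I, (∫ ω, c.Q sys t ω I ∂Pr) * x I := by
    rw [Finset.mul_sum, ← Finset.sum_sub_distrib]
    exact Finset.sum_congr rfl fun I _ => by ring
  -- The transmission term is compared only after taking expectations, so `x` can be any vector of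
  -- mean rates satisfying `hx`, including limits of such vectors.
  have h8 : sys.Tslot / sys.F ^ 2 * ∑ I, (∫ ω, c.Q sys t ω I ∂Pr) * x I ≤
      sys.Tslot / sys.F ^ 2 * ∑ I, ∫ ω, c.Q sys t ω I * c.μ t ω I ∂Pr :=
    mul_le_mul_of_nonneg_left hx (div_nonneg sys.Tslot_pos.le hF.le)
  rw [← Finset.sum_mul] at key
  rw [hB, e5]
  linarith

end IsProposed

end CodedCaching

/-! ### The converse: delivery rates are supported by static policies -/

namespace CodedCaching

theorem liminf_le_of_le_tendsto {u v : ℕ → ℝ} {L : ℝ} (hu : ∀ n, 0 ≤ u n) {φ : ℕ → ℕ}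
    (hφ : Tendsto φ atTop atTop) (huv : ∀ n, u (φ n) ≤ v n) (hv : Tendsto v atTop (nhds L)) :
    liminf u atTop ≤ L := by
  by_contra! h
  obtain ⟨m, hLm, hm⟩ := exists_between h
  have h1 : ∀ᶠ n in atTop, m < u n := eventually_lt_of_lt_liminf hm (isBoundedUnder_of ⟨0, hu⟩)
  have h2 : m ≤ L := ge_of_tendsto hv ((hφ.eventually h1).mono fun n hn => hn.le.trans (huv n))
  linarith

/-- A nonnegative sequence with bounded averages does not stay above the bound. -/
theorem frequently_le_of_sum_le {X : ℕ → ℝ} {M : ℝ} (hX : ∀ n, 0 ≤ X n)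
    (h : ∀ᶠ T : ℕ in atTop, (∑ t ∈ Finset.range T, X t) / T ≤ M) :
    ∃ᶠ T in atTop, X T ≤ M + 1 := by
  intro hc
  obtain ⟨t₀, ht₀⟩ := eventually_atTop.1 (hc.and h)
  have h0 : ∀ n, n * (M + 1) ≤ ∑ t ∈ Finset.range (t₀ + n), X t := by
    intro n
    induction n with
    | zero => simpa using Finset.sum_nonneg fun t _ => hX t
    | succ n ih =>
      rw [← add_assoc, Finset.sum_range_succ]
      have := not_le.1 (ht₀ (t₀ + n) (by omega)).1
      push_cast
      linarith
  obtain ⟨n, hn⟩ := exists_nat_gt (t₀ * M)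
  have h1 := (ht₀ (t₀ + (n + 1)) (by omega)).2
  rw [div_le_iff₀ (by positivity)] at h1
  have h2 := h0 (n + 1)
  push_cast at h1 h2
  nlinarith

variable {K : ℕ} {sys : System K}

theorem System.abs_le_of_mem_meanRates {x : UserSet K → ℝ} (hx : x ∈ sys.meanRates)
    (I : UserSet K) : |x I| ≤ ∫ h, sys.rateBound h ∂sys.ν := by
  obtain ⟨m, hm, hmh, hx⟩ := hx
  rw [hx I]
  exact norm_integral_le_of_norm_le (f := fun h => m h I) sys.integrable_rateBound
    (hmh.mono fun h hh => sys.abs_le_of_mem_rateHull hh I)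

variable {Ω : Type*} [mΩ : MeasurableSpace Ω] {Pr : Measure Ω} {ℱ : Filtration ℕ mΩ} {c : Trajectory K Ω}

/-- The delivery rates `r` can be supported by a static policy with mean numbers of combinations
`σb` and mean transmission rates that are, in the limit, those of static policies. -/
def IsSupported (sys : System K) (r : Fin K → ℝ) (σb x : UserSet K → ℝ) : Prop :=
  x ∈ closure sys.meanRates ∧ (∀ k, r k ≤ ∑ J : UserSet K with k ∈ J.1, σb J) ∧
    ∀ I : UserSet K, ∑ J : UserSet K with I.1 ⊆ J.1, sys.b J I * σb J ≤ sys.Tslot * x I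

theorem meanDelivery_nonneg (sys : System K) (Pr : Measure Ω) (c : Trajectory K Ω) (k : Fin K)
    (T : ℕ) : 0 ≤ meanDelivery sys Pr c k T :=
  div_nonneg (integral_nonneg fun _ => Nat.cast_nonneg _) (Nat.cast_nonneg _)

/-- Compactness: the approximations are bounded, a subsequence converges, and the inequalities pass
to the limit. Delivery rates are lower limits, hence at most the limit of any bound along a
subsequence. -/
theorem exists_isSupported_of_approx {r : Fin K → ℝ} (hr : HasDeliveryRates sys Pr c r) {C : ℝ}
    {φ : ℕ → ℕ} (hφ : Tendsto φ atTop atTop) {y x e : ℕ → UserSet K → ℝ}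
    (hy : ∀ n J, y n J ∈ Set.Icc 0 C) (hx : ∀ n, x n ∈ sys.meanRates)
    (hD : ∀ n k, meanDelivery sys Pr c k (φ n) ≤ ∑ J : UserSet K with k ∈ J.1, y n J)
    (hb : ∀ n (I : UserSet K), ∑ J : UserSet K with I.1 ⊆ J.1, sys.b J I * y n J ≤
      sys.Tslot * x n I + e n I) (he : ∀ I, Tendsto (fun n => e n I) atTop (nhds 0)) :
    ∃ σb x₀, (∀ J, σb J ∈ Set.Icc 0 C) ∧ IsSupported sys r σb x₀ := by
  set M := ∫ h, sys.rateBound h ∂sys.ν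
  have hcomp : IsCompact ((Set.univ.pi fun _ : UserSet K => Set.Icc (0 : ℝ) C) ×ˢ
      (Set.univ.pi fun _ : UserSet K => Set.Icc (-M) M)) :=
    (isCompact_univ_pi fun _ => isCompact_Icc).prod (isCompact_univ_pi fun _ => isCompact_Icc)
  obtain ⟨⟨σb, x₀⟩, hmem, ψ, hψ, hlim⟩ := hcomp.tendsto_subseq (x := fun n => (y n, x n)) fun n =>
    ⟨fun J _ => hy n J, fun I _ => abs_le.1 (sys.abs_le_of_mem_meanRates (hx n) I)⟩
  have hly : ∀ J, Tendsto (fun n => y (ψ n) J) atTop (nhds (σb J)) := fun J =>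
    ((continuous_apply J).tendsto _).comp ((continuous_fst.tendsto _).comp hlim)
  have hlx : Tendsto (fun n => x (ψ n)) atTop (nhds x₀) := (continuous_snd.tendsto _).comp hlim
  have hlx' : ∀ I, Tendsto (fun n => x (ψ n) I) atTop (nhds (x₀ I)) := fun I =>
    ((continuous_apply I).tendsto _).comp hlx
  refine ⟨σb, x₀, fun J => hmem.1 J trivial, ?_, fun k => ?_, fun I => ?_⟩
  · exact mem_closure_of_tendsto hlx (.of_forall fun n => hx _)
  · rw [hr k]
    exact liminf_le_of_le_tendsto (meanDelivery_nonneg sys Pr c k) (hφ.comp hψ.tendsto_atTop)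
      (fun n => hD (ψ n) k) (tendsto_finsetSum _ fun J _ => hly J)
  · have h1 : Tendsto (fun n => sys.Tslot * x (ψ n) I + e (ψ n) I) atTop
        (nhds (sys.Tslot * x₀ I + 0)) :=
      ((hlx' I).const_mul _).add ((he I).comp hψ.tendsto_atTop)
    rw [add_zero] at h1
    exact le_of_tendsto_of_tendsto' (tendsto_finsetSum _ fun J _ => (hly J).const_mul _) h1
      fun n => hb (ψ n) I

namespace IsAdmissible

variable [IsProbabilityMeasure Pr] (hc : IsAdmissible sys Pr ℱ c)
include hc

theorem meanDelivery_le (k : Fin K) {T : ℕ} (hT : 0 < T) :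
    meanDelivery sys Pr c k T ≤ (∫ ω, (c.S₀ ω k : ℝ) ∂Pr) / T + sys.γmax k := by
  have hT' : (0 : ℝ) < T := Nat.cast_pos.2 hT
  unfold meanDelivery
  rw [div_add' _ _ _ hT'.ne']
  refine div_le_div_of_nonneg_right ?_ hT'.le
  have h0 : Integrable (fun ω => (c.S₀ ω k : ℝ)) Pr := hc.integrable_S 0 k
  calc ∫ ω, (c.D sys T ω k : ℝ) ∂Pr ≤ ∫ ω, ((c.S₀ ω k : ℝ) + sys.γmax k * T) ∂Pr := by
        refine integral_mono (hc.integrable_D T k) (h0.add (integrable_const _)) fun ω => ?_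
        have := hc.D_le_admitted T ω k
        rw [← Nat.cast_le (α := ℝ)] at this
        push_cast at this
        simpa [mul_comm] using this
    _ = _ := by
        rw [integral_add h0 (integrable_const _)]
        simp

theorem deliveryRate_mem_Icc {r : Fin K → ℝ} (hr : HasDeliveryRates sys Pr c r) (k : Fin K) :
    r k ∈ Set.Icc (0 : ℝ) (sys.γmax k) := by
  constructor
  · rw [hr k]
    refine le_liminf_of_le (Filter.IsBoundedUnder.isCoboundedUnder_ge ?_)
      (.of_forall fun T => meanDelivery_nonneg sys Pr c k T)
    refine ⟨∫ ω, (c.S₀ ω k : ℝ) ∂Pr + sys.γmax k, ?_⟩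
    rw [eventually_map]
    filter_upwards [eventually_gt_atTop 0] with T hT
    refine (hc.meanDelivery_le k hT).trans (add_le_add_left ?_ _)
    exact div_le_self (integral_nonneg fun _ => Nat.cast_nonneg _) (Nat.one_le_cast.2 hT)
  · rw [hr k]
    have h1 : Tendsto (fun n : ℕ => (∫ ω, (c.S₀ ω k : ℝ) ∂Pr) / ((n + 1 : ℕ) : ℝ) + sys.γmax k)
        atTop (nhds (0 + sys.γmax k)) :=
      ((tendsto_const_div_atTop_nhds_zero_nat _).comp (tendsto_add_atTop_nat 1)).add_const _
    rw [zero_add] at h1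
    exact liminf_le_of_le_tendsto (meanDelivery_nonneg sys Pr c k) (tendsto_add_atTop_nat 1)
      (fun n => hc.meanDelivery_le k n.succ_pos) h1

theorem average_mem_meanRates {T : ℕ} (hT : 0 < T) :
    (fun I => (∑ t ∈ Finset.range T, ∫ ω, c.μ t ω I ∂Pr) / T) ∈ sys.meanRates := by
  have h := sys.convex_meanRates.sum_mem (t := Finset.range T) (w := fun _ => (T : ℝ)⁻¹)
    (z := fun t I => ∫ ω, c.μ t ω I ∂Pr) (fun _ _ => by positivity)
    (by simp [hT.ne']) (fun t _ => hc.mean_rate_mem_meanRates t)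
  convert h using 1
  funext I
  simp [Finset.sum_apply, ← Finset.mul_sum, div_eq_inv_mul]

theorem integral_bitsOut_le (T : ℕ) (I : UserSet K) :
    ∫ ω, c.bitsOut sys T ω I ∂Pr ≤ sys.Tslot * ∑ t ∈ Finset.range T, ∫ ω, c.μ t ω I ∂Pr := by
  rw [← integral_finsetSum _ fun t _ => hc.integrable_μ t I, ← integral_const_mul]
  exact integral_mono (hc.integrable_bitsOut T I)
    ((integrable_finsetSum _ fun t _ => hc.integrable_μ t I).const_mul _)
    fun ω => c.bitsOut_le sys T ω I

theorem exists_isSupported_of_isStable (hs : IsStable sys Pr c) {r : Fin K → ℝ}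
    (hr : HasDeliveryRates sys Pr c r) :
    ∃ σb x, (∀ J, σb J ∈ Set.Icc (0 : ℝ) sys.σmax) ∧ IsSupported sys r σb x := by
  have hQ0 : ∀ t I, 0 ≤ ∫ ω, c.Q sys t ω I ∂Pr := fun t I =>
    integral_nonneg fun ω => hc.Q_nonneg t ω I
  have hI : ∀ I, ∃ M : ℝ, ∀ᶠ T : ℕ in atTop,
      (∑ t ∈ Finset.range T, ∫ ω, c.Q sys t ω I ∂Pr) / T ≤ M := by
    intro I
    obtain ⟨M, hM1, hM2⟩ := EReal.lt_iff_exists_real_btwn.1 (hs.2 I)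
    refine ⟨M, (eventually_lt_of_limsup_lt hM1).mono fun T hT => ?_⟩
    exact (EReal.coe_lt_coe_iff.1 hT).le
  choose M hM using hI
  -- Summing over `I` first provides times at which all codeword queues have bounded mean
  -- simultaneously; their backlog per slot then vanishes along these times.
  have hfreq : ∃ᶠ T in atTop, ∑ I, ∫ ω, c.Q sys T ω I ∂Pr ≤ ∑ I, M I + 1 := by
    refine frequently_le_of_sum_le (fun t => Finset.sum_nonneg fun I _ => hQ0 t I) ?_
    filter_upwards [eventually_all.2 hM] with T hT
    rw [Finset.sum_comm, Finset.sum_div]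
    exact Finset.sum_le_sum fun I _ => hT I
  obtain ⟨φ, hφ, hφM⟩ := extraction_of_frequently_atTop
    (hfreq.and_eventually (eventually_gt_atTop 0))
  have hpos : ∀ n, (0 : ℝ) < φ n := fun n => Nat.cast_pos.2 (hφM n).2
  refine exists_isSupported_of_approx (φ := φ) hr hφ.tendsto_atTop
    (y := fun n J => (∑ t ∈ Finset.range (φ n), ∫ ω, (c.σ t ω J : ℝ) ∂Pr) / φ n)
    (x := fun n I => (∑ t ∈ Finset.range (φ n), ∫ ω, c.μ t ω I ∂Pr) / φ n)
    (e := fun n I => (∫ ω, c.Q sys (φ n) ω I ∂Pr) / φ n) ?_ ?_ ?_ ?_ ?_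
  · intro n J
    refine ⟨div_nonneg (Finset.sum_nonneg fun t _ => integral_nonneg fun _ => Nat.cast_nonneg _)
      (hpos n).le, ?_⟩
    rw [div_le_iff₀ (hpos n), mul_comm]
    have h1 : ∀ t ∈ Finset.range (φ n), ∫ ω, (c.σ t ω J : ℝ) ∂Pr ≤ sys.σmax := fun t _ => by
      calc _ ≤ ∫ _, (sys.σmax : ℝ) ∂Pr := integral_mono (hc.integrable_σ t J) (integrable_const _)
            fun ω => Nat.cast_le.2 (hc.σ_le t ω J)
        _ = _ := by simp
    simpa using Finset.sum_le_card_nsmul _ _ _ h1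
  · exact fun n => hc.average_mem_meanRates (hφM n).2
  · intro n k
    rw [← Finset.sum_div, Finset.sum_comm]
    refine div_le_div_of_nonneg_right ?_ (hpos n).le
    have hi : ∀ t, Integrable (fun ω => ∑ J : UserSet K with k ∈ J.1, (c.σ t ω J : ℝ)) Pr :=
      fun t => integrable_finsetSum _ fun J _ => hc.integrable_σ t J
    have e1 : ∑ t ∈ Finset.range (φ n), ∑ J : UserSet K with k ∈ J.1, ∫ ω, (c.σ t ω J : ℝ) ∂Pr =
        ∫ ω, ∑ t ∈ Finset.range (φ n), ∑ J : UserSet K with k ∈ J.1, (c.σ t ω J : ℝ) ∂Pr := by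
      rw [integral_finsetSum _ fun t _ => hi t]
      exact Finset.sum_congr rfl fun t _ => (integral_finsetSum _ fun J _ =>
        hc.integrable_σ t J).symm
    rw [e1]
    refine integral_mono (hc.integrable_D _ k) (integrable_finsetSum _ fun t _ => hi t) fun ω => ?_
    have := hc.D_le_sum_σ (φ n) ω k
    rw [← Nat.cast_le (α := ℝ)] at this
    push_cast at this
    exact this
  · intro n I
    have h1 : ∑ t ∈ Finset.range (φ n), ∫ ω, c.bitsIn sys t ω I ∂Pr ≤
        sys.Tslot * ∑ t ∈ Finset.range (φ n), ∫ ω, c.μ t ω I ∂Pr +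
          ∫ ω, c.Q sys (φ n) ω I ∂Pr := by
      have hi := integrable_finsetSum (Finset.range (φ n)) fun t _ => hc.integrable_bitsIn t I
      rw [← integral_finsetSum _ fun t _ => hc.integrable_bitsIn t I]
      calc _ ≤ ∫ ω, (c.Q sys (φ n) ω I + c.bitsOut sys (φ n) ω I) ∂Pr := by
            refine integral_mono hi
              ((hc.integrable_Q _ I).add (hc.integrable_bitsOut _ I)) fun ω => ?_
            dsimp only
            rw [c.Q_add_bitsOut sys]
            linarith [hc.Q₀_nonneg ω I]
        _ ≤ _ := by
            rw [integral_add (hc.integrable_Q _ I) (hc.integrable_bitsOut _ I)]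
            linarith [hc.integral_bitsOut_le (φ n) I]
    have h2 : ∑ J : UserSet K with I.1 ⊆ J.1, sys.b J I *
        ((∑ t ∈ Finset.range (φ n), ∫ ω, (c.σ t ω J : ℝ) ∂Pr) / φ n) =
        (∑ t ∈ Finset.range (φ n), ∫ ω, c.bitsIn sys t ω I ∂Pr) / φ n := by
      simp only [← mul_div_assoc, ← Finset.sum_div, Finset.mul_sum]
      rw [Finset.sum_comm]
      congr 1
      refine Finset.sum_congr rfl fun t _ => ?_
      unfold Trajectory.bitsIn
      rw [integral_finsetSum _ fun J _ => (hc.integrable_σ t J).const_mul _]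
      exact Finset.sum_congr rfl fun J _ => (integral_const_mul _ _).symm
    rw [h2, ← mul_div_assoc, ← add_div]
    exact div_le_div_of_nonneg_right h1 (hpos n).le
  · intro I
    have h1 : Tendsto (fun n => (∑ I, M I + 1) / (φ n : ℝ)) atTop (nhds 0) :=
      (tendsto_const_div_atTop_nhds_zero_nat _).comp hφ.tendsto_atTop
    refine squeeze_zero (fun n => div_nonneg (hQ0 _ I) (hpos n).le) (fun n => ?_) h1
    refine div_le_div_of_nonneg_right (le_trans ?_ (hφM n).1) (hpos n).le
    exact Finset.single_le_sum (f := fun I => ∫ ω, c.Q sys (φ n) ω I ∂Pr) (fun I _ => hQ0 _ I)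
      (Finset.mem_univ I)

/-- Stability is replaced by counting only what is delivered: `deliveredTo` supplies the combination
numbers, and the useful bits fit into actual transmissions after reassignment, with no error term.
The price is that the bound `σmax` on each combination number is lost. -/
theorem exists_isSupported_nonneg {r : Fin K → ℝ} (hr : HasDeliveryRates sys Pr c r) :
    ∃ σb x, (∀ J, 0 ≤ σb J) ∧ IsSupported sys r σb x := by
  have hpos : ∀ n : ℕ, (0 : ℝ) < ((n + 1 : ℕ) : ℝ) := fun n => Nat.cast_pos.2 n.succ_pos
  set C : ℝ := ∑ _J : UserSet K, (sys.σmax : ℝ)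
  let Eμ : ℕ → UserSet K → ℝ := fun n I => ∑ t ∈ Finset.range (n + 1), ∫ ω, c.μ t ω I ∂Pr
  let Z : ℕ → UserSet K → UserSet K → ℝ := fun n I' I => ∫ ω, c.usefulBits sys (n + 1) ω I' I ∂Pr
  -- The share of the mean service of `I'` that is spent on bits useful to exactly `I`. Where that
  -- service is zero, `Z` vanishes as well, so the value zero of the quotient is the right one.
  let θ : ℕ → UserSet K → UserSet K → ℝ := fun n I' I => Z n I' I / (sys.Tslot * Eμ n I')
  have hEμ : ∀ n I, 0 ≤ Eμ n I := fun n I =>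
    Finset.sum_nonneg fun t _ => integral_nonneg fun ω => hc.μ_nonneg t ω I
  have hZ0 : ∀ n I' I, 0 ≤ Z n I' I := fun n I' I =>
    integral_nonneg fun ω => c.usefulBits_nonneg sys _ ω I' I
  have hZ : ∀ n I', ∑ I, Z n I' I ≤ sys.Tslot * Eμ n I' := by
    intro n I'
    have hi : ∀ I ∈ Finset.univ, Integrable (fun ω => c.usefulBits sys (n + 1) ω I' I) Pr :=
      fun I _ => hc.integrable_usefulBits (n + 1) I' I
    simp only [Z]
    rw [← integral_finsetSum _ hi]
    exact (integral_mono (integrable_finsetSum _ hi) (hc.integrable_bitsOut (n + 1) I')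
      fun ω => hc.sum_usefulBits_le (n + 1) ω I').trans (hc.integral_bitsOut_le (n + 1) I')
  have hθ0 : ∀ n I' I, 0 ≤ θ n I' I := fun n I' I =>
    div_nonneg (hZ0 n I' I) (mul_nonneg sys.Tslot_pos.le (hEμ n I'))
  have hθ : ∀ n I' I, ¬ I.1 ⊆ I'.1 → θ n I' I = 0 := fun n I' I h => by
    simp only [θ, Z]
    simp [c.usefulBits_eq_zero sys _ _ h]
  have hθ1 : ∀ n I', ∑ I, θ n I' I ≤ 1 := fun n I' => by
    simp only [θ]
    rw [← Finset.sum_div]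
    exact div_le_one_of_le₀ (hZ n I') (mul_nonneg sys.Tslot_pos.le (hEμ n I'))
  have hθμ : ∀ n I' I, sys.Tslot * (θ n I' I * Eμ n I') = Z n I' I := by
    intro n I' I
    rcases (hEμ n I').eq_or_lt with h | h
    · have h1 := hZ n I'
      rw [← h, mul_zero] at h1
      have h2 := Finset.single_le_sum (f := fun I => Z n I' I) (fun I _ => hZ0 n I' I)
        (Finset.mem_univ I)
      rw [← h, mul_zero, mul_zero]
      exact le_antisymm (hZ0 n I' I) (h2.trans h1)
    · have := sys.Tslot_pos
      simp only [θ]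
      field_simp
  obtain ⟨σb, x, h1, h2⟩ := exists_isSupported_of_approx (C := C) (φ := fun n => n + 1) hr
    (tendsto_add_atTop_nat 1)
    (y := fun n A => (∫ ω, c.deliveredTo sys (n + 1) ω A ∂Pr) / ((n + 1 : ℕ) : ℝ))
    (x := fun n I => ∑ I', θ n I' I * (Eμ n I' / ((n + 1 : ℕ) : ℝ)))
    (e := fun _ _ => 0) (by
      intro n A
      refine ⟨div_nonneg (integral_nonneg fun ω => c.deliveredTo_nonneg sys _ ω A) (hpos n).le, ?_⟩
      rw [div_le_iff₀ (hpos n)]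
      calc _ ≤ ∫ _, C * ((n + 1 : ℕ) : ℝ) ∂Pr := by
            refine integral_mono (hc.integrable_deliveredTo _ A) (integrable_const _) fun ω => ?_
            have h3 : ∀ t ∈ Finset.range (n + 1), (∑ J : UserSet K,
                if c.deliveredUsers sys (n + 1) t ω J = A.1 then (c.σ t ω J : ℝ) else 0) ≤ C :=
              fun t _ => Finset.sum_le_sum fun J _ => by
                split_ifs
                exacts [Nat.cast_le.2 (hc.σ_le t ω J), Nat.cast_nonneg _]
            have := Finset.sum_le_card_nsmul _ _ _ h3
            rw [Finset.card_range, nsmul_eq_mul, mul_comm] at this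
            exact this
        _ = _ := by simp)
    (fun n => sys.reassign_mem_meanRates (hc.average_mem_meanRates n.succ_pos) (θ n) (hθ0 n)
      (hθ n) (hθ1 n))
    (by
      intro n k
      rw [← Finset.sum_div]
      refine div_le_div_of_nonneg_right ?_ (hpos n).le
      have hi : ∀ A ∈ Finset.univ.filter fun A : UserSet K => k ∈ A.1,
          Integrable (fun ω => c.deliveredTo sys (n + 1) ω A) Pr :=
        fun A _ => hc.integrable_deliveredTo (n + 1) A
      rw [← integral_finsetSum _ hi]
      exact integral_mono (hc.integrable_D _ k) (integrable_finsetSum _ hi)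
        fun ω => hc.D_le_sum_deliveredTo (n + 1) ω k)
    (by
      intro n I
      have e1 : ∑ A : UserSet K with I.1 ⊆ A.1, sys.b A I *
          ((∫ ω, c.deliveredTo sys (n + 1) ω A ∂Pr) / ((n + 1 : ℕ) : ℝ)) =
          (∑ I', Z n I' I) / ((n + 1 : ℕ) : ℝ) := by
        simp only [← mul_div_assoc, ← Finset.sum_div, Z]
        congr 1
        rw [← integral_finsetSum _ fun I' _ => hc.integrable_usefulBits (n + 1) I' I]
        simp only [← c.sum_b_mul_deliveredTo sys]
        rw [integral_finsetSum _ fun A _ => (hc.integrable_deliveredTo (n + 1) A).const_mul _]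
        exact Finset.sum_congr rfl fun A _ => (integral_const_mul _ _).symm
      rw [e1, add_zero, Finset.mul_sum, Finset.sum_div]
      refine Finset.sum_le_sum fun I' _ => ?_
      rw [← hθμ, ← mul_div_assoc, ← mul_div_assoc])
    (fun _ => tendsto_const_nhds)
  exact ⟨σb, x, fun J => (h1 J).1, h2⟩

end IsAdmissible

/-- The numbers of combinations can be capped if the rates do not exceed the cap. -/
theorem IsSupported.cap {r : Fin K → ℝ} {σb x : UserSet K → ℝ} (h : IsSupported sys r σb x)
    (hσ : ∀ J, 0 ≤ σb J) (hr : ∀ k, r k ≤ sys.σmax) :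
    IsSupported sys r (fun J => min (σb J) sys.σmax) x := by
  have hnn : ∀ J, 0 ≤ min (σb J) (sys.σmax : ℝ) := fun J => le_min (hσ J) (Nat.cast_nonneg _)
  refine ⟨h.1, fun k => ?_, fun I => ?_⟩
  -- A single set at the cap already serves `r k ≤ σmax`; otherwise no term for `k` is changed.
  · by_cases hex : ∃ J : UserSet K, k ∈ J.1 ∧ (sys.σmax : ℝ) ≤ σb J
    · obtain ⟨J, hkJ, hJ⟩ := hex
      refine ((hr k).trans_eq (min_eq_right hJ).symm).trans ?_
      exact Finset.single_le_sum (f := fun J => min (σb J) (sys.σmax : ℝ)) (fun J _ => hnn J)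
        (Finset.mem_filter.2 ⟨Finset.mem_univ J, hkJ⟩)
    · push Not at hex
      refine (h.2.1 k).trans_eq (Finset.sum_congr rfl fun J hJ => ?_)
      exact (min_eq_left (hex J (Finset.mem_filter.1 hJ).2).le).symm
  · refine le_trans (Finset.sum_le_sum fun J _ => ?_) (h.2.2 I)
    exact mul_le_mul_of_nonneg_left (min_le_left _ _) (sys.b_nonneg J I)

theorem exists_isSupported {r : Fin K → ℝ}
    (h : r ∈ stableRates sys ∨ ((∀ k, sys.γmax k ≤ sys.σmax) ∧ r ∈ feasibleRates sys)) :
    (∀ k, r k ∈ Set.Icc (0 : ℝ) (sys.γmax k)) ∧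
    ∃ σb x, (∀ J, σb J ∈ Set.Icc (0 : ℝ) sys.σmax) ∧ IsSupported sys r σb x := by
  rcases h with ⟨Ω, mΩ, Pr, hPr, ℱ, c, hc, hs, hr⟩ | ⟨hγ, Ω, mΩ, Pr, hPr, ℱ, c, hc, hr⟩
  · exact ⟨hc.deliveryRate_mem_Icc hr, hc.exists_isSupported_of_isStable hs hr⟩
  · have hmem := hc.deliveryRate_mem_Icc hr
    obtain ⟨σb, x, h0, hsup⟩ := hc.exists_isSupported_nonneg hr
    exact ⟨hmem, _, x, fun J => ⟨le_min (h0 J) (Nat.cast_nonneg _), min_le_right _ _⟩,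
      hsup.cap h0 fun k => (hmem k).2.trans (Nat.cast_le.2 (hγ k))⟩

end CodedCaching

/-! ### Mean rate stability, utility bound and backlog bound -/

namespace CodedCaching

variable {K : ℕ} {sys : System K} {Ω : Type*} [mΩ : MeasurableSpace Ω]
  {Pr : Measure Ω} [IsProbabilityMeasure Pr] {ℱ : Filtration ℕ mΩ} {c : Trajectory K Ω}
  {U₀ : Ω → Fin K → ℝ} {γ : ℕ → Ω → Fin K → ℝ} {V : ℝ} {α d : Fin K → ℝ}

/-- If the second moment of a queue grows at most linearly, then the queue is mean rate stable. -/
theorem tendsto_integral_div_of_sq_le {f : ℕ → Ω → ℝ} {A : ℝ} (hf0 : ∀ t ω, 0 ≤ f t ω)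
    (hf : ∀ t, MemLp (f t) 2 Pr) (hA : ∀ t : ℕ, ∫ ω, f t ω ^ 2 ∂Pr ≤ A * (t + 1)) :
    Tendsto (fun T : ℕ => (∫ ω, f T ω ∂Pr) / T) atTop (nhds 0) := by
  have hA0 : 0 ≤ A := by
    have := (integral_nonneg fun ω => sq_nonneg (f 0 ω)).trans (hA 0)
    simpa using this
  have hlim : Tendsto (fun T : ℕ => (2 * A + 1) / Real.sqrt T) atTop (nhds 0) :=
    tendsto_const_nhds.div_atTop (Real.tendsto_sqrt_atTop.comp tendsto_natCast_atTop_atTop)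
  refine squeeze_zero' (.of_forall fun T => div_nonneg (integral_nonneg (hf0 T))
    (Nat.cast_nonneg _)) ?_ hlim
  filter_upwards [eventually_ge_atTop 1] with T hT
  have hT' : (1 : ℝ) ≤ T := Nat.one_le_cast.2 hT
  -- The scale `√T` balances the two terms of `f ≤ f ^ 2 / q + q` when the second moment is of order
  -- `T`.
  set q := Real.sqrt T
  have hq : 0 < q := Real.sqrt_pos.2 (by linarith)
  have hqT : q * q = T := Real.mul_self_sqrt (by linarith)
  have h1 : ∫ ω, f T ω ∂Pr ≤ ∫ ω, (f T ω ^ 2 / q + q) ∂Pr := by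
    refine integral_mono ((hf T).integrable one_le_two)
      (((hf T).integrable_sq.div_const q).add (integrable_const q)) fun ω => ?_
    dsimp only
    rw [div_add' _ _ _ hq.ne', le_div_iff₀ hq]
    nlinarith [sq_nonneg (f T ω - q), sq_nonneg (f T ω + q)]
  rw [integral_add ((hf T).integrable_sq.div_const q) (integrable_const q), integral_div] at h1
  simp only [integral_const, probReal_univ, one_smul] at h1
  have h2 : (∫ ω, f T ω ^ 2 ∂Pr) / q ≤ 2 * A * q := by
    rw [div_le_iff₀ hq, mul_assoc, hqT]
    exact (hA T).trans (by nlinarith)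
  rw [div_le_div_iff₀ (by linarith) hq, ← hqT]
  nlinarith

namespace IsProposed

variable (hp : IsProposed sys V α d Pr ℱ c U₀ γ)
include hp

theorem integral_utility_le (hd : ∀ k, 0 < d k) (t : ℕ) (k : Fin K) :
    ∫ ω, utility (α k) (d k) (γ t ω k) ∂Pr ≤ utility (α k) (d k) (sys.γmax k) := by
  calc _ ≤ ∫ _, utility (α k) (d k) (sys.γmax k) ∂Pr :=
        integral_mono (hp.integrable_utility hd t k) (integrable_const _) fun ω =>
          monotoneOn_utility (hd k) (hp.γ_mem t ω k).1 (Set.mem_Ici.2 (Nat.cast_nonneg _))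
            (hp.γ_mem t ω k).2
    _ = _ := by simp

/-- The second moments of the queues grow at most linearly. -/
theorem exists_lyapunov_le (hV : 0 < V) (hd : ∀ k, 0 < d k) :
    ∃ A, ∀ t : ℕ, ∫ ω, lyapunov sys c U₀ γ t ω ∂Pr ≤ A * (t + 1) := by
  have hc := hp.admissible
  set C := sys.B + V * ∑ k, (utility (α k) (d k) (sys.γmax k) - utility (α k) (d k) 0)
  have h1 : ∀ t : ℕ, ∫ ω, lyapunov sys c U₀ γ (t + 1) ω ∂Pr ≤
      ∫ ω, lyapunov sys c U₀ γ t ω ∂Pr + C := by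
    intro t
    have hz : ∀ k, (0 : ℝ) ∈ Set.Icc (0 : ℝ) (sys.γmax k) := fun k => ⟨le_rfl, Nat.cast_nonneg _⟩
    -- Comparison with the idle policy: all queue terms disappear and the drift is bounded by a
    -- constant.
    have h := hp.drift_le hd t (γb := fun _ => 0) (ab := fun _ => 0) (σb := fun _ => 0)
      (x := fun _ => 0) hz hz (fun J => ⟨le_rfl, Nat.cast_nonneg _⟩) (by
        simp only [mul_zero, Finset.sum_const_zero]
        exact Finset.sum_nonneg fun I _ => integral_nonneg fun ω =>
          mul_nonneg (hc.Q_nonneg t ω I) (hc.μ_nonneg t ω I))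
    simp only [mul_zero, Finset.sum_const_zero, sub_zero, add_zero] at h
    have h2 : V * ∑ k, (∫ ω, utility (α k) (d k) (γ t ω k) ∂Pr - utility (α k) (d k) 0) ≤
        V * ∑ k, (utility (α k) (d k) (sys.γmax k) - utility (α k) (d k) 0) :=
      mul_le_mul_of_nonneg_left (Finset.sum_le_sum fun k _ =>
        sub_le_sub_right (hp.integral_utility_le hd t k) _) hV.le
    linarith
  have h0 : 0 ≤ ∫ ω, lyapunov sys c U₀ γ 0 ω ∂Pr :=
    integral_nonneg fun ω => lyapunov_nonneg sys c U₀ γ 0 ω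
  refine ⟨∫ ω, lyapunov sys c U₀ γ 0 ω ∂Pr + |C|, fun t => ?_⟩
  have hC := le_abs_self C
  have hC' := abs_nonneg C
  induction t with
  | zero => simp
  | succ t ih =>
    have := h1 t
    push_cast
    linarith

theorem tendsto_queue_div (hV : 0 < V) (hd : ∀ k, 0 < d k) {f : ℕ → Ω → ℝ} {a : ℝ}
    (hf0 : ∀ t ω, 0 ≤ f t ω) (hf : ∀ t, MemLp (f t) 2 Pr) (ha : 0 ≤ a)
    (hfL : ∀ t ω, f t ω ^ 2 ≤ a * lyapunov sys c U₀ γ t ω) :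
    Tendsto (fun T : ℕ => (∫ ω, f T ω ∂Pr) / T) atTop (nhds 0) := by
  obtain ⟨A, hA⟩ := hp.exists_lyapunov_le hV hd
  refine tendsto_integral_div_of_sq_le (A := a * A) hf0 hf fun t => ?_
  calc _ ≤ ∫ ω, a * lyapunov sys c U₀ γ t ω ∂Pr := integral_mono (hf t).integrable_sq
        ((hp.integrable_lyapunov t).const_mul a) (hfL t)
    _ = a * ∫ ω, lyapunov sys c U₀ γ t ω ∂Pr := integral_const_mul _ _
    _ ≤ a * (A * (t + 1)) := mul_le_mul_of_nonneg_left (hA t) ha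
    _ = _ := (mul_assoc _ _ _).symm

/-- The auxiliary rates exceed the delivery rates by a vanishing amount. -/
theorem exists_average_le_meanDelivery (hV : 0 < V) (hd : ∀ k, 0 < d k) (k : Fin K) :
    ∃ δ : ℕ → ℝ, Tendsto δ atTop (nhds 0) ∧ (∀ T, 0 ≤ δ T) ∧
      ∀ T : ℕ, (∑ t ∈ Finset.range T, ∫ ω, γ t ω k ∂Pr) / T ≤
        meanDelivery sys Pr c k T + δ T := by
  have hc := hp.admissible
  obtain ⟨β, hβ, hb⟩ := sys.exists_pos_le_b
  have tU := hp.tendsto_queue_div hV hd (fun t ω => hp.U_nonneg t ω k)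
    (fun t => hp.memLp_U t k) zero_le_two fun t ω => by
      have := U_sq_add_S_sq_le_lyapunov sys c U₀ γ t ω k
      have := sq_nonneg (c.S t ω k : ℝ)
      linarith
  have tS := hp.tendsto_queue_div hV hd (fun t ω => Nat.cast_nonneg (c.S t ω k))
    (fun t => hc.memLp_S t k) zero_le_two fun t ω => by
      have := U_sq_add_S_sq_le_lyapunov sys c U₀ γ t ω k
      have := sq_nonneg (virtualQueue U₀ c.a γ t ω k)
      linarith
  have tQ : ∀ I, Tendsto (fun T : ℕ => (∫ ω, c.Q sys T ω I ∂Pr) / T) atTop (nhds 0) := fun I =>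
    hp.tendsto_queue_div hV hd (fun t ω => hc.Q_nonneg t ω I)
      (fun t => hc.memLp_Q t I) (by positivity) fun t ω => Q_sq_le_lyapunov sys c U₀ γ t ω I
  refine ⟨fun T => (∫ ω, virtualQueue U₀ c.a γ T ω k ∂Pr) / T + (∫ ω, (c.S T ω k : ℝ) ∂Pr) / T +
    (∑ I, (sys.bitsMax I / T + (∫ ω, c.Q sys T ω I ∂Pr) / T)) / β, ?_, fun T => ?_, fun T => ?_⟩
  · have := (tU.add tS).add ((tendsto_finsetSum Finset.univ fun I _ =>
      (tendsto_const_div_atTop_nhds_zero_nat (sys.bitsMax I)).add (tQ I)).div_const β)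
    simpa using this
  · refine add_nonneg (add_nonneg ?_ ?_) (div_nonneg (Finset.sum_nonneg fun I _ =>
      add_nonneg ?_ ?_) hβ.le)
    · exact div_nonneg (integral_nonneg fun ω => hp.U_nonneg T ω k) (Nat.cast_nonneg _)
    · exact div_nonneg (integral_nonneg fun ω => Nat.cast_nonneg _) (Nat.cast_nonneg _)
    · exact div_nonneg (sys.bitsMax_nonneg I) (Nat.cast_nonneg _)
    · exact div_nonneg (integral_nonneg fun ω => hc.Q_nonneg T ω I) (Nat.cast_nonneg _)
  -- An auxiliary arrival that does not correspond to a delivery is accounted for by the virtual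
  -- queue, the user queue or the unsent batches of the codeword queues.
  · have hpt : ∀ ω, ∑ t ∈ Finset.range T, γ t ω k ≤ (c.D sys T ω k : ℝ) +
        virtualQueue U₀ c.a γ T ω k + (c.S T ω k : ℝ) +
        (∑ I, (sys.bitsMax I + c.Q sys T ω I)) / β := by
      intro ω
      have h1 := sum_γ_le U₀ c.a γ T ω k
      have h2 := hc.S_add_sum_x T ω k
      rw [← Nat.cast_inj (R := ℝ)] at h2
      push_cast at h2
      have h3 := hc.sum_x_le_D_add hβ hb T ω k
      have h4 := hp.U₀_nonneg ω k
      have h5 : (0 : ℝ) ≤ c.S₀ ω k := Nat.cast_nonneg _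
      linarith
    have iQ : ∀ I ∈ Finset.univ, Integrable (fun ω => sys.bitsMax I + c.Q sys T ω I) Pr :=
      fun I _ => (integrable_const _).add (hc.integrable_Q T I)
    have j1 := (hc.integrable_D T k).add (hp.integrable_U T k)
    have j2 := j1.add (hc.integrable_S T k)
    have j3 := (integrable_finsetSum _ iQ).div_const β
    have h := integral_mono (integrable_finsetSum _ fun t _ => hp.integrable_γ t k) (j2.add j3) hpt
    rw [integral_add' j2 j3, integral_add' j1 (hc.integrable_S T k),
      integral_add' (hc.integrable_D T k) (hp.integrable_U T k), integral_div,
      integral_finsetSum _ iQ, integral_finsetSum _ fun t _ => hp.integrable_γ t k] at h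
    have e : ∀ I, ∫ ω, (sys.bitsMax I + c.Q sys T ω I) ∂Pr =
        sys.bitsMax I + ∫ ω, c.Q sys T ω I ∂Pr := fun I => by
      rw [integral_add (integrable_const _) (hc.integrable_Q T I)]
      simp
    simp only [e] at h
    have h' := div_le_div_of_nonneg_right h (Nat.cast_nonneg (α := ℝ) T)
    refine h'.trans_eq ?_
    simp only [← add_div, ← Finset.sum_div]
    unfold meanDelivery
    ring

/-- Jensen's inequality is used twice, for the expectation and for the time average. -/
theorem average_integral_utility_le (hα : ∀ k, 0 ≤ α k) (hd : ∀ k, 0 < d k) (k : Fin K) {T : ℕ}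
    (hT : 0 < T) : (∑ t ∈ Finset.range T, ∫ ω, utility (α k) (d k) (γ t ω k) ∂Pr) / T ≤
      utility (α k) (d k) ((∑ t ∈ Finset.range T, ∫ ω, γ t ω k ∂Pr) / T) := by
  have hconc := concaveOn_utility (hα k) (hd k)
  have h1 : ∀ t, ∫ ω, utility (α k) (d k) (γ t ω k) ∂Pr ≤
      utility (α k) (d k) (∫ ω, γ t ω k ∂Pr) := fun t =>
    hconc.le_map_integral (f := fun ω => γ t ω k) (continuousOn_utility (hd k)) isClosed_Ici
      (.of_forall fun ω => (hp.γ_mem t ω k).1) (hp.integrable_γ t k) (hp.integrable_utility hd t k)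
  have h2 := hconc.le_map_sum (t := Finset.range T) (w := fun _ => (T : ℝ)⁻¹)
    (p := fun t => ∫ ω, γ t ω k ∂Pr) (fun _ _ => by positivity) (by simp [hT.ne'])
    (fun t _ => Set.mem_Ici.2 (integral_nonneg fun ω => (hp.γ_mem t ω k).1))
  simp only [smul_eq_mul, ← div_eq_inv_mul, ← Finset.sum_div] at h2
  exact (div_le_div_of_nonneg_right (Finset.sum_le_sum fun t _ => h1 t)
    (Nat.cast_nonneg _)).trans h2

theorem utility_le_average (hV : 0 < V) (hd : ∀ k, 0 < d k) {r : Fin K → ℝ}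
    {σb x : UserSet K → ℝ} (hr : ∀ k, r k ∈ Set.Icc (0 : ℝ) (sys.γmax k))
    (hσb : ∀ J, σb J ∈ Set.Icc (0 : ℝ) sys.σmax) (hsup : IsSupported sys r σb x) {T : ℕ}
    (hT : 0 < T) :
    ∑ k, utility (α k) (d k) (r k) - sys.B / V - (∫ ω, lyapunov sys c U₀ γ 0 ω ∂Pr) / V / T ≤
      ∑ k, (∑ t ∈ Finset.range T, ∫ ω, utility (α k) (d k) (γ t ω k) ∂Pr) / T := by
  have hc := hp.admissible
  have hT' : (0 : ℝ) < T := Nat.cast_pos.2 hT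
  set G := ∑ k, utility (α k) (d k) (r k)
  have h1 : ∀ t, ∫ ω, lyapunov sys c U₀ γ (t + 1) ω ∂Pr ≤ ∫ ω, lyapunov sys c U₀ γ t ω ∂Pr +
      sys.B + V * (∑ k, ∫ ω, utility (α k) (d k) (γ t ω k) ∂Pr - G) := by
    intro t
    -- Both the auxiliary rates and the admissions are compared with `r`, so the virtual queue terms
    -- cancel; support makes the other queue terms nonpositive.
    have h := hp.drift_le hd t hr hr hσb (hp.sum_mul_le_of_mem_closure t hsup.1)
    have h2 : ∑ k, (∫ ω, virtualQueue U₀ c.a γ t ω k ∂Pr) * (r k - r k) = 0 := by simp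
    have h3 : ∑ k, (∫ ω, (c.S t ω k : ℝ) ∂Pr) *
        (r k - ∑ J : UserSet K with k ∈ J.1, σb J) ≤ 0 :=
      Finset.sum_nonpos fun k _ => mul_nonpos_of_nonneg_of_nonpos
        (integral_nonneg fun _ => Nat.cast_nonneg _) (sub_nonpos.2 (hsup.2.1 k))
    have h4 : ∑ I, (∫ ω, c.Q sys t ω I ∂Pr) / sys.F ^ 2 *
        (∑ J : UserSet K with I.1 ⊆ J.1, sys.b J I * σb J - sys.Tslot * x I) ≤ 0 :=
      Finset.sum_nonpos fun I _ => mul_nonpos_of_nonneg_of_nonpos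
        (div_nonneg (integral_nonneg fun ω => hc.Q_nonneg t ω I) (sq_nonneg _))
        (sub_nonpos.2 (hsup.2.2 I))
    rw [Finset.sum_sub_distrib] at h
    linarith
  have h2 : ∀ T : ℕ, ∫ ω, lyapunov sys c U₀ γ T ω ∂Pr ≤ ∫ ω, lyapunov sys c U₀ γ 0 ω ∂Pr +
      T * (sys.B - V * G) +
      V * ∑ t ∈ Finset.range T, ∑ k, ∫ ω, utility (α k) (d k) (γ t ω k) ∂Pr := by
    intro T
    induction T with
    | zero => simp
    | succ T ih =>
      rw [Finset.sum_range_succ]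
      have := h1 T
      push_cast
      linarith
  have h3 : 0 ≤ ∫ ω, lyapunov sys c U₀ γ T ω ∂Pr :=
    integral_nonneg fun ω => lyapunov_nonneg sys c U₀ γ T ω
  rw [← Finset.sum_div, Finset.sum_comm, le_div_iff₀ hT']
  have h4 := h3.trans (h2 T)
  have e : (G - sys.B / V - (∫ ω, lyapunov sys c U₀ γ 0 ω ∂Pr) / V / T) * T =
      (V * G * T - sys.B * T - ∫ ω, lyapunov sys c U₀ γ 0 ω ∂Pr) / V := by
    field_simp
  rw [e, div_le_iff₀ hV]
  linarith

/-- The utilities of the mean deliveries are asymptotically within `B / V` of those of supported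
rates. -/
theorem exists_utility_le (hV : 0 < V) (hα : ∀ k, 0 ≤ α k) (hd : ∀ k, 0 < d k) {r : Fin K → ℝ}
    (h : r ∈ stableRates sys ∨ ((∀ k, sys.γmax k ≤ sys.σmax) ∧ r ∈ feasibleRates sys)) :
    ∃ l : ℕ → ℝ, Tendsto l atTop
        (nhds (∑ k, utility (α k) (d k) (r k) - sys.B / V)) ∧
      ∀ᶠ T in atTop, l T ≤ ∑ k, utility (α k) (d k) (meanDelivery sys Pr c k T) := by
  obtain ⟨hr, σb, x, hσb, hsup⟩ := exists_isSupported h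
  choose δ hδ0 hδ hle using hp.exists_average_le_meanDelivery hV hd
  refine ⟨fun T => ∑ k, utility (α k) (d k) (r k) - sys.B / V -
    (∫ ω, lyapunov sys c U₀ γ 0 ω ∂Pr) / V / T - ∑ k, d k ^ (-α k) * δ k T, ?_, ?_⟩
  · have h1 := (tendsto_const_nhds (x := ∑ k, utility (α k) (d k) (r k) - sys.B / V)).sub
      (tendsto_const_div_atTop_nhds_zero_nat ((∫ ω, lyapunov sys c U₀ γ 0 ω ∂Pr) / V))
    have h2 := h1.sub (tendsto_finsetSum Finset.univ fun k _ => (hδ0 k).const_mul (d k ^ (-α k)))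
    simpa using h2
  · filter_upwards [eventually_gt_atTop 0] with T hT
    have h1 := hp.utility_le_average hV hd hr hσb hsup hT
    have h2 : ∀ k, (∑ t ∈ Finset.range T, ∫ ω, utility (α k) (d k) (γ t ω k) ∂Pr) / T ≤
        utility (α k) (d k) (meanDelivery sys Pr c k T) + d k ^ (-α k) * δ k T := fun k =>
      (hp.average_integral_utility_le hα hd k hT).trans (utility_le_add (hα k) (hd k)
        (meanDelivery_nonneg sys Pr c k T) (div_nonneg (Finset.sum_nonneg fun t _ =>
          integral_nonneg fun ω => (hp.γ_mem t ω k).1) (Nat.cast_nonneg _)) (hδ k T) (hle k T))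
    have h3 := Finset.sum_le_sum fun k (_ : k ∈ Finset.univ) => h2 k
    rw [Finset.sum_add_distrib] at h3
    linarith

theorem integral_totalQueue (t : ℕ) : ∫ ω, totalQueue sys c U₀ γ t ω ∂Pr =
    ∑ k, (∫ ω, virtualQueue U₀ c.a γ t ω k ∂Pr + ∫ ω, (c.S t ω k : ℝ) ∂Pr) +
      ∑ I, (∫ ω, c.Q sys t ω I ∂Pr) / sys.F ^ 2 := by
  have hc := hp.admissible
  have i1 : ∀ k ∈ Finset.univ, Integrable (fun ω => virtualQueue U₀ c.a γ t ω k +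
      (c.S t ω k : ℝ)) Pr := fun k _ => (hp.integrable_U t k).add (hc.integrable_S t k)
  have i2 : ∀ I ∈ Finset.univ, Integrable (fun ω => c.Q sys t ω I / sys.F ^ 2) Pr :=
    fun I _ => (hc.integrable_Q t I).div_const _
  unfold totalQueue
  rw [integral_add (integrable_finsetSum _ i1) (integrable_finsetSum _ i2),
    integral_finsetSum _ i1, integral_finsetSum _ i2]
  congr 1
  · exact Finset.sum_congr rfl fun k _ => integral_add (hp.integrable_U t k) (hc.integrable_S t k)
  · exact Finset.sum_congr rfl fun I _ => integral_div _ _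

theorem limsup_totalQueue_le_of_isSlack (hV : 0 < V) (hd : ∀ k, 0 < d k) {ε : ℝ} (hε : 0 < ε)
    (hs : sys.IsSlack ε) :
    limsup (fun T : ℕ =>
      (((∑ t ∈ Finset.range T, ∫ ω, totalQueue sys c U₀ γ t ω ∂Pr) / T : ℝ) : EReal)) atTop ≤
    (((sys.B + V * ∑ k, (utility (α k) (d k) (sys.γmax k) - utility (α k) (d k) 0)) / ε : ℝ)
      : EReal) := by
  have hc := hp.admissible
  obtain ⟨ab, σb, r, hrm, hr, hab, hσb, hεa, hS, hQ⟩ := hs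
  set C := sys.B + V * ∑ k, (utility (α k) (d k) (sys.γmax k) - utility (α k) (d k) 0)
  have h1 : ∀ t, ∫ ω, lyapunov sys c U₀ γ (t + 1) ω ∂Pr ≤ ∫ ω, lyapunov sys c U₀ γ t ω ∂Pr +
      C - ε * ∫ ω, totalQueue sys c U₀ γ t ω ∂Pr := by
    intro t
    -- Zero auxiliary rates against admissions of at least `ε` give the virtual queues slack `ε`
    -- too; the price is the utility at zero in `C`.
    have h := hp.drift_le hd t (γb := fun _ => 0) (fun k => ⟨le_rfl, Nat.cast_nonneg _⟩)
      (fun k => ⟨hε.le.trans (hεa k), hab k⟩) hσb (hp.sum_mul_le_of_mem_closure t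
        (subset_closure (sys.mean_mem_meanRates hrm hr)))
    have h2 : V * ∑ k, (∫ ω, utility (α k) (d k) (γ t ω k) ∂Pr - utility (α k) (d k) 0) ≤
        V * ∑ k, (utility (α k) (d k) (sys.γmax k) - utility (α k) (d k) 0) :=
      mul_le_mul_of_nonneg_left (Finset.sum_le_sum fun k _ =>
        sub_le_sub_right (hp.integral_utility_le hd t k) _) hV.le
    have h3 : ∑ k, (∫ ω, virtualQueue U₀ c.a γ t ω k ∂Pr) * (0 - ab k) ≤
        ∑ k, (∫ ω, virtualQueue U₀ c.a γ t ω k ∂Pr) * (-ε) :=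
      Finset.sum_le_sum fun k _ => mul_le_mul_of_nonneg_left (by linarith [hεa k])
        (integral_nonneg fun ω => hp.U_nonneg t ω k)
    have h4 : ∑ k, (∫ ω, (c.S t ω k : ℝ) ∂Pr) *
        (ab k - ∑ J : UserSet K with k ∈ J.1, σb J) ≤
        ∑ k, (∫ ω, (c.S t ω k : ℝ) ∂Pr) * (-ε) :=
      Finset.sum_le_sum fun k _ => mul_le_mul_of_nonneg_left (by linarith [hS k])
        (integral_nonneg fun _ => Nat.cast_nonneg _)
    have h5 : ∑ I, (∫ ω, c.Q sys t ω I ∂Pr) / sys.F ^ 2 *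
        (∑ J : UserSet K with I.1 ⊆ J.1, sys.b J I * σb J - sys.Tslot * ∫ h, r h I ∂sys.ν) ≤
        ∑ I, (∫ ω, c.Q sys t ω I ∂Pr) / sys.F ^ 2 * (-ε) :=
      Finset.sum_le_sum fun I _ => mul_le_mul_of_nonneg_left (by linarith [hQ I])
        (div_nonneg (integral_nonneg fun ω => hc.Q_nonneg t ω I) (sq_nonneg _))
    rw [hp.integral_totalQueue, Finset.sum_add_distrib]
    rw [← Finset.sum_mul] at h3 h4 h5
    linarith
  have h2 : ∀ T : ℕ, ∫ ω, lyapunov sys c U₀ γ T ω ∂Pr ≤ ∫ ω, lyapunov sys c U₀ γ 0 ω ∂Pr +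
      T * C - ε * ∑ t ∈ Finset.range T, ∫ ω, totalQueue sys c U₀ γ t ω ∂Pr := by
    intro T
    induction T with
    | zero => simp
    | succ T ih =>
      rw [Finset.sum_range_succ]
      have := h1 T
      push_cast
      linarith
  have hlim : Tendsto (fun T : ℕ => C / ε + (∫ ω, lyapunov sys c U₀ γ 0 ω ∂Pr) / ε / T) atTop
      (nhds (C / ε)) := by
    simpa using (tendsto_const_nhds (x := C / ε)).add
      (tendsto_const_div_atTop_nhds_zero_nat ((∫ ω, lyapunov sys c U₀ γ 0 ω ∂Pr) / ε))
  rw [← ((continuous_coe_real_ereal.tendsto _).comp hlim).limsup_eq]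
  refine limsup_le_limsup ?_
  filter_upwards [eventually_gt_atTop 0] with T hT
  have hT' : (0 : ℝ) < T := Nat.cast_pos.2 hT
  refine EReal.coe_le_coe_iff.2 ?_
  have h3 : 0 ≤ ∫ ω, lyapunov sys c U₀ γ T ω ∂Pr :=
    integral_nonneg fun ω => lyapunov_nonneg sys c U₀ γ T ω
  have h4 := h3.trans (h2 T)
  rw [div_le_iff₀ hT']
  have e : (C / ε + (∫ ω, lyapunov sys c U₀ γ 0 ω ∂Pr) / ε / T) * T =
      (T * C + ∫ ω, lyapunov sys c U₀ γ 0 ω ∂Pr) / ε := by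
    field_simp
  rw [e, le_div_iff₀ hε]
  linarith

theorem limsup_totalQueue_le (hK : 0 < K) (hV : 0 < V) (hd : ∀ k, 0 < d k) (h0 : 0 < sys.eps0) :
    limsup (fun T : ℕ =>
      (((∑ t ∈ Finset.range T, ∫ ω, totalQueue sys c U₀ γ t ω ∂Pr) / T : ℝ) : EReal)) atTop ≤
    (((sys.B + V * ∑ k, (utility (α k) (d k) (sys.γmax k) - utility (α k) (d k) 0)) / sys.eps0
      : ℝ) : EReal) := by
  -- The real supremum of the empty set is zero, so positivity of `eps0` forces a slack to exist.
  have hne : {ε : ℝ | sys.IsSlack ε}.Nonempty := by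
    by_contra hemp
    rw [Set.not_nonempty_iff_eq_empty] at hemp
    rw [System.eps0, hemp, Real.sSup_empty] at h0
    exact h0.false
  have hbdd : BddAbove {ε : ℝ | sys.IsSlack ε} := by
    -- Any user bounds the slack through its admissions; this is where at least one user is needed.
    refine ⟨sys.γmax ⟨0, hK⟩, ?_⟩
    rintro ε ⟨ab, σb, r, -, -, hab, -, hεa, -⟩
    exact (hεa _).trans (hab _)
  -- The supremum need not be attained, so the bound is passed to the limit along slacks tending to
  -- `eps0`.
  obtain ⟨u, -, hu, hmem⟩ := exists_seq_tendsto_sSup hne hbdd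
  have hlim := (continuous_coe_real_ereal.tendsto _).comp ((tendsto_const_nhds (x := sys.B +
    V * ∑ k, (utility (α k) (d k) (sys.γmax k) - utility (α k) (d k) 0))).div hu h0.ne')
  refine ge_of_tendsto hlim ?_
  filter_upwards [hu.eventually (lt_mem_nhds h0)] with n hn
  exact hp.limsup_totalQueue_le_of_isSlack hV hd hn (hmem n)

end IsProposed

end CodedCaching

open CodedCaching in
theorem theorem4 {K : ℕ} (hK : 0 < K) (sys : System K) (V : ℝ) (hV : 0 < V)
    (α d : Fin K → ℝ) (hα : ∀ k, 0 ≤ α k) (hd : ∀ k, 0 < d k)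
    {Ω : Type*} [mΩ : MeasurableSpace Ω] (Pr : Measure Ω) [IsProbabilityMeasure Pr]
    (ℱ : Filtration ℕ mΩ) (c : Trajectory K Ω)
    (U₀ : Ω → Fin K → ℝ) (γ : ℕ → Ω → Fin K → ℝ)
    (hc : IsProposed sys V α d Pr ℱ c U₀ γ) :
    (∀ r : Fin K → ℝ,
      (r ∈ stableRates sys ∨ ((∀ k, sys.γmax k ≤ sys.σmax) ∧ r ∈ feasibleRates sys)) →
      (((∑ k, utility (α k) (d k) (r k) - sys.B / V : ℝ) : EReal) ≤
        liminf (fun T : ℕ =>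
          ((∑ k, utility (α k) (d k) (meanDelivery sys Pr c k T) : ℝ) : EReal)) atTop) ∧
      (∀ rπ : Fin K → ℝ, (∀ k, Tendsto (meanDelivery sys Pr c k) atTop (nhds (rπ k))) →
        ∑ k, utility (α k) (d k) (r k) - sys.B / V ≤ ∑ k, utility (α k) (d k) (rπ k))) ∧
    (0 < sys.eps0 →
      limsup (fun T : ℕ =>
          (((∑ t ∈ Finset.range T, ∫ ω, totalQueue sys c U₀ γ t ω ∂Pr) / T : ℝ) : EReal)) atTop ≤
        (((sys.B + V * ∑ k, (utility (α k) (d k) (sys.γmax k) - utility (α k) (d k) 0)) / sys.eps0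
          : ℝ) : EReal) ∧
      ((∀ k, α k ≤ 1) →
        limsup (fun T : ℕ =>
          (((∑ t ∈ Finset.range T, ∫ ω, totalQueue sys c U₀ γ t ω ∂Pr) / T : ℝ) : EReal)) atTop ≤
        (((sys.B + V * ∑ k, utility (α k) (d k) (sys.γmax k)) / sys.eps0 : ℝ) : EReal))) := by
  refine ⟨fun r hr => ?_, fun h0 => ?_⟩
  · obtain ⟨l, hl, hle⟩ := hc.exists_utility_le hV hα hd hr
    refine ⟨?_, fun rπ hrπ => ?_⟩
    · rw [← ((continuous_coe_real_ereal.tendsto _).comp hl).liminf_eq]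
      exact liminf_le_liminf (hle.mono fun T hT => EReal.coe_le_coe_iff.2 hT)
    · refine le_of_tendsto_of_tendsto hl (tendsto_finsetSum _ fun k _ => ?_) hle
      have hk : 0 ≤ rπ k := ge_of_tendsto' (hrπ k) (meanDelivery_nonneg sys Pr c k)
      exact ((hasDerivAt_utility (hd k) (by linarith [hd k])).continuousAt.tendsto).comp (hrπ k)
  · have h1 := hc.limsup_totalQueue_le hK hV hd h0
    refine ⟨h1, fun hα1 => h1.trans (EReal.coe_le_coe_iff.2 ?_)⟩
    refine div_le_div_of_nonneg_right ?_ h0.le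
    have := mul_le_mul_of_nonneg_left (Finset.sum_le_sum fun k (_ : k ∈ Finset.univ) =>
      sub_le_self (utility (α k) (d k) (sys.γmax k)) (utility_zero_nonneg (hα1 k) (hd k))) hV.le
    linarith
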